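/- All operads are coloured symmetric operads in sets, with set of colours $\mathbb N^3$; a colour $(p,q,r)$ is viewed as a box with left label $p$, $q$ inputs on top and right label $r$. **The operad $\Box p$.** It is presented by the following generators and relations. For all $n\ge 0$, $p_0,\dots,p_n,q_1,\dots,q_n,p,r\in\mathbb N$ there is a generator $$C^{p_0,\dots,p_n;p,r}_{q_1,\dots,q_n}\in\Box p\Big((p,n,r),(p_0,q_1,p_1),\dots,(p_{n-1},q_n,p_n);\,(p+p_0,\textstyle\sum_i q_i,r+p_n)\Big),$$ and there is a generator $\eta\in\Box p(\,;(0,1,0))$. The relations are: 1. (associativity) for all $n\ge 0$, $p,r,p_0,\dots,p_n\in\mathbb N$, $m_1,\dots,m_n\in\mathbb N$ with $M_i=m_1+\dots+m_i$ and $M=M_n$, all $p'_0,\dots,p'_M\in\mathbb N$ and all $q^i_j\in\mathbb N$ ($1\le i\le n$, $1\le j\le m_i$), $$C^{p'_0,\dots,p'_M;\,p+p_0,\,r+p_n}_{q^1_1,\dots,q^n_{m_n}}\circ_1 C^{p_0,\dots,p_n;p,r}_{m_1,\dots,m_n}=\Big(C^{p_0+p'_{M_0},\,p_1+p'_{M_1},\dots,\,p_n+p'_{M_n};\,p,r}_{\sum_j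 q^1_j,\dots,\sum_j q^n_j}\circ\big(-,D_1,\dots,D_n\big)\Big)^{\sigma},$$ where $D_i=C^{p'_{M_{i-1}},\dots,p'_{M_i};\,p_{i-1},p_i}_{q^i_1,\dots,q^i_{m_i}}$ and $\sigma$ is the shuffle identifying the inputs $(x;(x_1;x^1_1,\dots,x^1_{m_1}),\dots,(x_n;x^n_1,\dots,x^n_{m_n}))$ with $((x;x_1,\dots,x_n);x^1_1,\dots,x^n_{m_n})$; 2. (units) $C^{p,r;0,0}_{q}\circ_1\eta=1_{(p,q,r)}$ for all $p,q,r$, and $C^{0,\dots,0;p,r}_{1,\dots,1}\circ(-,\eta,\dots,\eta)=1_{(p,n,r)}$ for all $p,n,r$ (with $n$ copies of $\eta$). **The operad $\mathrm{Stack}$.** An element of $\mathrm{Stack}((p_1,q_1,r_1),\dots,(p_n,q_n,r_n);(p,q,r))$ (an admissible stacking) is a planar rooted tree with vertex set $\{1,\dots,n\}$ in which every internal (non-leaf) vertex $i$ has exactly $q_i$ children, in which $\sum_{i\text{ leaf}}q_i=q$, and for which there are start values $s_i\in\mathbb N$ ($i$ a leaf), with $s_i=0$ whenever $q_i>0$,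 such that the depths defined by $dL(i)=s_i+p_i$, $dR(i)=s_i+r_i$ for a leaf $i$, and $dL(i)=dL(b)+p_i$, $dR(i)=dR(c)+r_i$ for an internal vertex $i$ with leftmost child $b$ and rightmost child $c$, satisfy: $dR(b)=dL(c)$ for any two adjacent children $b,c$ ($c$ next to the right of $b$) of a vertex, and $dL(u)=p$, $dR(u)=r$ for the root $u$. The symmetric groups act by renaming vertices, and composition is substitution of trees in vertices: a vertex $i$ is replaced by a tree $T_i$, and the children of $i$, if there are any, are put from left to right on the leaves of $T_i$, each leaf $v$ of $T_i$ receiving $q_v$ of them. The unit of colour $c$ is the tree with the single vertex $c$. **The operad $\mathrm{Stack}[\eta]$.** It is the operad generated by the operad $\mathrm{Stack}$ (so that composition, units and symmetric group actions of $\mathrm{Stack}$ are respected) and a formal element $\eta\in\mathrm{Stack}[\eta](\,;(0,1,0))$, subject to the following relations for stackings $T$: 1. if $i$ is an internal vertex of $T$, of colour $(0,1,0)$, with exactly one child $j$, then inserting $\eta$ in $i$ gives the stacking $T'$ obtained from $T$ by contracting the vertices $i$ and $j$ to one vertex, named $j$; 2. if $j_1,\dots,j_m$ ($m\ge 1$)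 are the children of an internal vertex $i$ of $T$, all of colour $(0,1,0)$, and contracting $i,j_1,\dots,j_m$ to one vertex, named $i$, gives an admissible stacking $T'$, then inserting $\eta$ in all of $j_1,\dots,j_m$ gives $T'$. **Theorem.** The $\mathbb N^3$-coloured symmetric operads $\Box p$ and $\mathrm{Stack}[\eta]$ are isomorphic (by an isomorphism that is the identity on colours). -/

import Mathlib

/-- The canonical bijection `{*} × I ≃ I`, with the product written as a disjoint union. -/
def sigmaUnitEquiv (I : Type) : (Σ _ : Unit, I) ≃ I where
  toFun p := p.2
  invFun i := ⟨(), i⟩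
  left_inv _ := rfl
  right_inv _ := rfl

universe u v w

/-- A coloured symmetric operad (in sets) with set of colours `C`.  For a finite set `I` of inputs,
input colours `a : I → C` and output colour `d`, there is a set `Op I a d` of operations; for
`I = {1, …, n}` this is the set usually written `P(a₁, …, aₙ; d)`.  The symmetric group actions are
encoded by relabelling of the inputs along bijections of finite sets (for `I = J = {1, …, n}` the
actions of the permutations of `{1, …, n}`), and composition is total composition
`x ∘ (y₁, …, yₙ)`, the inputs of the composite being the pairs (input `i` of `x`, input of `y i`). -/
structure ColouredOperad (C : Type v) where
  /-- operations with inputs `I`, input colours `a` and output colour `d` -/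
  Op : (I : Type) → [Finite I] → (I → C) → C → Type u
  /-- the operadic unit of colour `c` -/
  one : (c : C) → Op Unit (fun _ => c) c
  /-- the symmetric structure -/
  act : ∀ {I J : Type} [Finite I] [Finite J] {b : J → C} {d : C} (e : I ≃ J),
    Op I (fun i => b (e i)) d → Op J b d
  /-- composition -/
  comp : ∀ {I : Type} {J : I → Type} [Finite I] [∀ i, Finite (J i)] {a : I → C}
    {b : ∀ i, J i → C} {d : C},
    Op I a d → (∀ i, Op (J i) (b i) (a i)) → Op (Σ i, J i) (fun p => b p.1 p.2) d
  act_refl : ∀ {I : Type} [Finite I] {a : I → C} {d : C} (x : Op I a d),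
    act (Equiv.refl I) x = x
  act_act : ∀ {I J K : Type} [Finite I] [Finite J] [Finite K] {c : K → C} {d : C}
    (e : I ≃ J) (f : J ≃ K) (x : Op I (fun i => c (f (e i))) d),
    act f (act (b := fun j => c (f j)) e x) = act (e.trans f) x
  /-- equivariance in the outer operation -/
  comp_act : ∀ {I K : Type} {J : K → Type} [Finite I] [Finite K] [∀ k, Finite (J k)]
    {a : K → C} {b : ∀ k, J k → C} {d : C} (e : I ≃ K) (x : Op I (fun i => a (e i)) d)
    (y : ∀ k, Op (J k) (b k) (a k)),
    comp (act e x) y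
      = act (Equiv.sigmaCongrLeft (β := J) e) (comp (J := fun i => J (e i)) x (fun i => y (e i)))
  /-- equivariance in the inner operations -/
  comp_act_inner : ∀ {I : Type} {J K : I → Type} [Finite I] [∀ i, Finite (J i)]
    [∀ i, Finite (K i)] {a : I → C} {b : ∀ i, K i → C} {d : C} (e : ∀ i, J i ≃ K i)
    (x : Op I a d) (y : ∀ i, Op (J i) (fun j => b i (e i j)) (a i)),
    comp x (fun i => act (e i) (y i)) = act (Equiv.sigmaCongrRight e) (comp x y)
  one_comp : ∀ {I : Type} [Finite I] {a : I → C} {d : C} (x : Op I a d),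
    act (sigmaUnitEquiv I) (comp (one d) (fun _ => x)) = x
  comp_one : ∀ {I : Type} [Finite I] {a : I → C} {d : C} (x : Op I a d),
    act (Equiv.sigmaPUnit I) (comp x (fun i => one (a i))) = x
  comp_assoc : ∀ {I : Type} {J : I → Type} {K : ∀ i, J i → Type} [Finite I] [∀ i, Finite (J i)]
    [∀ i j, Finite (K i j)] {a : I → C} {b : ∀ i, J i → C} {c : ∀ i j, K i j → C} {d : C}
    (x : Op I a d) (y : ∀ i, Op (J i) (b i) (a i)) (z : ∀ i j, Op (K i j) (c i j) (b i j)),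
    act (Equiv.sigmaAssoc K) (comp (comp x y) (fun p => z p.1 p.2))
      = comp x (fun i => comp (y i) (fun j => z i j))

namespace ColouredOperad

/-- An isomorphism of `C`-coloured symmetric operads (identity on colours): bijections between the
sets of operations compatible with units, symmetric structure and composition. -/
structure Iso {C : Type v} (P : ColouredOperad.{u} C) (Q : ColouredOperad.{w} C) where
  /-- the underlying bijections -/
  toEquiv : ∀ (I : Type) [Finite I] (a : I → C) (d : C), P.Op I a d ≃ Q.Op I a d
  map_one : ∀ c : C, toEquiv Unit (fun _ => c) c (P.one c) = Q.one c
  map_act : ∀ {I J : Type} [Finite I] [Finite J] {b : J → C} {d : C} (e : I ≃ J)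
    (x : P.Op I (fun i => b (e i)) d),
    toEquiv J b d (P.act e x) = Q.act e (toEquiv I _ d x)
  map_comp : ∀ {I : Type} {J : I → Type} [Finite I] [∀ i, Finite (J i)] {a : I → C}
    {b : ∀ i, J i → C} {d : C} (x : P.Op I a d) (y : ∀ i, P.Op (J i) (b i) (a i)),
    toEquiv _ _ d (P.comp x y)
      = Q.comp (toEquiv I a d x) (fun i => toEquiv (J i) (b i) (a i) (y i))

/-- Formal operadic expressions in generators `G`, where `G I a d` is the set of generators with
inputs `I`, input colours `a` and output colour `d`. -/
inductive Term {C : Type v} (G : (I : Type) → (I → C) → C → Type u) :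
    (I : Type) → (I → C) → C → Type (max 1 u v)
  | gen {I : Type} {a : I → C} {d : C} (g : G I a d) : Term G I a d
  | one (c : C) : Term G Unit (fun _ => c) c
  | act {I J : Type} [Finite I] [Finite J] {b : J → C} {d : C} (e : I ≃ J)
      (x : Term G I (fun i => b (e i)) d) : Term G J b d
  | comp {I : Type} {J : I → Type} [Finite I] [∀ i, Finite (J i)] {a : I → C}
      {b : ∀ i, J i → C} {d : C} (x : Term G I a d) (y : ∀ i, Term G (J i) (b i) (a i)) :
      Term G (Σ i, J i) (fun p => b p.1 p.2) d

/-- The smallest operadic congruence on formal expressions that contains the relations `R`: it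
contains `R`, is an equivalence relation, is compatible with relabelling and composition, and
contains all instances of the axioms of a coloured symmetric operad. -/
inductive Rel {C : Type v} {G : (I : Type) → (I → C) → C → Type u}
    (R : ∀ (I : Type) (a : I → C) (d : C), Term G I a d → Term G I a d → Prop) :
    ∀ (I : Type) (a : I → C) (d : C), Term G I a d → Term G I a d → Prop
  | of {I : Type} {a : I → C} {d : C} {x y : Term G I a d} (h : R I a d x y) : Rel R I a d x y
  | refl {I : Type} {a : I → C} {d : C} (x : Term G I a d) : Rel R I a d x x
  | symm {I : Type} {a : I → C} {d : C} {x y : Term G I a d} (h : Rel R I a d x y) :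
      Rel R I a d y x
  | trans {I : Type} {a : I → C} {d : C} {x y z : Term G I a d} (h : Rel R I a d x y)
      (h' : Rel R I a d y z) : Rel R I a d x z
  | act_congr {I J : Type} [Finite I] [Finite J] {b : J → C} {d : C} (e : I ≃ J)
      {x x' : Term G I (fun i => b (e i)) d} (h : Rel R I _ d x x') :
      Rel R J b d (.act e x) (.act e x')
  | comp_congr {I : Type} {J : I → Type} [Finite I] [∀ i, Finite (J i)] {a : I → C}
      {b : ∀ i, J i → C} {d : C} {x x' : Term G I a d} {y y' : ∀ i, Term G (J i) (b i) (a i)}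
      (h : Rel R I a d x x') (h' : ∀ i, Rel R (J i) (b i) (a i) (y i) (y' i)) :
      Rel R (Σ i, J i) (fun p => b p.1 p.2) d (.comp x y) (.comp x' y')
  | act_refl {I : Type} [Finite I] {a : I → C} {d : C} (x : Term G I a d) :
      Rel R I a d (.act (Equiv.refl I) x) x
  | act_act {I J K : Type} [Finite I] [Finite J] [Finite K] {c : K → C} {d : C}
      (e : I ≃ J) (f : J ≃ K) (x : Term G I (fun i => c (f (e i))) d) :
      Rel R K c d (.act f (.act (b := fun j => c (f j)) e x)) (.act (e.trans f) x)
  | comp_act {I K : Type} {J : K → Type} [Finite I] [Finite K] [∀ k, Finite (J k)]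
      {a : K → C} {b : ∀ k, J k → C} {d : C} (e : I ≃ K) (x : Term G I (fun i => a (e i)) d)
      (y : ∀ k, Term G (J k) (b k) (a k)) :
      Rel R (Σ k, J k) (fun p => b p.1 p.2) d (.comp (.act e x) y)
        (.act (Equiv.sigmaCongrLeft (β := J) e)
          (.comp (J := fun i => J (e i)) x (fun i => y (e i))))
  | comp_act_inner {I : Type} {J K : I → Type} [Finite I] [∀ i, Finite (J i)]
      [∀ i, Finite (K i)] {a : I → C} {b : ∀ i, K i → C} {d : C} (e : ∀ i, J i ≃ K i)
      (x : Term G I a d) (y : ∀ i, Term G (J i) (fun j => b i (e i j)) (a i)) :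
      Rel R (Σ i, K i) (fun p => b p.1 p.2) d (.comp x (fun i => .act (e i) (y i)))
        (.act (Equiv.sigmaCongrRight e) (.comp x y))
  | one_comp {I : Type} [Finite I] {a : I → C} {d : C} (x : Term G I a d) :
      Rel R I a d (.act (sigmaUnitEquiv I) (.comp (.one d) (fun _ => x))) x
  | comp_one {I : Type} [Finite I] {a : I → C} {d : C} (x : Term G I a d) :
      Rel R I a d (.act (Equiv.sigmaPUnit I) (.comp x (fun i => .one (a i)))) x
  | comp_assoc {I : Type} {J : I → Type} {K : ∀ i, J i → Type} [Finite I] [∀ i, Finite (J i)]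
      [∀ i j, Finite (K i j)] {a : I → C} {b : ∀ i, J i → C} {c : ∀ i j, K i j → C} {d : C}
      (x : Term G I a d) (y : ∀ i, Term G (J i) (b i) (a i))
      (z : ∀ i j, Term G (K i j) (c i j) (b i j)) :
      Rel R (Σ i, Σ j, K i j) (fun p => c p.1 p.2.1 p.2.2) d
        (.act (Equiv.sigmaAssoc K) (.comp (.comp x y) (fun p => z p.1 p.2)))
        (.comp x (fun i => .comp (y i) (fun j => z i j)))

/-- The set of formal expressions with the congruence generated by `R`. -/
def relSetoid {C : Type v} {G : (I : Type) → (I → C) → C → Type u}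
    (R : ∀ (I : Type) (a : I → C) (d : C), Term G I a d → Term G I a d → Prop)
    (I : Type) (a : I → C) (d : C) : Setoid (Term G I a d) where
  r := Rel R I a d
  iseqv := ⟨.refl, .symm, .trans⟩

/-- Composition in the operad presented by generators and relations. -/
noncomputable def presentedComp {C : Type v} {G : (I : Type) → (I → C) → C → Type u}
    (R : ∀ (I : Type) (a : I → C) (d : C), Term G I a d → Term G I a d → Prop)
    {I : Type} {J : I → Type} [Finite I] [∀ i, Finite (J i)] {a : I → C}
    {b : ∀ i, J i → C} {d : C} (x : Quotient (relSetoid R I a d))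
    (y : ∀ i, Quotient (relSetoid R (J i) (b i) (a i))) :
    Quotient (relSetoid R (Σ i, J i) (fun p => b p.1 p.2) d) :=
  Quotient.mk _ (.comp x.out (fun i => (y i).out))

theorem presentedComp_mk {C : Type v} {G : (I : Type) → (I → C) → C → Type u}
    (R : ∀ (I : Type) (a : I → C) (d : C), Term G I a d → Term G I a d → Prop)
    {I : Type} {J : I → Type} [Finite I] [∀ i, Finite (J i)] {a : I → C}
    {b : ∀ i, J i → C} {d : C} (x : Term G I a d) (y : ∀ i, Term G (J i) (b i) (a i)) :
    presentedComp R (Quotient.mk _ x) (fun i => Quotient.mk _ (y i))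
      = Quotient.mk _ (.comp x y) :=
  Quotient.sound (.comp_congr (Quotient.mk_out (s := relSetoid R I a d) x)
    (fun i => Quotient.mk_out (s := relSetoid R (J i) (b i) (a i)) (y i)))

/-- The coloured symmetric operad presented by generators `G` and relations `R`. -/
noncomputable def presented {C : Type v} (G : (I : Type) → (I → C) → C → Type u)
    (R : ∀ (I : Type) (a : I → C) (d : C), Term G I a d → Term G I a d → Prop) :
    ColouredOperad.{max 1 u v} C where
  Op I _ a d := Quotient (relSetoid R I a d)
  one c := Quotient.mk _ (.one c)
  act e := Quotient.map' (.act e) (fun _ _ h => .act_congr e h)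
  comp x y := presentedComp R x y
  act_refl x := by
    induction x using Quotient.inductionOn with | _ x
    exact Quotient.sound (.act_refl x)
  act_act e f x := by
    induction x using Quotient.inductionOn with | _ x
    exact Quotient.sound (.act_act e f x)
  comp_act {I K J} _ _ _ {a b d} e x y := by
    induction x using Quotient.inductionOn with | _ x
    obtain ⟨y, rfl⟩ : ∃ y', y = fun i => Quotient.mk _ (y' i) :=
      ⟨fun i => (y i).out, funext fun i => ((y i).out_eq).symm⟩
    refine Eq.trans (presentedComp_mk R _ _) ?_
    refine Eq.trans ?_ (congrArg _
      (presentedComp_mk R (J := fun i => J (e i)) x (fun i => y (e i))).symm)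
    exact Quotient.sound (.comp_act e x y)
  comp_act_inner e x y := by
    induction x using Quotient.inductionOn with | _ x
    obtain ⟨y, rfl⟩ : ∃ y', y = fun i => Quotient.mk _ (y' i) :=
      ⟨fun i => (y i).out, funext fun i => ((y i).out_eq).symm⟩
    refine Eq.trans (presentedComp_mk R x (fun i => .act (e i) (y i))) ?_
    refine Eq.trans ?_ (congrArg _ (presentedComp_mk R x y).symm)
    exact Quotient.sound (.comp_act_inner e x y)
  one_comp x := by
    induction x using Quotient.inductionOn with | _ x
    refine Eq.trans (congrArg _ (presentedComp_mk R (.one _) (fun _ => x))) ?_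
    exact Quotient.sound (.one_comp x)
  comp_one x := by
    induction x using Quotient.inductionOn with | _ x
    refine Eq.trans (congrArg _ (presentedComp_mk R x (fun _ => .one _))) ?_
    exact Quotient.sound (.comp_one x)
  comp_assoc {I J K} _ _ _ {a b c d} x y z := by
    induction x using Quotient.inductionOn with | _ x
    obtain ⟨y, rfl⟩ : ∃ y', y = fun i => Quotient.mk _ (y' i) :=
      ⟨fun i => (y i).out, funext fun i => ((y i).out_eq).symm⟩
    obtain ⟨z, rfl⟩ : ∃ z', z = fun i j => Quotient.mk _ (z' i j) :=
      ⟨fun i j => (z i j).out, funext fun i => funext fun j => ((z i j).out_eq).symm⟩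
    rw [presentedComp_mk]
    refine Eq.trans (congrArg _ (presentedComp_mk R (Term.comp x y)
      (J := fun p : Σ i, J i => K p.1 p.2) (b := fun p => c p.1 p.2) (fun p => z p.1 p.2))) ?_
    refine Eq.trans (Quotient.sound (.comp_assoc x y z)) ?_
    refine (presentedComp_mk R x (fun i => .comp (y i) (fun j => z i j))).symm.trans ?_
    refine congrArg (presentedComp R _) ?_
    funext i
    exact (presentedComp_mk R (y i) (z i)).symm

end ColouredOperad

namespace ColouredOperad

/-- The inputs of a composite `x ∘ (-, …, -, y₁, …, yₘ)`, where `x` has inputs `K ⊕ E`, the inputs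
in `K` are left open and `y e`, with inputs `J e`, is inserted in the input `e : E`. -/
def fillEquiv (K : Type) {E : Type} (J : E → Type) :
    (Σ s : K ⊕ E, Sum.elim (fun _ => Unit) J s) ≃ K ⊕ Σ e, J e where
  toFun
    | ⟨.inl k, _⟩ => .inl k
    | ⟨.inr e, j⟩ => .inr ⟨e, j⟩
  invFun
    | .inl k => ⟨.inl k, ()⟩
    | .inr ⟨e, j⟩ => ⟨.inr e, j⟩
  left_inv := by rintro ⟨k | e, j⟩ <;> rfl
  right_inv := by rintro (k | ⟨e, j⟩) <;> rfl

instance finite_fill (K : Type) {E : Type} (J : E → Type) [h : ∀ e, Finite (J e)]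
    (s : K ⊕ E) : Finite (Sum.elim (fun _ => Unit) J s) :=
  match s with
  | .inl _ => inferInstanceAs (Finite Unit)
  | .inr e => h e

/-- The composite `x ∘ (-, …, -, y₁, …, yₘ)`: the inputs in `K` are left open (they are filled by
the operadic unit) and `y e` is inserted in the input `e : E`. -/
def Term.fill {C : Type v} {G : (I : Type) → (I → C) → C → Type u} {K E : Type} [Finite K]
    [Finite E] {J : E → Type} [∀ e, Finite (J e)] {c : K ⊕ (Σ e, J e) → C} {b : E → C} {d : C}
    (x : Term G (K ⊕ E) (Sum.elim (fun k => c (.inl k)) b) d)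
    (y : ∀ e, Term G (J e) (fun j => c (.inr ⟨e, j⟩)) (b e)) :
    Term G (K ⊕ Σ e, J e) c d :=
  .act (fillEquiv K J) (.comp (J := Sum.elim (fun _ => Unit) J)
    (b := fun s j => c (fillEquiv K J ⟨s, j⟩)) x
    (fun | .inl k => .one (c (.inl k)) | .inr e => y e))

/-- The inputs of `x ∘ (-, …, -, h, …, h)`, where `h` has no inputs. -/
def plugEquiv (K E : Type) : (K ⊕ Σ _ : E, Empty) ≃ K where
  toFun
    | .inl k => k
    | .inr ⟨_, z⟩ => z.elim
  invFun := .inl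
  left_inv := by rintro (k | ⟨_, ⟨⟩⟩); rfl
  right_inv _ := rfl

/-- The composite `x ∘ (-, …, -, h, …, h)` in which an operation `h` without inputs is inserted in
all inputs in `E`; its inputs are those in `K`. -/
def Term.plug {C : Type v} {G : (I : Type) → (I → C) → C → Type u} {K E : Type} [Finite K]
    [Finite E] {a : K → C} {u d : C} (x : Term G (K ⊕ E) (Sum.elim a (fun _ => u)) d)
    (h : ∀ z : Empty → C, Term G Empty z u) : Term G K a d :=
  .act (plugEquiv K E)
    (Term.fill (c := fun s => a (plugEquiv K E s)) x (fun _ => h _))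

end ColouredOperad

namespace BoxOp

open ColouredOperad

/-- Colours `(p, q, r)` of boxes. -/
abbrev Colour : Type := ℕ × ℕ × ℕ

/-- The generators of the box operad:
* `C^{P 0, …, P n; p, r}_{q 0, …, q (n-1)}`, with `1 + n` inputs: the bottom box `inl ()`, of colour
  `(p, n, r)`, and the top boxes `inr i`, of colours `(P i, q i, P (i+1))`; its output colour is
  `(p + P 0, ∑ q i, r + P n)`;
* the unit `η`, without inputs, of output colour `(0, 1, 0)`. -/
inductive BoxGen : (I : Type) → (I → Colour) → Colour → Type
  | C {n : ℕ} (P : Fin (n + 1) → ℕ) (p r : ℕ) (q : Fin n → ℕ) {a : Unit ⊕ Fin n → Colour}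
      {d : Colour} (bottom : a (.inl ()) = (p, n, r))
      (top : ∀ i, a (.inr i) = (P i.castSucc, q i, P i.succ))
      (output : d = (p + P 0, ∑ i, q i, r + P (Fin.last n))) : BoxGen (Unit ⊕ Fin n) a d
  | eta (z : Empty → Colour) : BoxGen Empty z (0, 1, 0)

/-- The number `m 0 + … + m (i-1)`. -/
def offset {n : ℕ} (m : Fin n → ℕ) (i : Fin (n + 1)) : ℕ :=
  ∑ k : Fin i, m (k.castLE (Nat.lt_succ_iff.mp i.2))

theorem offset_zero {n : ℕ} (m : Fin n → ℕ) : offset m 0 = 0 := rfl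

theorem offset_last {n : ℕ} (m : Fin n → ℕ) : offset m (Fin.last n) = ∑ i, m i := rfl

theorem offset_succ {n : ℕ} (m : Fin n → ℕ) (i : Fin n) :
    offset m i.succ = offset m i.castSucc + m i :=
  Fin.sum_univ_castSucc _

theorem offset_add_snd {n : ℕ} (m : Fin n → ℕ) (x : Fin (∑ i, m i)) :
    offset m (finSigmaFinEquiv.symm x).1.castSucc + (finSigmaFinEquiv.symm x).2 = x := by
  conv_rhs => rw [← finSigmaFinEquiv.apply_symm_apply x]
  exact (finSigmaFinEquiv_apply _).symm

theorem sum_flatten {n : ℕ} (m : Fin n → ℕ) (q : ∀ i, Fin (m i) → ℕ) :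
    ∑ x, q (finSigmaFinEquiv.symm x).1 (finSigmaFinEquiv.symm x).2 = ∑ i, ∑ j, q i j := by
  rw [← Fintype.sum_sigma' (fun i j => q i j)]
  exact Equiv.sum_comp finSigmaFinEquiv.symm (fun s : Σ i, Fin (m i) => q s.1 s.2)

/-- The shuffle
`((x; x₁, …, xₙ); x¹₁, …, xⁿ_{mₙ}) ↦ (x; (x₁; x¹₁, …, x¹_{m₁}), …, (xₙ; xⁿ₁, …, xⁿ_{mₙ}))`,
with the list `x¹₁, …, xⁿ_{mₙ}` numbered lexicographically. -/
def shuffle {n : ℕ} (m : Fin n → ℕ) :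
    (Fin (∑ i, m i) ⊕ Σ _ : Unit, Unit ⊕ Fin n) ≃ Unit ⊕ Σ i : Fin n, Unit ⊕ Fin (m i) where
  toFun
    | .inl x => .inr ⟨(finSigmaFinEquiv.symm x).1, .inr (finSigmaFinEquiv.symm x).2⟩
    | .inr ⟨_, .inl _⟩ => .inl ()
    | .inr ⟨_, .inr i⟩ => .inr ⟨i, .inl ()⟩
  invFun
    | .inl _ => .inr ⟨(), .inl ()⟩
    | .inr ⟨i, .inl _⟩ => .inr ⟨(), .inr i⟩
    | .inr ⟨i, .inr j⟩ => .inl (finSigmaFinEquiv ⟨i, j⟩)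
  left_inv := by
    rintro (x | ⟨⟨⟩, ⟨⟨⟩⟩ | i⟩)
    · simp
    · rfl
    · rfl
  right_inv := by
    rintro (⟨⟨⟩⟩ | ⟨i, ⟨⟨⟩⟩ | j⟩)
    · rfl
    · rfl
    · exact congrArg (fun s : Σ i : Fin n, Fin (m i) =>
          (Sum.inr ⟨s.1, Sum.inr s.2⟩ : Unit ⊕ Σ i : Fin n, Unit ⊕ Fin (m i)))
        (finSigmaFinEquiv.symm_apply_apply ⟨i, j⟩)

/-- The colours of the `1 + n + ∑ m i` boxes in the associativity relation: the bottom box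
`(p, n, r)`, the middle boxes `(P i, m i, P (i+1))` and, on top of the `i`-th middle box, the boxes
`(P' j', q i j, P' (j'+1))` with `j' = m 0 + … + m (i-1) + j`. -/
def assocColour {n : ℕ} (P : Fin (n + 1) → ℕ) (p r : ℕ) (m : Fin n → ℕ) (P' : ℕ → ℕ)
    (q : ∀ i, Fin (m i) → ℕ) : (Unit ⊕ Σ i : Fin n, Unit ⊕ Fin (m i)) → Colour
  | .inl _ => (p, n, r)
  | .inr ⟨i, .inl _⟩ => (P i.castSucc, m i, P i.succ)
  | .inr ⟨i, .inr j⟩ =>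
      (P' (offset m i.castSucc + j), q i j, P' (offset m i.castSucc + j + 1))

theorem assocColour_shuffle {n : ℕ} (P : Fin (n + 1) → ℕ) (p r : ℕ) (m : Fin n → ℕ)
    (P' : ℕ → ℕ) (q : ∀ i, Fin (m i) → ℕ) (x : Fin (∑ i, m i)) :
    assocColour P p r m P' q (shuffle m (.inl x))
      = (P' x, q (finSigmaFinEquiv.symm x).1 (finSigmaFinEquiv.symm x).2, P' (x + 1)) := by
  simp only [shuffle, assocColour, Equiv.coe_fn_mk, offset_add_snd]

/-- The relations of the box operad.
* `assoc`: `C_{q} ∘₁ C_{m} = (C_{∑ q} ∘ (-, C_{q 0}, …, C_{q (n-1)}))^σ` for `m : Fin n → ℕ`, where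
  the side labels of the topmost boxes are `P' 0, …, P' M` with `M = ∑ m i`; the right hand side
  has side labels `P i + P' (m 0 + … + m (i-1))` in its outer generator;
* `eta_bottom`: `C_q^{p,r;0,0} ∘₁ η = 1`;
* `eta_top`: `C_{1,…,1}^{0,…,0;p,r} ∘ (-, η, …, η) = 1`. -/
inductive BoxRel : ∀ (I : Type) (a : I → Colour) (d : Colour),
    Term BoxGen I a d → Term BoxGen I a d → Prop
  | assoc {n : ℕ} (P : Fin (n + 1) → ℕ) (p r : ℕ) (m : Fin n → ℕ) (P' : ℕ → ℕ)
      (q : ∀ i, Fin (m i) → ℕ) :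
      BoxRel (Unit ⊕ Σ i : Fin n, Unit ⊕ Fin (m i)) (assocColour P p r m P' q)
        (p + P 0 + P' 0, ∑ i, ∑ j, q i j, r + P (Fin.last n) + P' (∑ i, m i))
        (.act (shuffle m)
          (Term.fill (K := Fin (∑ i, m i)) (E := Unit) (J := fun _ => Unit ⊕ Fin n)
            (c := fun s => assocColour P p r m P' q (shuffle m s))
            (b := fun _ => (p + P 0, ∑ i, m i, r + P (Fin.last n)))
            (.act (Equiv.sumComm Unit (Fin (∑ i, m i)))
              (.gen (.C (fun j => P' j) (p + P 0) (r + P (Fin.last n))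
                (fun x => q (finSigmaFinEquiv.symm x).1 (finSigmaFinEquiv.symm x).2)
                rfl
                (fun x => assocColour_shuffle P p r m P' q x)
                (by rw [sum_flatten]; rfl))))
            (fun _ => .gen (.C P p r m rfl (fun _ => rfl) rfl))))
        (Term.fill (K := Unit) (E := Fin n) (J := fun i => Unit ⊕ Fin (m i))
          (b := fun i => (P i.castSucc + P' (offset m i.castSucc), ∑ j, q i j,
            P i.succ + P' (offset m i.succ)))
          (.gen (.C (fun i => P i + P' (offset m i)) p r (fun i => ∑ j, q i j)
            rfl (fun _ => rfl)
            (by simp only [offset_zero, offset_last, Nat.add_assoc])))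
          (fun i => .gen (.C (fun j => P' (offset m i.castSucc + j)) (P i.castSucc) (P i.succ)
            (q i) rfl (fun _ => rfl)
            (by simp [offset_succ]))))
  | eta_bottom (p q r : ℕ) :
      BoxRel Unit (fun _ => (p, q, r)) (p, q, r)
        (Term.plug (E := Unit) (u := (0, 1, 0))
          (.act ((Equiv.sumComm Unit (Fin 1)).trans
              (Equiv.sumCongr (Equiv.ofUnique (Fin 1) Unit) (Equiv.refl Unit)))
            (.gen (.C ![p, r] 0 0 ![q] rfl (fun i => by fin_cases i; rfl) (by simp))))
          (fun z => .gen (.eta z)))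
        (.one (p, q, r))
  | eta_top (p n r : ℕ) :
      BoxRel Unit (fun _ => (p, n, r)) (p, n, r)
        (Term.plug (E := Fin n) (u := (0, 1, 0))
          (.gen (.C (fun _ => 0) p r (fun _ => 1) rfl (fun _ => rfl) (by simp)))
          (fun z => .gen (.eta z)))
        (.one (p, n, r))

/-- The `ℕ³`-coloured symmetric operad whose algebras are box operads. -/
noncomputable def boxOperad : ColouredOperad.{1} Colour := presented BoxGen BoxRel

/-- Planar forests with vertices labelled by `I`: `cons v c f` is the forest whose leftmost tree has
root `v` and forest of subtrees `c` (the subtrees at the children of `v`, from left to right), and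
`f` consists of the remaining trees, from left to right. A planar tree is a forest with exactly
one tree. -/
inductive Forest (I : Type) : Type
  | nil : Forest I
  | cons (v : I) (children : Forest I) (rest : Forest I) : Forest I

namespace Forest

variable {I J : Type}

/-- The number of trees of a forest. -/
def length : Forest I → ℕ
  | nil => 0
  | cons _ _ f => length f + 1

/-- The roots of the trees of a forest, from left to right. -/
def roots : Forest I → List I
  | nil => []
  | cons v _ f => v :: roots f

/-- The list of all vertices of a forest. -/
def labels : Forest I → List I
  | nil => []
  | cons v c f => v :: (labels c ++ labels f)

/-- Every internal vertex `v` has exactly `q v` children. -/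
def Full (q : I → ℕ) : Forest I → Prop
  | nil => True
  | cons v c f => (c = nil ∨ c.length = q v) ∧ Full q c ∧ Full q f

/-- The sum of the numbers `q v` over all leaves `v`. -/
def inputs (q : I → ℕ) : Forest I → ℕ
  | nil => 0
  | cons v nil f => q v + inputs q f
  | cons _ (cons w c c') f => inputs q (cons w c c') + inputs q f

/-- `leftDepth p s F x` is the left depth `dL` of the root of the leftmost tree of `F`, or `x` if `F`
is empty, where `p` gives the left labels of the boxes and `s` the start values: the left depth of a
vertex is the left depth of its leftmost child (or its start value, if it is a leaf) plus its left
label. -/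
def leftDepth (p s : I → ℕ) : Forest I → ℕ → ℕ
  | nil, x => x
  | cons v c _, _ => leftDepth p s c (s v) + p v

/-- `rightDepth r s F x` is the right depth `dR` of the root of the rightmost tree of `F`, or `x` if
`F` is empty: the right depth of a vertex is the right depth of its rightmost child (or its start
value, if it is a leaf) plus its right label. -/
def rightDepth (r s : I → ℕ) : Forest I → ℕ → ℕ
  | nil, x => x
  | cons v c f, _ => rightDepth r s f (rightDepth r s c (s v) + r v)

/-- For any two adjacent children `v`, `w` of a vertex (and adjacent roots), `dR v = dL w`. -/
def Adjacent (p r s : I → ℕ) : Forest I → Prop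
  | nil => True
  | cons v c f =>
      (f ≠ nil → rightDepth r s c (s v) + r v = leftDepth p s f 0) ∧
        Adjacent p r s c ∧ Adjacent p r s f

/-- Renaming of the vertices. -/
def map (e : I → J) : Forest I → Forest J
  | nil => nil
  | cons v c f => cons (e v) (map e c) (map e f)

/-- Juxtaposition of forests. -/
def append : Forest I → Forest I → Forest I
  | nil, g => g
  | cons v c f, g => cons v c (append f g)

/-- The first `n` trees of a forest. -/
def take : ℕ → Forest I → Forest I
  | 0, _ => nil
  | _ + 1, nil => nil
  | n + 1, cons v c f => cons v c (take n f)

/-- All but the first `n` trees of a forest. -/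
def drop : ℕ → Forest I → Forest I
  | 0, f => f
  | _ + 1, nil => nil
  | n + 1, cons _ _ f => drop n f

/-- `graft q A L` puts the trees of `L` on top of the leaves of `A`, from left to right; a leaf `v`
of `A` receives `q v` of them. -/
def graft (q : I → ℕ) : Forest I → Forest I → Forest I
  | nil, _ => nil
  | cons v nil f, L => cons v (take (q v) L) (graft q f (drop (q v) L))
  | cons v (cons w c c') f, L =>
      cons v (graft q (cons w c c') (take (inputs q (cons w c c')) L))
        (graft q f (drop (inputs q (cons w c c')) L))

/-- Substitution of the trees `T v` in the vertices `v` of a forest: the vertex `v` is replaced by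
`T v`, and the children of `v` are put on top of the leaves of `T v`, from left to right, where
`q v j` is the number of children that a leaf `j` of `T v` receives. -/
def subst {J : I → Type} (q : ∀ i, J i → ℕ) (T : ∀ i, Forest (J i)) :
    Forest I → Forest (Σ i, J i)
  | nil => nil
  | cons v c f =>
      append (graft (fun x => q x.1 x.2) (map (Sigma.mk v) (T v)) (subst q T c)) (subst q T f)

end Forest

/-- `F` is an admissible stacking of the boxes `a i` (in the forest `F`) with left depth `d.1` and
right depth `d.2.2`: there are start values, which vanish at all leaves `i` with a positive number
of inputs, for which adjacent depths agree. (Start values at internal vertices play no role.) -/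
def Admissible {I : Type} (a : I → Colour) (d : Colour) (F : Forest I) : Prop :=
  ∃ s : I → ℕ, (∀ i, 0 < (a i).2.1 → s i = 0) ∧
    F.Adjacent (fun i => (a i).1) (fun i => (a i).2.2) s ∧
    F.leftDepth (fun i => (a i).1) s 0 = d.1 ∧
    F.rightDepth (fun i => (a i).2.2) s 0 = d.2.2

/-- Admissible stackings of the boxes `a i = (pᵢ, qᵢ, rᵢ)`, `i ∈ I`, with output colour
`d = (p, q, r)`: planar trees with set of vertices `I` that are full with respect to the `qᵢ` and
`q`, and that are admissible. -/
structure Stacking (I : Type) (a : I → Colour) (d : Colour) : Type where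
  /-- the underlying planar tree -/
  tree : Forest I
  length_eq : tree.length = 1
  nodup : tree.labels.Nodup
  mem_labels : ∀ i, i ∈ tree.labels
  full : tree.Full (fun i => (a i).2.1)
  inputs_eq : tree.inputs (fun i => (a i).2.1) = d.2.1
  admissible : Admissible a d tree

namespace Forest

variable {I J K : Type}

theorem length_append (f g : Forest I) : (append f g).length = f.length + g.length := by
  induction f with
  | nil => simp [append, length]
  | cons v c f _ ih => simp only [append, length, ih]; omega

theorem append_nil (f : Forest I) : append f nil = f := by
  induction f with
  | nil => rfl
  | cons v c f _ ih => simp [append, ih]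

theorem append_assoc (f g h : Forest I) : append (append f g) h = append f (append g h) := by
  induction f with
  | nil => rfl
  | cons v c f _ ih => simp [append, ih]

theorem take_append {n : ℕ} {f : Forest I} (h : f.length = n) (g : Forest I) :
    take n (append f g) = f := by
  induction f generalizing n with
  | nil => subst h; rfl
  | cons v c f _ ih => subst h; simp [append, length, take, ih]

theorem drop_append {n : ℕ} {f : Forest I} (h : f.length = n) (g : Forest I) :
    drop n (append f g) = g := by
  induction f generalizing n with
  | nil => subst h; rfl
  | cons v c f _ ih => subst h; simp [append, length, drop, ih]

theorem exists_split {n : ℕ} {m : ℕ} {f : Forest I} (h : f.length = n + m) :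
    ∃ f₁ f₂, f = append f₁ f₂ ∧ f₁.length = n ∧ f₂.length = m := by
  induction n generalizing f with
  | zero => exact ⟨nil, f, rfl, rfl, by omega⟩
  | succ n ih =>
    cases f with
    | nil => simp [length] at h; omega
    | cons v c f =>
      obtain ⟨f₁, f₂, rfl, h1, h2⟩ := ih (f := f) (by simp [length] at h; omega)
      exact ⟨cons v c f₁, f₂, rfl, by simp [length, h1], h2⟩

theorem length_eq_zero {f : Forest I} (h : f.length = 0) : f = nil := by
  cases f with
  | nil => rfl
  | cons v c f => simp [length] at h

/-- Induction over a forest with a matching forest to be grafted. -/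
theorem graft_induction (q : I → ℕ) {M : Forest I → Forest I → Prop} (hnil : M nil nil)
    (hleaf : ∀ v f L₁ L₂, L₁.length = q v → L₂.length = inputs q f → M f L₂ →
      M (cons v nil f) (append L₁ L₂))
    (hint : ∀ v c f L₁ L₂, c ≠ nil → L₁.length = inputs q c → L₂.length = inputs q f →
      M c L₁ → M f L₂ → M (cons v c f) (append L₁ L₂))
    (A L : Forest I) (h : L.length = inputs q A) : M A L := by
  induction A generalizing L with
  | nil => rw [length_eq_zero h]; exact hnil
  | cons v c f ihc ihf =>
    cases c with
    | nil =>
      obtain ⟨L₁, L₂, rfl, h1, h2⟩ := exists_split h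
      exact hleaf v f L₁ L₂ h1 h2 (ihf _ h2)
    | cons w c c' =>
      obtain ⟨L₁, L₂, rfl, h1, h2⟩ := exists_split h
      exact hint v _ f L₁ L₂ (by simp) h1 h2 (ihc _ h1) (ihf _ h2)

theorem inputs_cons {q : I → ℕ} {c : Forest I} (v : I) (hc : c ≠ nil) (f : Forest I) :
    inputs q (cons v c f) = inputs q c + inputs q f := by
  cases c with
  | nil => exact absurd rfl hc
  | cons => rfl

theorem graft_leaf {q : I → ℕ} {v : I} {f L₁ L₂ : Forest I} (h : L₁.length = q v) :
    graft q (cons v nil f) (append L₁ L₂) = cons v L₁ (graft q f L₂) := by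
  simp [graft, take_append h, drop_append h]

theorem graft_cons {q : I → ℕ} {v : I} {c f L₁ L₂ : Forest I} (hc : c ≠ nil)
    (h : L₁.length = inputs q c) :
    graft q (cons v c f) (append L₁ L₂) = cons v (graft q c L₁) (graft q f L₂) := by
  cases c with
  | nil => exact absurd rfl hc
  | cons => simp [graft, take_append h, drop_append h]

theorem take_nil (n : ℕ) : take n (nil : Forest I) = nil := by cases n <;> rfl

theorem drop_nil (n : ℕ) : drop n (nil : Forest I) = nil := by cases n <;> rfl

theorem graft_nil (q : I → ℕ) (A : Forest I) : graft q A nil = A := by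
  induction A with
  | nil => rfl
  | cons v c f ihc ihf =>
    cases c with
    | nil => simp [graft, take_nil, drop_nil, ihf]
    | cons => simp [graft, take_nil, drop_nil, ihf, ihc]

theorem graft_ne_nil {q : I → ℕ} {A L : Forest I} (h : A ≠ nil) : graft q A L ≠ nil := by
  cases A with
  | nil => exact absurd rfl h
  | cons v c f => cases c <;> simp [graft]

theorem length_graft (q : I → ℕ) (A L : Forest I) : (graft q A L).length = A.length := by
  induction A generalizing L with
  | nil => rfl
  | cons v c f ihc ihf => cases c <;> simp [graft, length, ihf]

theorem inputs_append (q : I → ℕ) (f g : Forest I) :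
    inputs q (append f g) = inputs q f + inputs q g := by
  induction f with
  | nil => simp [append, inputs]
  | cons v c f _ ih =>
    cases c with
    | nil => simp only [append, inputs, ih]; omega
    | cons => simp only [append, inputs, ih]; omega

theorem full_append {q : I → ℕ} {f g : Forest I} (hf : f.Full q) (hg : g.Full q) :
    (append f g).Full q := by
  induction f with
  | nil => exact hg
  | cons v c f _ ih => exact ⟨hf.1, hf.2.1, ih hf.2.2⟩

theorem full_of_append {q : I → ℕ} {f g : Forest I} (h : (append f g).Full q) :
    f.Full q ∧ g.Full q := by
  induction f with
  | nil => exact ⟨trivial, h⟩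
  | cons v c f _ ih => exact ⟨⟨h.1, h.2.1, (ih h.2.2).1⟩, (ih h.2.2).2⟩

theorem inputs_graft {q : I → ℕ} {A L : Forest I} (h : L.length = inputs q A) :
    inputs q (graft q A L) = inputs q L := by
  refine graft_induction q (M := fun A L => inputs q (graft q A L) = inputs q L) rfl ?_ ?_ A L h
  · intro v f L₁ L₂ h1 h2 ih
    rw [graft_leaf h1, inputs_append]
    cases L₁ with
    | nil => simp [inputs, ih, ← h1, length]
    | cons => rw [inputs_cons _ (by simp), ih]
  · intro v c f L₁ L₂ hc h1 h2 ihc ihf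
    rw [graft_cons hc h1, inputs_append, inputs_cons _ (graft_ne_nil hc), ihc, ihf]

theorem full_graft {q : I → ℕ} {A L : Forest I} (h : L.length = inputs q A) (hA : A.Full q)
    (hL : L.Full q) : (graft q A L).Full q := by
  refine graft_induction q (M := fun A L => A.Full q → L.Full q → (graft q A L).Full q)
    (fun _ _ => trivial) ?_ ?_ A L h hA hL
  · intro v f L₁ L₂ h1 h2 ih hA hL
    rw [graft_leaf h1]
    exact ⟨.inr h1, (full_of_append hL).1, ih hA.2.2 (full_of_append hL).2⟩
  · intro v c f L₁ L₂ hc h1 h2 ihc ihf hA hL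
    rw [graft_cons hc h1]
    refine ⟨.inr ?_, ihc hA.2.1 (full_of_append hL).1, ihf hA.2.2 (full_of_append hL).2⟩
    rw [length_graft]
    exact hA.1.resolve_left hc

theorem labels_append (f g : Forest I) : labels (append f g) = labels f ++ labels g := by
  induction f with
  | nil => rfl
  | cons v c f _ ih => simp [append, labels, ih]

theorem labels_graft {q : I → ℕ} {A L : Forest I} (h : L.length = inputs q A) :
    (labels (graft q A L)).Perm (labels A ++ labels L) := by
  classical
  refine graft_induction q (M := fun A L => (labels (graft q A L)).Perm (labels A ++ labels L))
    (List.Perm.refl _) ?_ ?_ A L h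
  · intro v f L₁ L₂ h1 h2 ih
    rw [graft_leaf h1, labels_append]
    rw [List.perm_iff_count] at ih ⊢
    intro x
    have := ih x
    simp only [labels, List.count_cons, List.count_append, List.count_nil] at this ⊢
    omega
  · intro v c f L₁ L₂ hc h1 h2 ihc ihf
    rw [graft_cons hc h1, labels_append]
    rw [List.perm_iff_count] at ihc ihf ⊢
    intro x
    have := ihc x
    have := ihf x
    simp only [labels, List.count_cons, List.count_append] at *
    omega

theorem length_map (e : I → J) (f : Forest I) : (map e f).length = f.length := by
  induction f with
  | nil => rfl
  | cons v c f _ ih => simp [map, length, ih]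

theorem labels_map (e : I → J) (f : Forest I) : labels (map e f) = (labels f).map e := by
  induction f with
  | nil => rfl
  | cons v c f ihc ihf => simp [map, labels, ihc, ihf]

theorem map_id (f : Forest I) : map (fun i => i) f = f := by
  induction f with
  | nil => rfl
  | cons v c f ihc ihf => simp [map, ihc, ihf]

theorem map_map (e : I → J) (e' : J → K) (f : Forest I) :
    map e' (map e f) = map (fun i => e' (e i)) f := by
  induction f with
  | nil => rfl
  | cons v c f ihc ihf => simp [map, ihc, ihf]

theorem map_append (e : I → J) (f g : Forest I) :
    map e (append f g) = append (map e f) (map e g) := by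
  induction f with
  | nil => rfl
  | cons v c f _ ihf => simp [map, append, ihf]

theorem map_take (e : I → J) (n : ℕ) (f : Forest I) : map e (take n f) = take n (map e f) := by
  induction n generalizing f with
  | zero => rfl
  | succ n ih => cases f <;> simp [take, map, ih]

theorem map_drop (e : I → J) (n : ℕ) (f : Forest I) : map e (drop n f) = drop n (map e f) := by
  induction n generalizing f with
  | zero => rfl
  | succ n ih => cases f <;> simp [drop, map, ih]

theorem map_ne_nil {e : I → J} {f : Forest I} (h : f ≠ nil) : map e f ≠ nil := by
  cases f with
  | nil => exact absurd rfl h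
  | cons => simp [map]

theorem inputs_map (q : J → ℕ) (e : I → J) (f : Forest I) :
    inputs q (map e f) = inputs (fun i => q (e i)) f := by
  induction f with
  | nil => rfl
  | cons v c f ihc ihf =>
    cases c with
    | nil => simp [map, inputs, ihf]
    | cons => rw [map, inputs_cons _ (map_ne_nil (by simp)), inputs_cons _ (by simp), ihc, ihf]

theorem full_map {q : J → ℕ} {e : I → J} {f : Forest I} (h : f.Full (fun i => q (e i))) :
    (map e f).Full q := by
  induction f with
  | nil => trivial
  | cons v c f ihc ihf =>
    refine ⟨?_, ihc h.2.1, ihf h.2.2⟩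
    rcases h.1 with rfl | h
    · exact .inl rfl
    · exact .inr (by rw [length_map, h])

theorem map_graft (q : J → ℕ) (e : I → J) (A L : Forest I) :
    map e (graft (fun i => q (e i)) A L) = graft q (map e A) (map e L) := by
  induction A generalizing L with
  | nil => rfl
  | cons v c f ihc ihf =>
    cases c with
    | nil => simp [map, graft, ihf, map_take, map_drop]
    | cons w c c' =>
      have h := inputs_map q e (cons w c c')
      simp only [map] at h
      have h' := fun L => ihc L
      simp only [map] at h'
      simp only [map, graft, h, h', ihf, map_take, map_drop]

section subst

variable {J : I → Type} {q : ∀ i, J i → ℕ} {T : ∀ i, Forest (J i)}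

theorem length_subst (hT : ∀ i, (T i).length = 1) (f : Forest I) :
    (subst q T f).length = f.length := by
  induction f with
  | nil => rfl
  | cons v c f _ ihf =>
    simp only [subst, length_append, length_graft, length_map, ihf, hT, length]
    omega

theorem subst_append (f g : Forest I) :
    subst q T (append f g) = append (subst q T f) (subst q T g) := by
  induction f with
  | nil => rfl
  | cons v c f _ ihf => simp [append, subst, ihf, append_assoc]

theorem subst_ne_nil (hT : ∀ i, (T i).length = 1) {f : Forest I} (h : f ≠ nil) :
    subst q T f ≠ nil := by
  intro h'
  exact h (length_eq_zero (by rw [← length_subst (q := q) hT, h']; rfl))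

/-- The forests grafted in a substitution are either empty or of the right length. -/
theorem subst_match {k : I → ℕ} (hT : ∀ i, (T i).length = 1)
    (hq : ∀ i, inputs (q i) (T i) = k i) {v : I} {c : Forest I}
    (h : c = nil ∨ c.length = k v) :
    subst q T c = nil ∨ (subst q T c).length
      = inputs (fun x : Σ i, J i => q x.1 x.2) (map (Sigma.mk v) (T v)) := by
  rcases h with rfl | h
  · exact .inl rfl
  · exact .inr (by rw [length_subst hT, h, inputs_map, hq])

theorem inputs_subst {k : I → ℕ} (hT : ∀ i, (T i).length = 1)
    (hq : ∀ i, inputs (q i) (T i) = k i) {f : Forest I} (hf : f.Full k) :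
    inputs (fun x : Σ i, J i => q x.1 x.2) (subst q T f) = inputs k f := by
  induction f with
  | nil => rfl
  | cons v c f ihc ihf =>
    rw [subst, inputs_append, ihf hf.2.2]
    cases c with
    | nil => rw [subst, graft_nil, inputs_map, hq]; rfl
    | cons w c c' =>
      have h := (subst_match hT hq hf.1).resolve_left (subst_ne_nil hT (by simp))
      rw [inputs_graft h, ihc hf.2.1]
      rfl

theorem full_subst {k : I → ℕ} (hT : ∀ i, (T i).length = 1)
    (hq : ∀ i, inputs (q i) (T i) = k i) (hF : ∀ i, (T i).Full (q i)) {f : Forest I}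
    (hf : f.Full k) : (subst q T f).Full (fun x : Σ i, J i => q x.1 x.2) := by
  induction f with
  | nil => trivial
  | cons v c f ihc ihf =>
    refine full_append ?_ (ihf hf.2.2)
    rcases subst_match hT hq hf.1 with h | h
    · rw [h, graft_nil]
      exact full_map (hF v)
    · exact full_graft h (full_map (hF v)) (ihc hf.2.1)

theorem labels_subst {k : I → ℕ} (hT : ∀ i, (T i).length = 1)
    (hq : ∀ i, inputs (q i) (T i) = k i) {f : Forest I} (hf : f.Full k) :
    (labels (subst q T f)).Perm ((labels f).sigma (fun i => labels (T i))) := by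
  induction f with
  | nil => exact List.Perm.refl _
  | cons v c f ihc ihf =>
    have key : (labels (graft (fun x : Σ i, J i => q x.1 x.2) (map (Sigma.mk v) (T v))
        (subst q T c))).Perm ((labels (T v)).map (Sigma.mk v) ++ labels (subst q T c)) := by
      rw [← labels_map]
      rcases subst_match hT hq hf.1 with h | h
      · simp [h, graft_nil, labels]
      · exact labels_graft h
    rw [subst, labels_append, labels, List.sigma_cons]
    have happ : (labels c ++ labels f).sigma (fun i => labels (T i))
        = (labels c).sigma (fun i => labels (T i)) ++ (labels f).sigma (fun i => labels (T i)) := by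
      simp [List.sigma]
    rw [happ, ← List.append_assoc]
    exact (key.trans ((List.Perm.refl _).append (ihc hf.2.1))).append (ihf hf.2.2)

end subst

theorem graft_append {q : I → ℕ} {A B L₁ L₂ : Forest I} (h : L₁.length = inputs q A) :
    graft q (append A B) (append L₁ L₂) = append (graft q A L₁) (graft q B L₂) := by
  refine graft_induction q (M := fun A L₁ => graft q (append A B) (append L₁ L₂)
    = append (graft q A L₁) (graft q B L₂)) rfl ?_ ?_ A L₁ h
  · intro v f M₁ M₂ h1 h2 ih
    rw [append_assoc, append, graft_leaf h1, graft_leaf h1, ih]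
    rfl
  · intro v c f M₁ M₂ hc h1 h2 ihc ihf
    rw [append_assoc, append, graft_cons hc h1, graft_cons hc h1, ihf]
    rfl

theorem graft_graft {q : I → ℕ} {A B L : Forest I} (hB : B.length = inputs q A)
    (hL : L.length = inputs q B) : graft q (graft q A B) L = graft q A (graft q B L) := by
  refine graft_induction q (M := fun A B => ∀ L, L.length = inputs q B →
    graft q (graft q A B) L = graft q A (graft q B L)) (fun L _ => rfl) ?_ ?_ A B hB L hL
  · intro v f B₁ B₂ h1 h2 ih L hL
    rw [inputs_append] at hL
    obtain ⟨L₁, L₂, rfl, hL1, hL2⟩ := exists_split hL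
    rw [graft_append hL1, graft_leaf h1, graft_leaf (by rw [length_graft, h1]), ← ih _ hL2]
    cases B₁ with
    | nil =>
      have := length_eq_zero hL1
      subst this
      exact graft_leaf h1
    | cons => exact graft_cons (by simp) hL1
  · intro v c f B₁ B₂ hc h1 h2 ihc ihf L hL
    rw [inputs_append] at hL
    obtain ⟨L₁, L₂, rfl, hL1, hL2⟩ := exists_split hL
    rw [graft_append hL1, graft_cons hc h1, graft_cons hc (by rw [length_graft, h1]),
      ← ihf _ hL2, ← ihc _ hL1]
    exact graft_cons (graft_ne_nil hc) (by rw [inputs_graft h1, hL1])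

theorem map_subst_sigma {J : I → Type} {K : ∀ i, J i → Type} (q : ∀ i j, K i j → ℕ)
    (U : ∀ i j, Forest (K i j)) (v : I) (f : Forest (J v)) :
    subst (fun x : Σ i, J i => q x.1 x.2) (fun x => U x.1 x.2) (map (Sigma.mk v) f)
      = map (fun y : Σ j, K v j => (⟨⟨v, y.1⟩, y.2⟩ : Σ x : Σ i, J i, K x.1 x.2))
        (subst (q v) (U v) f) := by
  induction f with
  | nil => rfl
  | cons w c f ihc ihf =>
    simp only [map, subst, map_append, ihc, ihf]
    rw [map_graft (fun x : Σ x : Σ i, J i, K x.1 x.2 => q x.1.1 x.1.2 x.2)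
      (fun y : Σ j, K v j => (⟨⟨v, y.1⟩, y.2⟩ : Σ x : Σ i, J i, K x.1 x.2)), map_map]

theorem subst_graft {J : I → Type} {q : ∀ i, J i → ℕ} {T : ∀ i, Forest (J i)} {k : I → ℕ}
    (hT : ∀ i, (T i).length = 1) (hq : ∀ i, inputs (q i) (T i) = k i) {A L : Forest I}
    (hA : A.Full k) (h : L.length = inputs k A) :
    subst q T (graft k A L)
      = graft (fun x : Σ i, J i => q x.1 x.2) (subst q T A) (subst q T L) := by
  refine graft_induction k (M := fun A L => A.Full k → subst q T (graft k A L)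
      = graft (fun x : Σ i, J i => q x.1 x.2) (subst q T A) (subst q T L))
      (fun _ => rfl) ?_ ?_ A L h hA
  · intro v f L₁ L₂ h1 h2 ih hA
    rw [graft_leaf h1, subst, ih hA.2.2, subst_append, subst, subst, graft_nil, graft_append]
    rw [length_subst hT, h1, inputs_map, hq]
  · intro v c f L₁ L₂ hc h1 h2 ihc ihf hA
    have hm := (subst_match hT hq hA.1).resolve_left (subst_ne_nil hT hc)
    have h3 : (subst q T L₁).length = inputs (fun x : Σ i, J i => q x.1 x.2) (subst q T c) := by
      rw [length_subst hT, h1, inputs_subst hT hq hA.2.1]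
    rw [graft_cons hc h1, subst, ihc hA.2.1, ihf hA.2.2, subst_append, subst, graft_append,
      graft_graft hm h3]
    rw [inputs_graft hm, h3]

theorem subst_subst {J : I → Type} {K : ∀ i, J i → Type} {k : I → ℕ} {l : ∀ i, J i → ℕ}
    {q : ∀ i j, K i j → ℕ} {T : ∀ i, Forest (J i)} {U : ∀ i j, Forest (K i j)}
    (hT : ∀ i, (T i).length = 1) (hl : ∀ i, inputs (l i) (T i) = k i)
    (hF : ∀ i, (T i).Full (l i))
    (hU : ∀ i j, (U i j).length = 1) (hq : ∀ i j, inputs (q i j) (U i j) = l i j)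
    {f : Forest I} (hf : f.Full k) :
    map (Equiv.sigmaAssoc K) (subst (fun x : Σ i, J i => q x.1 x.2) (fun x => U x.1 x.2)
        (subst l T f))
      = subst (fun i => fun x : Σ j, K i j => q i x.1 x.2)
          (fun i => subst (q i) (U i) (T i)) f := by
  induction f with
  | nil => rfl
  | cons v c f ihc ihf =>
    rw [subst, subst_append, map_append, ihf hf.2.2, subst]
    congr 1
    have hmap : ∀ g : Forest (Σ j, K v j), map (Equiv.sigmaAssoc K)
        (map (fun y : Σ j, K v j => (⟨⟨v, y.1⟩, y.2⟩ : Σ x : Σ i, J i, K x.1 x.2)) g)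
          = map (Sigma.mk v) g := fun g => map_map _ _ g
    rcases subst_match hT hl hf.1 with h | h
    · have hc : c = nil := length_eq_zero (by rw [← length_subst (q := l) hT, h]; rfl)
      subst hc
      simp only [subst, graft_nil]
      rw [map_subst_sigma, hmap]
    · rw [subst_graft (fun x : Σ i, J i => hU x.1 x.2) (fun x : Σ i, J i => hq x.1 x.2)
        (full_map (hF v)) h, map_subst_sigma, ← ihc hf.2.1, ← hmap]
      exact map_graft (fun x : Σ i, Σ j, K i j => q x.1 x.2.1 x.2.2) (Equiv.sigmaAssoc K) _ _

theorem subst_map {J : K → Type} (q : ∀ i, J i → ℕ) (T : ∀ i, Forest (J i)) (e : I ≃ K)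
    (f : Forest I) :
    subst q T (map e f)
      = map (Equiv.sigmaCongrLeft (β := J) e)
          (subst (fun i => q (e i)) (fun i => T (e i)) f) := by
  induction f with
  | nil => rfl
  | cons v c f ihc ihf =>
    rw [map, subst, ihc, ihf, subst, map_append]
    congr 1
    refine Eq.trans ?_
      (map_graft (fun x : Σ i, J i => q x.1 x.2) (Equiv.sigmaCongrLeft (β := J) e) _ _).symm
    rw [map_map]
    rfl

theorem subst_map_inner {J K : I → Type} (q : ∀ i, K i → ℕ) (e : ∀ i, J i ≃ K i)
    (T : ∀ i, Forest (J i)) (f : Forest I) :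
    subst q (fun i => map (e i) (T i)) f
      = map (Equiv.sigmaCongrRight e) (subst (fun i j => q i (e i j)) T f) := by
  induction f with
  | nil => rfl
  | cons v c f ihc ihf =>
    rw [subst, ihc, ihf, subst, map_append]
    congr 1
    refine Eq.trans ?_
      (map_graft (fun x : Σ i, K i => q x.1 x.2) (Equiv.sigmaCongrRight e) _ _).symm
    rw [map_map, map_map]
    rfl

theorem subst_one (q : I → ℕ) (f : Forest I) (hf : f.Full q) :
    map (Equiv.sigmaPUnit I) (subst (fun i (_ : Unit) => q i) (fun _ => cons () nil nil) f)
      = f := by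
  induction f with
  | nil => rfl
  | cons v c f ihc ihf =>
    have h : take (q v) (subst (fun i (_ : Unit) => q i) (fun _ => cons () nil nil) c)
        = subst (fun i (_ : Unit) => q i) (fun _ => cons () nil nil) c := by
      rcases hf.1 with rfl | h
      · exact take_nil _
      · rw [← h, ← length_subst (q := fun i (_ : Unit) => q i) (T := fun _ => cons () nil nil)
          (fun _ => rfl) c]
        conv_lhs => rw [← append_nil (subst _ _ c)]
        rw [take_append (by rw [append_nil])]
    simp only [subst, map, graft, append, h, ihc hf.2.1, ihf hf.2.2]
    rfl

/-- Inductive form of admissibility: with suitable start values, adjacent depths agree in `F`, and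
`F` has left depth `x` and right depth `y` (with `x = y` arbitrary for the empty forest). -/
def Spans (p q r : I → ℕ) : Forest I → ℕ → ℕ → Prop
  | nil, x, y => x = y
  | cons v c f, x, y => ∃ x' y', Spans p q r c x' y' ∧ (c = nil → 0 < q v → x' = 0) ∧
      x = x' + p v ∧ Spans p q r f (y' + r v) y

theorem leftDepth_eq {p s : I → ℕ} {f : Forest I} (h : f ≠ nil) (x y : ℕ) :
    leftDepth p s f x = leftDepth p s f y := by
  cases f with
  | nil => exact absurd rfl h
  | cons => rfl

theorem leftDepth_congr {p s s' : I → ℕ} {f : Forest I} (h : ∀ i ∈ labels f, s i = s' i)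
    (x : ℕ) : leftDepth p s f x = leftDepth p s' f x := by
  induction f generalizing x with
  | nil => rfl
  | cons v c f ihc ihf =>
    simp only [leftDepth]
    rw [h v (by simp [labels]), ihc (fun i hi => h i (by simp [labels, hi]))]

theorem rightDepth_congr {r s s' : I → ℕ} {f : Forest I} (h : ∀ i ∈ labels f, s i = s' i)
    (x : ℕ) : rightDepth r s f x = rightDepth r s' f x := by
  induction f generalizing x with
  | nil => rfl
  | cons v c f ihc ihf =>
    simp only [rightDepth]
    rw [h v (by simp [labels]), ihc (fun i hi => h i (by simp [labels, hi])),
      ihf (fun i hi => h i (by simp [labels, hi]))]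

theorem rightDepth_eq {r s : I → ℕ} {f : Forest I} (h : f ≠ nil) (x y : ℕ) :
    rightDepth r s f x = rightDepth r s f y := by
  cases f with
  | nil => exact absurd rfl h
  | cons => rfl

theorem adjacent_congr {p r s s' : I → ℕ} {f : Forest I} (h : ∀ i ∈ labels f, s i = s' i)
    (hf : Adjacent p r s f) : Adjacent p r s' f := by
  induction f with
  | nil => trivial
  | cons v c f ihc ihf =>
    have hc : ∀ i ∈ labels c, s i = s' i := fun i hi => h i (by simp [labels, hi])
    have hf' : ∀ i ∈ labels f, s i = s' i := fun i hi => h i (by simp [labels, hi])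
    refine ⟨fun hne => ?_, ihc hc hf.2.1, ihf hf' hf.2.2⟩
    rw [← h v (by simp [labels]), ← rightDepth_congr hc, ← leftDepth_congr hf']
    exact hf.1 hne

theorem spans_of_adjacent {p q r s : I → ℕ} (hs : ∀ i, 0 < q i → s i = 0) {f : Forest I}
    (hf : Adjacent p r s f) (x : ℕ) :
    Spans p q r f (leftDepth p s f x) (rightDepth r s f x) := by
  induction f generalizing x with
  | nil => rfl
  | cons v c f ihc ihf =>
    refine ⟨_, _, ihc hf.2.1 (s v), ?_, rfl, ?_⟩
    · rintro rfl hq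
      exact hs v hq
    · have := ihf hf.2.2 (rightDepth r s c (s v) + r v)
      by_cases hne : f = nil
      · subst hne; exact this
      · rw [leftDepth_eq hne _ 0, ← hf.1 hne] at this
        exact this

theorem exists_of_spans {p q r : I → ℕ} {f : Forest I} (hn : (labels f).Nodup) {x y : ℕ}
    (h : Spans p q r f x y) : ∃ s : I → ℕ, (∀ i, 0 < q i → s i = 0) ∧ Adjacent p r s f ∧
      leftDepth p s f x = x ∧ rightDepth r s f x = y := by
  classical
  induction f generalizing x y with
  | nil => exact ⟨fun _ => 0, fun _ _ => rfl, trivial, rfl, h⟩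
  | cons v c f ihc ihf =>
    obtain ⟨x', y', h1, h2, rfl, h3⟩ := h
    simp only [labels, List.nodup_cons, List.mem_append, not_or, List.nodup_append] at hn
    obtain ⟨⟨hvc, hvf⟩, hnc, hnf, hd⟩ := hn
    obtain ⟨s₁, a1, a2, a3, a4⟩ := ihc hnc h1
    obtain ⟨s₂, b1, b2, b3, b4⟩ := ihf hnf h3
    let s : I → ℕ := fun i => if i = v then (if c = nil then x' else 0) else
      if i ∈ labels c then s₁ i else s₂ i
    have hsv : s v = if c = nil then x' else 0 := by simp [s]
    have hsc : ∀ i ∈ labels c, s₁ i = s i := by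
      intro i hi
      have : i ≠ v := fun h => hvc (h ▸ hi)
      simp [s, this, hi]
    have hsf : ∀ i ∈ labels f, s₂ i = s i := by
      intro i hi
      have h4 : i ≠ v := fun h => hvf (h ▸ hi)
      have h5 : i ∉ labels c := fun h => hd i h i hi rfl
      simp [s, h4, h5]
    have hl : leftDepth p s c (s v) = x' := by
      rw [← leftDepth_congr hsc]
      by_cases hc : c = nil
      · rw [hsv, if_pos hc, a3]
      · rw [leftDepth_eq hc _ x', a3]
    have hr : rightDepth r s c (s v) = y' := by
      rw [← rightDepth_congr hsc]
      by_cases hc : c = nil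
      · rw [hsv, if_pos hc, a4]
      · rw [rightDepth_eq hc _ x', a4]
    refine ⟨s, ?_, ⟨?_, adjacent_congr hsc a2, adjacent_congr hsf b2⟩, ?_, ?_⟩
    · intro i hi
      simp only [s]
      split_ifs with h4 h5 h6
      · exact h2 h5 (h4 ▸ hi)
      · rfl
      · exact a1 i hi
      · exact b1 i hi
    · intro hne
      rw [hr, ← leftDepth_congr hsf, leftDepth_eq hne _ (y' + r v), b3]
    · simp only [leftDepth, hl]
    · simp only [rightDepth, hr]
      rw [← rightDepth_congr hsf, b4]

theorem spans_append {p q r : I → ℕ} {f g : Forest I} {x y z : ℕ} (hf : Spans p q r f x y)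
    (hg : Spans p q r g y z) : Spans p q r (append f g) x z := by
  induction f generalizing x with
  | nil => cases hf; exact hg
  | cons v c f _ ih =>
    obtain ⟨x', y', h1, h2, h3, h4⟩ := hf
    exact ⟨x', y', h1, h2, h3, ih h4⟩

theorem spans_of_append {p q r : I → ℕ} {f g : Forest I} {x z : ℕ}
    (h : Spans p q r (append f g) x z) : ∃ y, Spans p q r f x y ∧ Spans p q r g y z := by
  induction f generalizing x with
  | nil => exact ⟨x, rfl, h⟩
  | cons v c f _ ih =>
    obtain ⟨x', y', h1, h2, h3, h4⟩ := h
    obtain ⟨y, h5, h6⟩ := ih h4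
    exact ⟨y, ⟨x', y', h1, h2, h3, h5⟩, h6⟩

theorem spans_map {p q r : J → ℕ} {e : I → J} {f : Forest I} {x y : ℕ}
    (h : Spans (fun i => p (e i)) (fun i => q (e i)) (fun i => r (e i)) f x y) :
    Spans p q r (map e f) x y := by
  induction f generalizing x y with
  | nil => exact h
  | cons v c f ihc ihf =>
    obtain ⟨x', y', h1, h2, h3, h4⟩ := h
    refine ⟨x', y', ihc h1, fun hc => h2 ?_, h3, ihf h4⟩
    by_contra hne
    exact map_ne_nil hne hc

theorem spans_graft {p q r : I → ℕ} {A L : Forest I} (h : L.length = inputs q A) {x y u w : ℕ}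
    (hA : Spans p q r A x y) (hL : Spans p q r L u w) :
    Spans p q r (graft q A L) (x + u) (y + w) := by
  refine graft_induction q (M := fun A L => ∀ x y u w, Spans p q r A x y → Spans p q r L u w →
    Spans p q r (graft q A L) (x + u) (y + w)) ?_ ?_ ?_ A L h x y u w hA hL
  · intro x y u w hA hL
    cases hA; cases hL; rfl
  · intro v f L₁ L₂ h1 h2 ih x y u w hA hL
    obtain ⟨x', y', a1, a2, rfl, a4⟩ := hA
    cases a1
    obtain ⟨t, b1, b2⟩ := spans_of_append hL
    rw [graft_leaf h1]
    have key := ih _ _ _ _ a4 b2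
    cases L₁ with
    | nil =>
      cases b1
      refine ⟨x' + u, x' + u, rfl, fun _ hq => ?_, by omega, ?_⟩
      · simp only [length] at h1; omega
      · rwa [show x' + u + r v = x' + r v + u by omega]
    | cons w' d d' =>
      have hx : x' = 0 := a2 rfl (by simp only [length] at h1; omega)
      subst hx
      refine ⟨u, t, b1, by simp, by omega, ?_⟩
      rwa [show t + r v = 0 + r v + t by omega]
  · intro v c f L₁ L₂ hc h1 h2 ihc ihf x y u w hA hL
    obtain ⟨x', y', a1, a2, rfl, a4⟩ := hA
    obtain ⟨t, b1, b2⟩ := spans_of_append hL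
    rw [graft_cons hc h1]
    refine ⟨x' + u, y' + t, ihc _ _ _ _ a1 b1, fun h => absurd h (graft_ne_nil hc), by omega, ?_⟩
    have key := ihf _ _ _ _ a4 b2
    rwa [show y' + t + r v = y' + r v + t by omega]

theorem spans_subst {J : I → Type} {p q r : ∀ i, J i → ℕ} {T : ∀ i, Forest (J i)}
    {l k m : I → ℕ} (hT : ∀ i, (T i).length = 1) (hq : ∀ i, inputs (q i) (T i) = k i)
    (hS : ∀ i, Spans (p i) (q i) (r i) (T i) (l i) (m i)) {f : Forest I} (hf : f.Full k)
    {x y : ℕ} (h : Spans l k m f x y) :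
    Spans (fun x : Σ i, J i => p x.1 x.2) (fun x : Σ i, J i => q x.1 x.2)
      (fun x : Σ i, J i => r x.1 x.2) (subst q T f) x y := by
  induction f generalizing x y with
  | nil => exact h
  | cons v c f ihc ihf =>
    obtain ⟨x', y', h1, h2, rfl, h4⟩ := h
    refine spans_append ?_ (ihf hf.2.2 h4)
    have hc := ihc hf.2.1 h1
    have hv := spans_map (p := fun x : Σ i, J i => p x.1 x.2)
      (q := fun x : Σ i, J i => q x.1 x.2) (r := fun x : Σ i, J i => r x.1 x.2)
      (e := Sigma.mk v) (hS v)
    rcases subst_match hT hq hf.1 with hn | hn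
    · have hcn : c = nil := length_eq_zero (by rw [← length_subst (q := q) hT, hn]; rfl)
      subst hcn
      cases h1
      rcases Nat.eq_zero_or_pos (k v) with hk | hk
      · have := spans_graft (by rw [hn, inputs_map, hq, hk]; rfl) hv hc
        rwa [Nat.add_comm (l v), Nat.add_comm (m v)] at this
      · have hx := h2 rfl hk
        subst hx
        rw [hn, graft_nil, Nat.zero_add, Nat.zero_add]
        exact hv
    · have := spans_graft hn hv hc
      rwa [Nat.add_comm (l v), Nat.add_comm (m v)] at this

end Forest

theorem spans_of_admissible {I : Type} {a : I → Colour} {d : Colour} {F : Forest I}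
    (h : Admissible a d F) :
    F.Spans (fun i => (a i).1) (fun i => (a i).2.1) (fun i => (a i).2.2) d.1 d.2.2 := by
  obtain ⟨s, h1, h2, h3, h4⟩ := h
  rw [← h3, ← h4]
  exact Forest.spans_of_adjacent h1 h2 0

theorem admissible_of_spans {I : Type} {a : I → Colour} {d : Colour} {F : Forest I}
    (hF : F.length = 1) (hn : F.labels.Nodup)
    (h : F.Spans (fun i => (a i).1) (fun i => (a i).2.1) (fun i => (a i).2.2) d.1 d.2.2) :
    Admissible a d F := by
  obtain ⟨s, h1, h2, h3, h4⟩ := Forest.exists_of_spans hn h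
  have hne : F ≠ .nil := by rintro rfl; simp [Forest.length] at hF
  exact ⟨s, h1, h2, (Forest.leftDepth_eq hne _ _).trans h3,
    (Forest.rightDepth_eq hne _ _).trans h4⟩

namespace Stacking

@[ext]
theorem ext {I : Type} {a : I → Colour} {d : Colour} {S T : Stacking I a d}
    (h : S.tree = T.tree) : S = T := by
  cases S; cases T; cases h; rfl

/-- The stacking consisting of the single box `c`, with start value `0`. -/
def one (c : Colour) : Stacking Unit (fun _ => c) c where
  tree := .cons () .nil .nil
  length_eq := rfl
  nodup := by simp [Forest.labels]
  mem_labels _ := by simp [Forest.labels]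
  full := ⟨.inl rfl, trivial, trivial⟩
  inputs_eq := rfl
  admissible := ⟨fun _ => 0, fun _ _ => rfl, by simp [Forest.Adjacent],
    by simp [Forest.leftDepth], by simp [Forest.rightDepth]⟩

/-- Renaming of the boxes of a stacking. -/
def act {I J : Type} {b : J → Colour} {d : Colour} (e : I ≃ J)
    (S : Stacking I (fun i => b (e i)) d) : Stacking J b d where
  tree := S.tree.map e
  length_eq := by rw [Forest.length_map, S.length_eq]
  nodup := by
    rw [Forest.labels_map]
    exact S.nodup.map e.injective
  mem_labels j := by
    rw [Forest.labels_map, List.mem_map]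
    exact ⟨e.symm j, S.mem_labels _, e.apply_symm_apply j⟩
  full := Forest.full_map (q := fun i => (b i).2.1) S.full
  inputs_eq := by rw [Forest.inputs_map]; exact S.inputs_eq
  admissible := by
    refine admissible_of_spans (by rw [Forest.length_map, S.length_eq]) ?_ ?_
    · rw [Forest.labels_map]
      exact S.nodup.map e.injective
    · exact Forest.spans_map (p := fun i => (b i).1) (q := fun i => (b i).2.1)
        (r := fun i => (b i).2.2) (e := e) (spans_of_admissible S.admissible)

/-- Composition of stackings: the stackings `T i` are substituted in the boxes `i` of `S`. -/
def comp {I : Type} {J : I → Type} {a : I → Colour} {b : ∀ i, J i → Colour} {d : Colour}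
    (S : Stacking I a d) (T : ∀ i, Stacking (J i) (b i) (a i)) :
    Stacking (Σ i, J i) (fun x => b x.1 x.2) d :=
  have hT : ∀ i, (T i).tree.length = 1 := fun i => (T i).length_eq
  have hq : ∀ i, (T i).tree.inputs (fun j => (b i j).2.1) = (a i).2.1 := fun i => (T i).inputs_eq
  have hn : (Forest.subst (fun i j => (b i j).2.1) (fun i => (T i).tree) S.tree).labels.Nodup :=
    (Forest.labels_subst hT hq S.full).nodup_iff.mpr
      (S.nodup.sigma fun i => (T i).nodup)
  have hl : (Forest.subst (fun i j => (b i j).2.1) (fun i => (T i).tree) S.tree).length = 1 :=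
    (Forest.length_subst hT _).trans S.length_eq
  { tree := Forest.subst (fun i j => (b i j).2.1) (fun i => (T i).tree) S.tree
    length_eq := hl
    nodup := hn
    mem_labels := fun x => (Forest.labels_subst hT hq S.full).mem_iff.mpr
      (List.mem_sigma.mpr ⟨S.mem_labels x.1, (T x.1).mem_labels x.2⟩)
    full := Forest.full_subst hT hq (fun i => (T i).full) S.full
    inputs_eq := (Forest.inputs_subst hT hq S.full).trans S.inputs_eq
    admissible := admissible_of_spans hl hn
      (Forest.spans_subst hT hq (fun i => spans_of_admissible (T i).admissible) S.full
        (spans_of_admissible S.admissible)) }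

end Stacking

/-- The `ℕ³`-coloured symmetric operad of admissible stackings. -/
def stack : ColouredOperad.{0} Colour where
  Op I _ a d := Stacking I a d
  one := Stacking.one
  act e S := S.act e
  comp S T := S.comp T
  act_refl S := Stacking.ext (Forest.map_id S.tree)
  act_act e f S := Stacking.ext (Forest.map_map e f S.tree)
  comp_act e S T := Stacking.ext (Forest.subst_map _ _ e S.tree)
  comp_act_inner {I J K} _ _ _ {a b d} e S T :=
    Stacking.ext (Forest.subst_map_inner (fun i k => (b i k).2.1) e (fun i => (T i).tree) S.tree)
  one_comp {I} _ {a d} S := Stacking.ext (by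
    change Forest.map (sigmaUnitEquiv I) (Forest.append (Forest.graft _
      (Forest.map _ S.tree) .nil) .nil) = S.tree
    rw [Forest.append_nil, Forest.graft_nil, Forest.map_map]
    exact Forest.map_id S.tree)
  comp_one {I} _ {a d} S := Stacking.ext (Forest.subst_one (fun i => (a i).2.1) S.tree S.full)
  comp_assoc {I J K} _ _ _ {a b c d} S T U :=
    Stacking.ext (Forest.subst_subst (fun i => (T i).length_eq) (fun i => (T i).inputs_eq)
      (fun i => (T i).full) (fun i j => (U i j).length_eq) (fun i j => (U i j).inputs_eq) S.full)


/-- `f.HasChildren v c`: the forest `f` has a vertex `v` whose forest of subtrees is `c`. -/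
def Forest.HasChildren {I : Type} : Forest I → I → Forest I → Prop
  | nil, _, _ => False
  | cons w c' f, v, c => (w = v ∧ c' = c) ∨ HasChildren c' v c ∨ HasChildren f v c

/-- Contraction of the vertices in `E` with a neighbouring vertex: each vertex `e : E` is removed
and its forest of subtrees takes its place. Contracting the edge between a vertex `e` and its only
child `j` (the result being named `j`), or the edges between a vertex `i` and its children
`j₁, …, jₘ` (the result being named `i`), amounts to this operation for `E = {e}` and
`E = {j₁, …, jₘ}` respectively. -/
def Forest.contract {K E : Type} : Forest (K ⊕ E) → Forest K
  | nil => nil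
  | cons (.inl k) c f => cons k (contract c) (contract f)
  | cons (.inr _) c f => append (contract c) (contract f)

/-- Generators of `Stack[η]`: the admissible stackings and the formal element `η`. -/
inductive StackEtaGen : (I : Type) → (I → Colour) → Colour → Type 1
  | stack {I : Type} {a : I → Colour} {d : Colour} (S : Stacking I a d) : StackEtaGen I a d
  | eta (z : Empty → Colour) : StackEtaGen Empty z (0, 1, 0)

/-- Relations of `Stack[η]`.
* `one`, `act`, `comp`: the operad structure of `stack` is respected;
* `eta_bottom`: if `η` is inserted in an internal vertex `inr ()` (of colour `(0, 1, 0)`) with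
  exactly one child `j`, the result is the stacking in which these two vertices are contracted;
* `eta_top`: if `η` is inserted in all the children `inr 0, …, inr (m-1)` (of colour `(0, 1, 0)`) of
  an internal vertex `i`, the result is the stacking in which `i` and its children are
  contracted. -/
inductive StackEtaRel : ∀ (I : Type) (a : I → Colour) (d : Colour),
    Term StackEtaGen I a d → Term StackEtaGen I a d → Prop
  | one (c : Colour) : StackEtaRel Unit (fun _ => c) c (.gen (.stack (stack.one c))) (.one c)
  | act {I J : Type} [Finite I] [Finite J] {b : J → Colour} {d : Colour} (e : I ≃ J)
      (S : stack.Op I (fun i => b (e i)) d) :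
      StackEtaRel J b d (.gen (.stack (stack.act e S))) (.act e (.gen (.stack S)))
  | comp {I : Type} {J : I → Type} [Finite I] [∀ i, Finite (J i)] {a : I → Colour}
      {b : ∀ i, J i → Colour} {d : Colour} (S : stack.Op I a d)
      (T : ∀ i, stack.Op (J i) (b i) (a i)) :
      StackEtaRel (Σ i, J i) (fun p => b p.1 p.2) d (.gen (.stack (stack.comp S T)))
        (.comp (.gen (.stack S)) (fun i => .gen (.stack (T i))))
  | eta_bottom {K : Type} [Finite K] {a : K → Colour} {d : Colour}
      (T : Stacking (K ⊕ Unit) (Sum.elim a (fun _ => (0, 1, 0))) d) (T' : Stacking K a d)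
      (c : Forest (K ⊕ Unit)) (j : K) (hc : T.tree.HasChildren (.inr ()) c)
      (hj : c.roots = [.inl j]) (hT' : T'.tree = T.tree.contract) :
      StackEtaRel K a d
        (Term.plug (E := Unit) (u := (0, 1, 0)) (.gen (.stack T)) (fun z => .gen (.eta z)))
        (.gen (.stack T'))
  | eta_top {K : Type} [Finite K] {a : K → Colour} {d : Colour} {m : ℕ} (hm : 0 < m)
      (T : Stacking (K ⊕ Fin m) (Sum.elim a (fun _ => (0, 1, 0))) d) (T' : Stacking K a d)
      (c : Forest (K ⊕ Fin m)) (i : K) (hc : T.tree.HasChildren (.inl i) c)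
      (hi : c.roots = List.ofFn (fun s : Fin m => .inr s)) (hT' : T'.tree = T.tree.contract) :
      StackEtaRel K a d
        (Term.plug (E := Fin m) (u := (0, 1, 0)) (.gen (.stack T)) (fun z => .gen (.eta z)))
        (.gen (.stack T'))

/-- The operad `Stack[η]`: the operad of admissible stackings with a formal unit `η` adjoined. -/
noncomputable def stackEta : ColouredOperad.{1} Colour := presented StackEtaGen StackEtaRel

end BoxOp

-- The comparison sends a generator `C` to the corolla stacking (a bottom box with the top boxes as
-- leaves above it) and `η` to `η`. Both sides of the associativity relation become the same
-- three-storey tree (`assoc_trees`). The unit relations become instances of the two contraction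
-- relations, apart from `C^{0;p,r} = 1` with no top boxes, which contains no `η` and already holds
-- in `stack`. This gives the morphism `boxToStackEta`.
--
-- Surjectivity: it suffices to reach every stacking (`exists_map_eq_stackHom`). A root with as many
-- children as inputs is a corolla into whose top inputs the subtrees are substituted, so induction
-- on the number of vertices applies. Otherwise the stacking is a single leaf with start value `0`,
-- that is, a relabelled unit.
--
-- Injectivity needs no normal forms for box operations. An operation of any operad is determined by
-- its action on the free algebra on its inputs (`freeHom_injective`). Hence it is enough to extend
-- every algebra over the box operad to an algebra over `Stack[η]` along the comparison
-- (`stackEtaHom_boxToStackEta`). A stacking acts by evaluation from the leaves down: at each vertex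
-- `C` is applied to the values of the children. A leaf without inputs and with start value `s` uses
-- `C` with no top boxes, which adds `s` to both side labels. The depths of the stacking are the
-- side labels of the values, so all rows fit (`eval_spec`). Associativity makes evaluation
-- compatible with grafting (`eval_graft`) and therefore with substitution (`eval_subst`). The unit
-- relations give invariance under contraction (`eval_contract_of_one_child`,
-- `eval_contract_of_children`).
--
-- To keep colours out of the types, the elements of all colours are collected in one set, and `C`
-- becomes a total operation on lists with a default value (`BoxAlgebra`).

universe w'

/-! ### Relabelling and morphisms of coloured operads -/

namespace ColouredOperad

variable {C : Type v}

/-- Relabelling of the inputs of an operation along a bijection that preserves colours. -/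
def relabel (P : ColouredOperad.{u} C) {I J : Type} [Finite I] [Finite J] {a : I → C} {b : J → C}
    {d : C} (e : I ≃ J) (h : ∀ i, a i = b (e i)) (x : P.Op I a d) : P.Op J b d :=
  P.act e ((funext h : a = fun i => b (e i)) ▸ x)

theorem relabel_refl (P : ColouredOperad.{u} C) {I : Type} [Finite I] {a : I → C} {d : C}
    (e : I ≃ I) (he : ∀ i, e i = i) (h : ∀ i, a i = a (e i)) (x : P.Op I a d) :
    P.relabel e h x = x := by
  obtain rfl : e = Equiv.refl I := Equiv.ext he
  exact P.act_refl x

theorem relabel_relabel (P : ColouredOperad.{u} C) {I J K : Type} [Finite I] [Finite J] [Finite K]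
    {a : I → C} {b : J → C} {c : K → C} {d : C} (e : I ≃ J) (h : ∀ i, a i = b (e i)) (f : J ≃ K)
    (h' : ∀ j, b j = c (f j)) (x : P.Op I a d) :
    P.relabel f h' (P.relabel e h x)
      = P.relabel (e.trans f) (fun i => (h i).trans (h' (e i))) x := by
  obtain rfl : b = fun j => c (f j) := funext h'
  obtain rfl : a = fun i => c (f (e i)) := funext h
  exact P.act_act e f x

theorem comp_relabel_inner (P : ColouredOperad.{u} C) {I : Type} {J K : I → Type} [Finite I]
    [∀ i, Finite (J i)] [∀ i, Finite (K i)] {a : I → C} {b : ∀ i, J i → C} {c : ∀ i, K i → C}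
    {d : C} (e : ∀ i, J i ≃ K i) (h : ∀ i j, b i j = c i (e i j)) (x : P.Op I a d)
    (y : ∀ i, P.Op (J i) (b i) (a i)) :
    P.comp x (fun i => P.relabel (e i) (h i) (y i))
      = P.relabel (Equiv.sigmaCongrRight e) (fun p => h p.1 p.2) (P.comp x y) := by
  obtain rfl : b = fun i j => c i (e i j) := funext fun i => funext (h i)
  exact P.comp_act_inner e x y

/-- A morphism of `C`-coloured symmetric operads that is the identity on colours. -/
structure Hom (P : ColouredOperad.{u} C) (Q : ColouredOperad.{w} C) where
  /-- the underlying maps -/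
  map : ∀ {I : Type} [Finite I] {a : I → C} {d : C}, P.Op I a d → Q.Op I a d
  map_one : ∀ c : C, map (P.one c) = Q.one c
  map_act : ∀ {I J : Type} [Finite I] [Finite J] {b : J → C} {d : C} (e : I ≃ J)
    (x : P.Op I (fun i => b (e i)) d), map (P.act e x) = Q.act e (map x)
  map_comp : ∀ {I : Type} {J : I → Type} [Finite I] [∀ i, Finite (J i)] {a : I → C}
    {b : ∀ i, J i → C} {d : C} (x : P.Op I a d) (y : ∀ i, P.Op (J i) (b i) (a i)),
    map (P.comp x y) = Q.comp (map x) (fun i => map (y i))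

/-- A bijective morphism is an isomorphism. -/
noncomputable def Hom.toIso {P : ColouredOperad.{u} C} {Q : ColouredOperad.{w} C} (f : Hom P Q)
    (hf : ∀ (I : Type) [Finite I] (a : I → C) (d : C),
      Function.Bijective (f.map : P.Op I a d → Q.Op I a d)) : Iso P Q where
  toEquiv I _ a d := Equiv.ofBijective f.map (hf I a d)
  map_one := f.map_one
  map_act := f.map_act
  map_comp := f.map_comp

/-- The composite of two morphisms. -/
def Hom.trans {P : ColouredOperad.{u} C} {Q : ColouredOperad.{w} C} {R : ColouredOperad.{w'} C}
    (f : Hom P Q) (g : Hom Q R) : Hom P R where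
  map x := g.map (f.map x)
  map_one c := by rw [f.map_one, g.map_one]
  map_act e x := by rw [f.map_act, g.map_act]
  map_comp x y := by rw [f.map_comp, g.map_comp]

/-! ### The universal property of a presented operad -/

/-- The value in `Q` of a formal expression, for given values `φ` of the generators. -/
def Term.eval {G : (I : Type) → (I → C) → C → Type u} (Q : ColouredOperad.{w} C)
    (φ : ∀ (I : Type) [Finite I] (a : I → C) (d : C), G I a d → Q.Op I a d) :
    ∀ {I : Type} {a : I → C} {d : C}, Term G I a d → ∀ [Finite I], Q.Op I a d
  | _, _, _, .gen g, _ => φ _ _ _ g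
  | _, _, _, .one c, _ => Q.one c
  | _, _, _, @Term.act _ _ _ _ _ _ _ _ e x, _ => Q.act e (x.eval Q φ)
  | _, _, _, @Term.comp _ _ _ _ _ _ _ _ _ x y, _ => Q.comp (x.eval Q φ) (fun i => (y i).eval Q φ)

/-- Apart from `R` itself, every clause of the congruence is an axiom valid in `Q`. Finiteness of
the inputs is quantified after the relation, because the index type of a generator carries no such
instance. -/
theorem Term.eval_eq_of_rel {G : (I : Type) → (I → C) → C → Type u} {Q : ColouredOperad.{w} C}
    {φ : ∀ (I : Type) [Finite I] (a : I → C) (d : C), G I a d → Q.Op I a d}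
    {R : ∀ (I : Type) (a : I → C) (d : C), Term G I a d → Term G I a d → Prop}
    (hR : ∀ (I : Type) [Finite I] (a : I → C) (d : C) (x y : Term G I a d), R I a d x y →
      x.eval Q φ = y.eval Q φ) {I : Type} {a : I → C} {d : C} {x y : Term G I a d}
    (h : Rel R I a d x y) : ∀ [Finite I], x.eval Q φ = y.eval Q φ := by
  induction h with
  | of h => intro _; exact hR _ _ _ _ _ h
  | refl x => intro _; rfl
  | symm _ ih => intro _; exact ih.symm
  | trans _ _ ih ih' => intro _; exact ih.trans ih'
  | act_congr e _ ih => intro _; simp only [Term.eval]; rw [ih]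
  | comp_congr _ _ ih ih' =>
    intro _
    simp only [Term.eval]
    rw [ih, funext fun i => @ih' i _]
  | act_refl x => intro _; exact Q.act_refl _
  | act_act e f x => intro _; exact Q.act_act e f _
  | comp_act e x y => intro _; exact Q.comp_act e _ _
  | comp_act_inner e x y => intro _; exact Q.comp_act_inner e _ _
  | one_comp x => intro _; exact Q.one_comp _
  | comp_one x => intro _; exact Q.comp_one _
  | comp_assoc x y z =>
    intro _
    exact Q.comp_assoc (x.eval Q φ) (fun i => (y i).eval Q φ) (fun i j => (z i j).eval Q φ)

/-- The class of a formal expression in a presented operad. -/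
def cls {G : (I : Type) → (I → C) → C → Type u}
    (R : ∀ (I : Type) (a : I → C) (d : C), Term G I a d → Term G I a d → Prop) {I : Type}
    [Finite I] {a : I → C} {d : C} (x : Term G I a d) : (presented G R).Op I a d :=
  Quotient.mk (relSetoid R I a d) x

section presented

variable {G : (I : Type) → (I → C) → C → Type u}
  {R : ∀ (I : Type) (a : I → C) (d : C), Term G I a d → Term G I a d → Prop}

theorem exists_cls {I : Type} [Finite I] {a : I → C} {d : C} (x : (presented G R).Op I a d) :
    ∃ t : Term G I a d, cls R t = x := Quotient.exists_rep x

theorem cls_sound {I : Type} [Finite I] {a : I → C} {d : C} {x y : Term G I a d}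
    (h : R I a d x y) : cls R x = cls R y := Quotient.sound (.of h)

theorem cls_one (c : C) : cls R (.one c) = (presented G R).one c := rfl

theorem cls_act {I J : Type} [Finite I] [Finite J] {b : J → C} {d : C} (e : I ≃ J)
    (x : Term G I (fun i => b (e i)) d) : cls R (.act e x) = (presented G R).act e (cls R x) := rfl

theorem cls_comp {I : Type} {J : I → Type} [Finite I] [∀ i, Finite (J i)] {a : I → C}
    {b : ∀ i, J i → C} {d : C} (x : Term G I a d) (y : ∀ i, Term G (J i) (b i) (a i)) :
    cls R (.comp x y) = (presented G R).comp (cls R x) (fun i => cls R (y i)) :=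
  (presentedComp_mk R x y).symm

/-- The morphism from a presented operad determined by the values of the generators. -/
def lift (Q : ColouredOperad.{w} C)
    (φ : ∀ (I : Type) [Finite I] (a : I → C) (d : C), G I a d → Q.Op I a d)
    (hR : ∀ (I : Type) [Finite I] (a : I → C) (d : C) (x y : Term G I a d), R I a d x y →
      x.eval Q φ = y.eval Q φ) : Hom (presented G R) Q where
  map {I _ a d} x := Quotient.lift (s := relSetoid R I a d) (fun t => t.eval Q φ)
    (fun _ _ h => Term.eval_eq_of_rel hR h) x
  map_one _ := rfl
  map_act e x := by
    obtain ⟨x, rfl⟩ := exists_cls x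
    rfl
  map_comp x y := by
    obtain ⟨x, rfl⟩ := exists_cls x
    choose y' hy using fun i => exists_cls (y i)
    obtain rfl : (fun i => cls R (y' i)) = y := funext hy
    rw [← cls_comp]
    rfl

/-- Induction over the operations of a presented operad. -/
theorem presented_induction {M : ∀ {I : Type} [Finite I] {a : I → C} {d : C},
      (presented G R).Op I a d → Prop}
    (gen : ∀ {I : Type} [Finite I] {a : I → C} {d : C} (g : G I a d), M (cls R (.gen g)))
    (one : ∀ c, M ((presented G R).one c))
    (act : ∀ {I J : Type} [Finite I] [Finite J] {b : J → C} {d : C} (e : I ≃ J)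
      (x : (presented G R).Op I (fun i => b (e i)) d), M x → M ((presented G R).act e x))
    (comp : ∀ {I : Type} {J : I → Type} [Finite I] [∀ i, Finite (J i)] {a : I → C}
      {b : ∀ i, J i → C} {d : C} (x : (presented G R).Op I a d)
      (y : ∀ i, (presented G R).Op (J i) (b i) (a i)), M x → (∀ i, M (y i)) →
      M ((presented G R).comp x y))
    {I : Type} [Finite I] {a : I → C} {d : C} (x : (presented G R).Op I a d) : M x := by
  suffices h : ∀ {I : Type} {a : I → C} {d : C} (t : Term G I a d) [Finite I], M (cls R t) by
    obtain ⟨t, rfl⟩ := exists_cls x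
    exact h t
  intro I a d t
  induction t with
  | gen g => exact gen g
  | one c => exact one c
  | act e x ih => exact act e _ ih
  | comp x y ihx ihy =>
    have := comp (cls R x) (fun i => cls R (y i)) ihx (fun i => ihy i)
    rw [← cls_comp] at this
    exact fun {_} => this

/-- Morphisms from a presented operad that agree on the generators are equal. -/
theorem hom_ext {Q : ColouredOperad.{w} C} {f g : Hom (presented G R) Q}
    (h : ∀ {I : Type} [Finite I] {a : I → C} {d : C} (x : G I a d),
      f.map (cls R (.gen x)) = g.map (cls R (.gen x))) {I : Type} [Finite I] {a : I → C} {d : C}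
    (x : (presented G R).Op I a d) : f.map x = g.map x := by
  refine presented_induction (M := fun x => f.map x = g.map x) h ?_ ?_ ?_ x
  · intro c; rw [f.map_one, g.map_one]
  · intro I J _ _ b d e x ih; rw [f.map_act, g.map_act, ih]
  · intro I J _ _ a b d x y ihx ihy; rw [f.map_comp, g.map_comp, ihx, funext ihy]

end presented

/-! ### Partial composites in an operad and their evaluation -/

/-- The composite `x ∘ (-, …, -, y₁, …, yₘ)`: the inputs in `K` are left open and `y e` is inserted
in the input `e : E`. -/
def fill (P : ColouredOperad.{u} C) {K E : Type} [Finite K]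
    [Finite E] {J : E → Type} [∀ e, Finite (J e)] {c : K ⊕ (Σ e, J e) → C} {b : E → C} {d : C}
    (x : P.Op (K ⊕ E) (Sum.elim (fun k => c (.inl k)) b) d)
    (y : ∀ e, P.Op (J e) (fun j => c (.inr ⟨e, j⟩)) (b e)) :
    P.Op (K ⊕ Σ e, J e) c d :=
  P.act (fillEquiv K J) (P.comp (J := Sum.elim (fun _ => Unit) J)
    (b := fun s j => c (fillEquiv K J ⟨s, j⟩)) x
    (fun | .inl k => P.one (c (.inl k)) | .inr e => y e))

/-- The composite `x ∘ (-, …, -, h, …, h)` in which an operation `h` without inputs is inserted in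
all inputs in `E`. -/
def plug (P : ColouredOperad.{u} C) {K E : Type} [Finite K]
    [Finite E] {a : K → C} {u d : C} (x : P.Op (K ⊕ E) (Sum.elim a (fun _ => u)) d)
    (h : ∀ z : Empty → C, P.Op Empty z u) : P.Op K a d :=
  P.act (plugEquiv K E)
    (P.fill (c := fun s => a (plugEquiv K E s)) x (fun _ => h _))

theorem Hom.map_fill {P : ColouredOperad.{u} C} {Q : ColouredOperad.{w} C} (f : Hom P Q)
    {K E : Type} [Finite K]
    [Finite E] {J : E → Type} [∀ e, Finite (J e)] {c : K ⊕ (Σ e, J e) → C} {b : E → C} {d : C}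
    (x : P.Op (K ⊕ E) (Sum.elim (fun k => c (.inl k)) b) d)
    (y : ∀ e, P.Op (J e) (fun j => c (.inr ⟨e, j⟩)) (b e)) :
    f.map (P.fill x y) = Q.fill (f.map x) (fun e => f.map (y e)) := by
  refine (f.map_act _ _).trans (congrArg _ ((f.map_comp _ _).trans (congrArg _ ?_)))
  funext s
  cases s with
  | inl k => exact f.map_one _
  | inr e => rfl

section presented

variable {G : (I : Type) → (I → C) → C → Type u}
  {R : ∀ (I : Type) (a : I → C) (d : C), Term G I a d → Term G I a d → Prop}

theorem cls_fill {K E : Type} [Finite K]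
    [Finite E] {J : E → Type} [∀ e, Finite (J e)] {c : K ⊕ (Σ e, J e) → C} {b : E → C}
    {d : C} (x : Term G (K ⊕ E) (Sum.elim (fun k => c (.inl k)) b) d)
    (y : ∀ e, Term G (J e) (fun j => c (.inr ⟨e, j⟩)) (b e)) :
    cls R (Term.fill x y) = (presented G R).fill (cls R x) (fun e => cls R (y e)) := by
  unfold Term.fill fill
  rw [cls_act, cls_comp]
  congr 2
  funext s
  cases s <;> rfl

theorem cls_plug {K E : Type} [Finite K] [Finite E] {a : K → C} {u d : C}
    (x : Term G (K ⊕ E) (Sum.elim a (fun _ => u)) d) (h : ∀ z : Empty → C, Term G Empty z u) :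
    cls R (Term.plug x h) = (presented G R).plug (cls R x) (fun z => cls R (h z)) :=
  congrArg ((presented G R).act _) (cls_fill _ _)

theorem Term.eval_fill (Q : ColouredOperad.{w} C)
    (φ : ∀ (I : Type) [Finite I] (a : I → C) (d : C), G I a d → Q.Op I a d) {K E : Type} [Finite K]
    [Finite E] {J : E → Type} [∀ e, Finite (J e)] {c : K ⊕ (Σ e, J e) → C} {b : E → C}
    {d : C} (x : Term G (K ⊕ E) (Sum.elim (fun k => c (.inl k)) b) d)
    (y : ∀ e, Term G (J e) (fun j => c (.inr ⟨e, j⟩)) (b e)) :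
    (Term.fill x y).eval Q φ = Q.fill (x.eval Q φ) (fun e => (y e).eval Q φ) := by
  refine congrArg (Q.act _) (congrArg (Q.comp (x.eval Q φ)) ?_)
  funext s
  cases s <;> rfl

theorem Term.eval_plug (Q : ColouredOperad.{w} C)
    (φ : ∀ (I : Type) [Finite I] (a : I → C) (d : C), G I a d → Q.Op I a d)
    {K E : Type} [Finite K] [Finite E] {a : K → C} {u d : C}
    (x : Term G (K ⊕ E) (Sum.elim a (fun _ => u)) d) (h : ∀ z : Empty → C, Term G Empty z u) :
    (Term.plug x h).eval Q φ = Q.plug (x.eval Q φ) (fun z => (h z).eval Q φ) :=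
  congrArg (Q.act _) (Term.eval_fill Q φ _ _)

end presented

/-! ### Endomorphism operads and the faithful free algebra -/

/-- The operad of all operations on a family of sets `A c`, `c : C`. -/
def endo (A : C → Type w) : ColouredOperad.{w} C where
  Op _ _ a d := (∀ i, A (a i)) → A d
  one _ := fun z => z ()
  act e x := fun z => x (fun i => z (e i))
  comp x y := fun z => x (fun i => y i (fun j => z ⟨i, j⟩))
  act_refl _ := rfl
  act_act _ _ _ := rfl
  comp_act _ _ _ := rfl
  comp_act_inner _ _ _ := rfl
  one_comp _ := rfl
  comp_one _ := rfl
  comp_assoc _ _ _ := rfl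

end ColouredOperad

namespace ColouredOperad

variable {C : Type v}

/-- An operation of `P` whose inputs are labelled by variables `V` with colours `a`. -/
structure FreeElt (P : ColouredOperad.{u} C) {V : Type} (a : V → C) (d : C) : Type (max 1 u) where
  /-- the inputs -/
  inputs : Type
  finite : Finite inputs
  /-- the variables inserted in the inputs -/
  var : inputs → V
  /-- the operation -/
  op : P.Op inputs (fun j => a (var j)) d

attribute [instance] FreeElt.finite

variable {P : ColouredOperad.{u} C} {V : Type} {a : V → C}

/-- Two labelled operations agree up to renaming of the inputs. -/
def FreeElt.Equivalent {d : C} (x y : FreeElt P a d) : Prop :=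
  ∃ (e : x.inputs ≃ y.inputs) (h : ∀ j, x.var j = y.var (e j)),
    P.relabel e (fun j => congrArg a (h j)) x.op = y.op

/-- Labelled operations up to renaming of the inputs. -/
instance FreeElt.setoid (P : ColouredOperad.{u} C) {V : Type} (a : V → C) (d : C) :
    Setoid (FreeElt P a d) where
  r := FreeElt.Equivalent
  iseqv := by
    refine ⟨fun x => ⟨Equiv.refl _, fun _ => rfl, P.relabel_refl _ (fun _ => rfl) _ _⟩, ?_, ?_⟩
    · rintro x y ⟨e, h, h'⟩
      refine ⟨e.symm, fun j => by rw [h, e.apply_symm_apply], ?_⟩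
      rw [← h', P.relabel_relabel]
      exact P.relabel_refl _ (fun _ => by simp) _ _
    · rintro x y z ⟨e, h, h'⟩ ⟨f, g, g'⟩
      refine ⟨e.trans f, fun j => by rw [h, g]; rfl, ?_⟩
      rw [← g', ← h', P.relabel_relabel]

/-- The free `P`-algebra on the variables `V` of colours `a`. -/
def FreeAlg (P : ColouredOperad.{u} C) {V : Type} (a : V → C) (d : C) : Type (max 1 u) :=
  Quotient (FreeElt.setoid P a d)

/-- Insertion of labelled operations in an operation. -/
def FreeElt.comp {K : Type} [Finite K] {c : K → C} {d : C} (x : P.Op K c d)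
    (y : ∀ k, FreeElt P a (c k)) : FreeElt P a d where
  inputs := Σ k, (y k).inputs
  finite := inferInstance
  var p := (y p.1).var p.2
  op := P.comp x (fun k => (y k).op)

/-- The action on the free algebra is defined through chosen representatives; this makes the result
independent of the choice. The bijections of the inputs of the `y k` combine by equivariance in the
inner operations. -/
theorem FreeElt.comp_congr {K : Type} [Finite K] {c : K → C} {d : C} (x : P.Op K c d)
    {y y' : ∀ k, FreeElt P a (c k)} (h : ∀ k, y k ≈ y' k) :
    FreeElt.comp x y ≈ FreeElt.comp x y' := by
  choose e h h' using h
  refine ⟨Equiv.sigmaCongrRight e, fun p => h p.1 p.2, ?_⟩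
  have := P.comp_relabel_inner (c := fun k j => a ((y' k).var j)) e (fun k j => congrArg a (h k j))
    x (fun k => (y k).op)
  rw [funext h'] at this
  exact this.symm

/-- The class of a labelled operation. -/
def FreeAlg.of {d : C} (x : FreeElt P a d) : FreeAlg P a d := Quotient.mk _ x

theorem FreeAlg.exists_of {d : C} (x : FreeAlg P a d) : ∃ y, FreeAlg.of y = x :=
  Quotient.exists_rep x

/-- The action of `P` on the free algebra. -/
noncomputable def FreeAlg.act {K : Type} [Finite K] {c : K → C} {d : C} (x : P.Op K c d)
    (y : ∀ k, FreeAlg P a (c k)) : FreeAlg P a d :=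
  FreeAlg.of (FreeElt.comp x (fun k => (y k).out))

theorem FreeAlg.act_of {K : Type} [Finite K] {c : K → C} {d : C} (x : P.Op K c d)
    (y : ∀ k, FreeElt P a (c k)) :
    FreeAlg.act x (fun k => FreeAlg.of (y k)) = FreeAlg.of (FreeElt.comp x y) :=
  Quotient.sound (FreeElt.comp_congr x (fun k => Quotient.mk_out (s := FreeElt.setoid P a _) (y k)))

/-- The structure of the free algebra, as a morphism of operads. -/
noncomputable def freeHom (P : ColouredOperad.{u} C) {V : Type} (a : V → C) :
    Hom P (endo (FreeAlg P a)) where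
  map x := FreeAlg.act x
  map_one c := by
    funext z
    obtain ⟨y, hy⟩ := FreeAlg.exists_of (z ())
    obtain rfl : (fun _ => FreeAlg.of y) = z := funext fun _ => hy
    rw [FreeAlg.act_of]
    -- The operad axioms hold in `P` after a canonical bijection of the inputs. Passing to classes
    -- absorbs this bijection, here and in the two cases below.
    refine Quotient.sound ⟨sigmaUnitEquiv _, fun _ => rfl, ?_⟩
    exact P.one_comp y.op
  map_act {I J} _ _ {b d} e x := by
    funext z
    choose y hy using fun j => FreeAlg.exists_of (z j)
    obtain rfl : (fun j => FreeAlg.of (y j)) = z := funext hy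
    rw [FreeAlg.act_of]
    refine Eq.trans ?_ (FreeAlg.act_of x (fun i => y (e i))).symm
    refine Eq.symm (Quotient.sound
      ⟨Equiv.sigmaCongrLeft (β := fun j => (y j).inputs) e, fun _ => rfl, ?_⟩)
    exact (P.comp_act e x (fun j => (y j).op)).symm
  map_comp {I J} _ _ {a b d} x y := by
    funext z
    choose z' hz using fun p => FreeAlg.exists_of (z p)
    obtain rfl : (fun p => FreeAlg.of (z' p)) = z := funext hz
    rw [FreeAlg.act_of]
    have : (fun i => FreeAlg.act (y i) (fun j => FreeAlg.of (z' ⟨i, j⟩)))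
        = fun i => FreeAlg.of (FreeElt.comp (y i) (fun j => z' ⟨i, j⟩)) :=
      funext fun i => FreeAlg.act_of (y i) (fun j => z' ⟨i, j⟩)
    refine Eq.trans ?_ (congrArg (FreeAlg.act x) this).symm
    rw [FreeAlg.act_of]
    refine Quotient.sound ⟨Equiv.sigmaAssoc (fun i j => (z' ⟨i, j⟩).inputs), fun _ => rfl, ?_⟩
    exact P.comp_assoc x y (fun i j => (z' ⟨i, j⟩).op)

/-- The free algebra is faithful: operations that act equally on the variables are equal. -/
theorem freeHom_injective [Finite V] {d : C} {x y : P.Op V a d}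
    (h : (freeHom P a).map x = (freeHom P a).map y) : x = y := by
  -- Evaluation at the generic element, the tuple of all variables, returns `x` itself.
  have key : ∀ x : P.Op V a d, (freeHom P a).map x
      (fun i => FreeAlg.of ⟨Unit, inferInstance, fun _ => i, P.one (a i)⟩)
        = FreeAlg.of ⟨V, inferInstance, fun i => i, x⟩ := by
    intro x
    refine (FreeAlg.act_of x _).trans (Quotient.sound ⟨Equiv.sigmaPUnit V, fun _ => rfl, ?_⟩)
    exact P.comp_one x
  have h' := (key x).symm.trans ((congrFun h _).trans (key y))
  obtain ⟨e, he, h''⟩ := Quotient.exact h'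
  -- Each input carries itself as its variable, so a bijection that preserves variables is the
  -- identity.
  exact (P.relabel_refl e (fun i => (he i).symm) _ x).symm.trans h''

end ColouredOperad

/-! ### Box algebras and the evaluation of forests -/

namespace BoxOp

section lists

variable {B : Type w} (col : B → Colour)

/-- The side labels of adjacent members of the list agree, and the first left label is `x`. -/
def Chain : ℕ → List B → Prop
  | _, [] => True
  | x, b :: L => (col b).1 = x ∧ Chain (col b).2.2 L

/-- The last right label of a list, or `x` if the list is empty. -/
def chainEnd : ℕ → List B → ℕ
  | x, [] => x
  | _, b :: L => chainEnd (col b).2.2 L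

/-- The total number of inputs of the members of a list. -/
def totalInputs : List B → ℕ
  | [] => 0
  | b :: L => (col b).2.1 + totalInputs L

/-- The boxes `L`, with first left label `x`, fit on top of `b`. -/
def Fits (b : B) (x : ℕ) (L : List B) : Prop := L.length = (col b).2.1 ∧ Chain col x L

/-- The boxes `M`, with first left label `x`, are put on top of the boxes `L`. -/
def graftList (box : B → ℕ → List B → B) : List B → ℕ → List B → List B
  | [], _, _ => []
  | b :: L, x, M => box b x (M.take (col b).2.1) ::
      graftList box L (chainEnd col x (M.take (col b).2.1)) (M.drop (col b).2.1)

variable {col}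

theorem chainEnd_append {x : ℕ} {L M : List B} :
    chainEnd col x (L ++ M) = chainEnd col (chainEnd col x L) M := by
  induction L generalizing x with
  | nil => rfl
  | cons b L ih => simp [chainEnd, ih]

end lists

/-- A box algebra whose elements of all colours are collected in one set; `box b x L` is the result
of putting the boxes `L`, with first left label `x`, on top of `b`, and is `b` if they do not
fit. -/
structure BoxAlgebra where
  /-- the elements -/
  B : Type w
  /-- the colour of an element -/
  col : B → Colour
  /-- the operations `C` -/
  box : B → ℕ → List B → B
  /-- the unit -/
  eta : B
  col_box : ∀ {b x L}, Fits col b x L →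
    col (box b x L) = ((col b).1 + x, totalInputs col L, (col b).2.2 + chainEnd col x L)
  box_of_not_fits : ∀ {b x L}, ¬ Fits col b x L → box b x L = b
  assoc : ∀ {b x L x' M}, Fits col b x L → Fits col (box b x L) x' M →
    box (box b x L) x' M = box b (x + x') (graftList col box L x' M)
  col_eta : col eta = (0, 1, 0)
  box_eta : ∀ {x t}, (col t).1 = x → box eta x [t] = t
  box_top : ∀ b, box b 0 (List.replicate (col b).2.1 eta) = b

namespace BoxAlgebra

variable (A : BoxAlgebra.{w}) {I : Type}

/-- The operation given by a forest, applied to the elements `env i`; `x` is the left depth. -/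
def eval (env : I → A.B) : Forest I → ℕ → List A.B
  | .nil, _ => []
  -- The depth `x` of the root includes its own left label, so the row above it starts at the
  -- difference; for a spanning forest this subtraction is not truncated. The remaining trees start
  -- at the right label of the value just computed.
  | .cons v c f, x =>
      A.box (env v) (x - (A.col (env v)).1) (eval env c (x - (A.col (env v)).1)) ::
        eval env f (A.col (A.box (env v) (x - (A.col (env v)).1)
          (eval env c (x - (A.col (env v)).1)))).2.2

/-- A forest spans from `x` to `y`, for the colours of the elements `env i`. -/
abbrev Spans (env : I → A.B) (f : Forest I) (x y : ℕ) : Prop :=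
  f.Spans (fun i => (A.col (env i)).1) (fun i => (A.col (env i)).2.1)
    (fun i => (A.col (env i)).2.2) x y

/-- The number of inputs of an element of the algebra inserted in a box. -/
abbrev q (env : I → A.B) (i : I) : ℕ := (A.col (env i)).2.1

variable {A} {env : I → A.B}

theorem spans_cons {v : I} {c f : Forest I} {x y : ℕ} : A.Spans env (.cons v c f) x y ↔
    ∃ s t, A.Spans env c s t ∧ (c = .nil → 0 < A.q env v → s = 0) ∧
      x = s + (A.col (env v)).1 ∧ A.Spans env f (t + (A.col (env v)).2.2) y := Iff.rfl

theorem eval_cons (v : I) (c f : Forest I) (s : ℕ) :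
    A.eval env (.cons v c f) (s + (A.col (env v)).1) = A.box (env v) s (A.eval env c s) ::
      A.eval env f (A.col (A.box (env v) s (A.eval env c s))).2.2 := by
  simp only [eval, Nat.add_sub_cancel]

/-- The purpose of the default value: the empty row does not fit on a box with inputs, so a leaf
whose inputs stay open is left unchanged. -/
theorem box_leaf {b : A.B} (h : 0 < (A.col b).2.1) (x : ℕ) : A.box b x [] = b :=
  A.box_of_not_fits (fun h' => by have := h'.1; simp at this; omega)

/-- There are three cases. A leaf without inputs is hit by `C` with an empty row, which adds its
start value to both labels. A leaf with inputs has start value `0` and is unchanged. At an internal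
vertex the row of values fits. What is needed about this row is the hypothesis `h`, so that the
lemma can serve inside the induction for `eval_spec`. -/
theorem col_vertex {v : I} {c : Forest I} {x y : ℕ} (hc : c = .nil ∨ c.length = A.q env v)
    (hx : c = .nil → 0 < A.q env v → x = 0) (hs : A.Spans env c x y)
    (h : (A.eval env c x).length = c.length ∧ Chain A.col x (A.eval env c x) ∧
      chainEnd A.col x (A.eval env c x) = y ∧
      totalInputs A.col (A.eval env c x) = c.inputs (A.q env)) :
    A.col (A.box (env v) x (A.eval env c x)) =
      (x + (A.col (env v)).1, (Forest.cons v c .nil).inputs (A.q env),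
        y + (A.col (env v)).2.2) := by
  have fits : (A.eval env c x).length = A.q env v → _ :=
    fun hl => A.col_box (b := env v) ⟨hl, h.2.1⟩
  rw [h.2.2.1, h.2.2.2] at fits
  by_cases hn : c = .nil
  · subst hn
    cases hs
    rcases Nat.eq_zero_or_pos (A.q env v) with hq | hq
    · rw [fits (by rw [h.1, hq]; rfl)]
      simp [Forest.inputs, hq, Nat.add_comm]
    · obtain rfl := hx rfl hq
      rw [eval, box_leaf hq]
      simp [Forest.inputs]
  · rw [fits (by rw [h.1, hc.resolve_left hn]), Forest.inputs_cons v hn]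
    simp [Forest.inputs, Nat.add_comm]

/-- The invariant behind evaluation: depths are side labels of values. Equality of adjacent depths
therefore says exactly that the values of adjacent trees can be put next to each other. -/
theorem eval_spec {f : Forest I} (hf : f.Full (A.q env)) {x y : ℕ} (hs : A.Spans env f x y) :
    (A.eval env f x).length = f.length ∧ Chain A.col x (A.eval env f x) ∧
      chainEnd A.col x (A.eval env f x) = y ∧
      totalInputs A.col (A.eval env f x) = f.inputs (A.q env) := by
  induction f generalizing x y with
  | nil => exact ⟨rfl, trivial, hs, rfl⟩
  | cons v c f ihc ihf =>
    obtain ⟨x', y', h1, h2, rfl, h3⟩ := spans_cons.mp hs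
    have hv := col_vertex hf.1 h2 h1 (ihc hf.2.1 h1)
    obtain ⟨i1, i2, i3, i4⟩ := ihf hf.2.2 h3
    simp only [eval, Nat.add_sub_cancel, Chain, chainEnd, totalInputs, List.length_cons, hv]
    refine ⟨by rw [i1]; rfl, ⟨trivial, i2⟩, i3, ?_⟩
    rw [i4]
    cases c <;> simp [Forest.inputs]

theorem col_box_eval {v : I} {c : Forest I} {x y : ℕ} (hc : c = .nil ∨ c.length = A.q env v)
    (hf : c.Full (A.q env))
    (hx : c = .nil → 0 < A.q env v → x = 0) (hs : A.Spans env c x y) :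
    A.col (A.box (env v) x (A.eval env c x)) =
      (x + (A.col (env v)).1, (Forest.cons v c .nil).inputs (A.q env),
        y + (A.col (env v)).2.2) :=
  col_vertex hc hx hs (eval_spec hf hs)

theorem fits_eval {b : A.B} {c : Forest I} {x y : ℕ} (hl : c.length = (A.col b).2.1)
    (hf : c.Full (A.q env)) (hs : A.Spans env c x y) :
    Fits A.col b x (A.eval env c x) :=
  ⟨(eval_spec hf hs).1.trans hl, (eval_spec hf hs).2.1⟩

theorem eval_append (f g : Forest I) (x : ℕ) :
    A.eval env (f.append g) x
      = A.eval env f x ++ A.eval env g (chainEnd A.col x (A.eval env f x)) := by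
  induction f generalizing x with
  | nil => rfl
  | cons v c f _ ih => simp [Forest.append, eval, ih, chainEnd]

theorem eval_map {J : Type} (e : J → I) (f : Forest J) (x : ℕ) :
    A.eval env (f.map e) x = A.eval (fun j => env (e j)) f x := by
  induction f generalizing x with
  | nil => rfl
  | cons v c f ihc ihf => simp [Forest.map, eval, ihc, ihf]

/-- This is associativity of `C`, propagated through the forest: grafting above a subtree and then
applying the root agrees with applying the root first and putting the new row on the result. Depths
add, hence the start `x + x'`. -/
theorem eval_graft {F L : Forest I} (h : L.length = F.inputs (A.q env))
    (hF : F.Full (A.q env)) (hL : L.Full (A.q env)) {x y x' y' : ℕ} (hFs : A.Spans env F x y)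
    (hLs : A.Spans env L x' y') :
    A.eval env (F.graft (A.q env) L) (x + x')
      = graftList A.col A.box (A.eval env F x) x' (A.eval env L x') := by
  refine Forest.graft_induction (A.q env) (M := fun F L => ∀ x y x' y', F.Full (A.q env) →
    L.Full (A.q env) → A.Spans env F x y → A.Spans env L x' y' →
    A.eval env (F.graft (A.q env) L) (x + x')
      = graftList A.col A.box (A.eval env F x) x' (A.eval env L x')) ?_ ?_ ?_ F L h
      x y x' y' hF hL hFs hLs
  · intros; rfl
  · intro v f L₁ L₂ h1 h2 ih x y x' y' hF hL hFs hLs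
    obtain ⟨s, t, hs1, hs2, rfl, hs3⟩ := spans_cons.mp hFs
    obtain ⟨z, hz1, hz2⟩ := Forest.spans_of_append hLs
    have hL1 := (Forest.full_of_append hL).1
    have e1 := eval_spec hL1 hz1
    have hcol := col_box_eval hF.1 hF.2.1 hs2 hs1
    have hfit : Fits A.col (A.box (env v) s (A.eval env .nil s)) x' (A.eval env L₁ x') :=
      fits_eval (by rw [h1, hcol]; simp [Forest.inputs]) hL1 hz1
    have hcol' := A.col_box hfit
    -- A leaf without inputs receives nothing, and associativity with empty rows adds the start
    -- values `s` and `x'`. A leaf with inputs has `s = 0` and is its own value, so there is nothing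
    -- to associate.
    have hb : A.box (env v) (s + x') (A.eval env L₁ (s + x'))
        = A.box (A.box (env v) s (A.eval env .nil s)) x' (A.eval env L₁ x') := by
      rcases Nat.eq_zero_or_pos (A.q env v) with hq | hq
      · obtain rfl := Forest.length_eq_zero (h1.trans hq)
        exact (A.assoc (L := []) ⟨hq.symm, trivial⟩ hfit).symm
      · obtain rfl := hs2 rfl hq
        rw [eval, box_leaf hq, Nat.zero_add]
    rw [Forest.graft_leaf h1, show s + (A.col (env v)).1 + x' = s + x' + (A.col (env v)).1
      by omega, eval_cons, hb, hcol', hcol, e1.2.2.1,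
      ih _ _ _ _ hF.2.2 (Forest.full_of_append hL).2 hs3 hz2,
      eval_append, eval_cons, graftList, hcol]
    have hl : (A.eval env L₁ x').length = (Forest.cons v .nil .nil).inputs (A.q env) := by
      rw [e1.1, h1]; simp [Forest.inputs]
    rw [List.take_left' hl, List.drop_left' hl, e1.2.2.1]
  · intro v c f L₁ L₂ hc h1 h2 ihc ihf x y x' y' hF hL hFs hLs
    obtain ⟨s, t, hs1, hs2, rfl, hs3⟩ := spans_cons.mp hFs
    obtain ⟨z, hz1, hz2⟩ := Forest.spans_of_append hLs
    have hL1 := (Forest.full_of_append hL).1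
    have e1 := eval_spec hL1 hz1
    have hcol := col_box_eval hF.1 hF.2.1 hs2 hs1
    have hfit : Fits A.col (A.box (env v) s (A.eval env c s)) x' (A.eval env L₁ x') :=
      fits_eval (by rw [h1, hcol, Forest.inputs_cons v hc]; simp [Forest.inputs]) hL1 hz1
    have hcol' := A.col_box hfit
    have hb : A.box (env v) (s + x') (A.eval env (c.graft (A.q env) L₁) (s + x'))
        = A.box (A.box (env v) s (A.eval env c s)) x' (A.eval env L₁ x') := by
      rw [ihc _ _ _ _ hF.2.1 hL1 hs1 hz1]
      exact (A.assoc (fits_eval (hF.1.resolve_left hc) hF.2.1 hs1) hfit).symm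
    rw [Forest.graft_cons hc h1, show s + (A.col (env v)).1 + x' = s + x' + (A.col (env v)).1
      by omega, eval_cons, hb, hcol', hcol, e1.2.2.1,
      ihf _ _ _ _ hF.2.2 (Forest.full_of_append hL).2 hs3 hz2,
      eval_append, eval_cons, graftList, hcol]
    have hl : (A.eval env L₁ x').length = (Forest.cons v c .nil).inputs (A.q env) := by
      rw [e1.1, h1, Forest.inputs_cons v hc]; simp [Forest.inputs]
    rw [List.take_left' hl, List.drop_left' hl, e1.2.2.1]

variable (A env) in
/-- The operation given by a tree, applied to the elements `env i`; `x` is the left depth. -/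
def val (f : Forest I) (x : ℕ) : A.B := (A.eval env f x).headD A.eta

theorem eval_eq_val {f : Forest I} (hl : f.length = 1) (x : ℕ) :
    A.eval env f x = [A.val env f x] := by
  match f, hl with
  | .cons v c .nil, _ => rfl
  | .cons v c (.cons _ _ _), h => simp [Forest.length] at h

theorem col_val {f : Forest I} (hl : f.length = 1) (hf : f.Full (A.q env)) {x y : ℕ}
    (hs : A.Spans env f x y) : A.col (A.val env f x) = (x, f.inputs (A.q env), y) := by
  obtain ⟨-, h2, h3, h4⟩ := eval_spec hf hs
  rw [eval_eq_val hl] at h2 h3 h4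
  simp only [Chain, chainEnd, totalInputs] at h2 h3 h4
  ext
  · exact h2.1
  · exact h4
  · exact h3

/-- Compatibility with operadic composition. The tree substituted in `v` has a single value, of
colour `a v`. By `eval_graft`, grafting the substituted children on that tree amounts to putting
their values as one row on this value. -/
theorem eval_subst {J : I → Type} {env : (Σ i, J i) → A.B} {T : ∀ i, Forest (J i)}
    {a : I → Colour} (hT : ∀ i, (T i).length = 1)
    (hq : ∀ i, (T i).inputs (A.q fun j => env ⟨i, j⟩) = (a i).2.1)
    (hF : ∀ i, (T i).Full (A.q fun j => env ⟨i, j⟩))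
    (hS : ∀ i, A.Spans (fun j => env ⟨i, j⟩) (T i) (a i).1 (a i).2.2)
    {f : Forest I} (hf : f.Full (fun i => (a i).2.1)) {x y : ℕ}
    (h : f.Spans (fun i => (a i).1) (fun i => (a i).2.1) (fun i => (a i).2.2) x y) :
    A.eval env (f.subst (fun i j => A.q env ⟨i, j⟩) T) x
      = A.eval (fun i => A.val (fun j => env ⟨i, j⟩) (T i) (a i).1) f x := by
  have hcol : ∀ i, A.col (A.val (fun j => env ⟨i, j⟩) (T i) (a i).1) = a i := fun i => by
    rw [col_val (hT i) (hF i) (hS i), hq]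
  have hqe : (A.q fun i => A.val (fun j => env ⟨i, j⟩) (T i) (a i).1) = fun i => (a i).2.1 :=
    funext fun i => congrArg (fun c => c.2.1) (hcol i)
  induction f generalizing x y with
  | nil => rfl
  | cons v c f ihc ihf =>
    obtain ⟨x', y', h1, h2, rfl, h3⟩ := h
    have ihc := ihc hf.2.1 h1
    have ihf := ihf hf.2.2 h3
    have hTe : A.eval env ((T v).map (Sigma.mk v)) (a v).1
        = [A.val (fun j => env ⟨v, j⟩) (T v) (a v).1] := by
      rw [eval_map, eval_eq_val (hT v)]
    have hSc := Forest.spans_subst (p := fun i j => (A.col (env ⟨i, j⟩)).1)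
      (q := fun i j => (A.col (env ⟨i, j⟩)).2.1) (r := fun i j => (A.col (env ⟨i, j⟩)).2.2)
      (l := fun i => (a i).1) (m := fun i => (a i).2.2) hT hq hS hf.2.1 h1
    have hFc := Forest.full_subst hT hq hF hf.2.1
    have hcolb : (A.col (A.box (A.val (fun j => env ⟨v, j⟩) (T v) (a v).1) x'
        (A.eval (fun i => A.val (fun j => env ⟨i, j⟩) (T i) (a i).1) c x'))).2.2
        = y' + (a v).2.2 := by
      have := col_box_eval (A := A) (env := fun i => A.val (fun j => env ⟨i, j⟩) (T i) (a i).1)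
        (v := v) (c := c) (x := x') (y := y') (by simpa only [q, hcol] using hf.1)
        (by rw [hqe]; exact hf.2.1) (by simpa only [q, hcol] using h2)
        (by simpa only [Spans, hcol] using h1)
      rw [this, hcol]
    have key : A.eval env (((T v).map (Sigma.mk v)).graft (A.q env)
        (c.subst (fun i j => A.q env ⟨i, j⟩) T)) (x' + (a v).1)
        = [A.box (A.val (fun j => env ⟨v, j⟩) (T v) (a v).1) x'
          (A.eval (fun i => A.val (fun j => env ⟨i, j⟩) (T i) (a i).1) c x')] := by
      -- For a leaf with open inputs nothing is grafted and the lengths required by `eval_graft` do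
      -- not match; but then `x' = 0` and `box` returns its first argument. In all other cases,
      -- including a leaf without inputs, the lengths agree.
      by_cases hn : c = .nil ∧ 0 < (a v).2.1
      · obtain ⟨rfl, hpos⟩ := hn
        obtain rfl := h2 rfl hpos
        rw [Forest.subst, Forest.graft_nil, Nat.zero_add, hTe, eval, box_leaf]
        rw [hcol]; exact hpos
      · have hlen : (c.subst (fun i j => A.q env ⟨i, j⟩) T).length
            = ((T v).map (Sigma.mk v)).inputs (A.q env) := by
          rw [Forest.length_subst hT, Forest.inputs_map, hq]
          rcases hf.1 with rfl | hl
          · simp only [Forest.length, true_and] at hn ⊢; omega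
          · exact hl
        rw [Nat.add_comm, eval_graft hlen (Forest.full_map (hF v)) hFc
          (Forest.spans_map (p := fun i => (A.col (env i)).1) (q := fun i => (A.col (env i)).2.1)
            (r := fun i => (A.col (env i)).2.2) (e := Sigma.mk v) (hS v)) hSc, hTe, ihc,
            graftList]
        rw [List.take_of_length_le]
        · rfl
        · rw [← ihc, (eval_spec hFc hSc).1, hlen, hcol, Forest.inputs_map, hq]
    rw [Forest.subst, eval_append]
    erw [key]
    simp only [chainEnd, List.singleton_append]
    rw [eval, hcol, Nat.add_sub_cancel, hcolb, ihf]

end BoxAlgebra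

end BoxOp

/-! ### Children and parents in forests; insertion of units as contraction -/

namespace BoxOp

namespace Forest

variable {I K E : Type}

theorem mem_labels_of_mem_roots {f : Forest I} {v : I} (h : v ∈ f.roots) : v ∈ f.labels := by
  induction f with
  | nil => exact h
  | cons w c f _ ihf =>
    simp only [roots, labels, List.mem_cons, List.mem_append] at h ⊢
    exact h.imp_right fun h => .inr (ihf h)

theorem HasChildren.mem_labels {f c : Forest I} {v : I} (h : f.HasChildren v c) :
    v ∈ f.labels := by
  induction f with
  | nil => exact h.elim
  | cons w c' f ihc ihf =>
    simp only [labels, List.mem_cons, List.mem_append]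
    rcases h with ⟨h, -⟩ | h | h
    · exact .inl h.symm
    · exact .inr (.inl (ihc h))
    · exact .inr (.inr (ihf h))

theorem HasChildren.labels_subset {f c : Forest I} {v : I} (h : f.HasChildren v c) :
    c.labels ⊆ f.labels := by
  induction f with
  | nil => exact h.elim
  | cons w c' f ihc ihf =>
    intro x hx
    simp only [labels, List.mem_cons, List.mem_append]
    rcases h with ⟨-, rfl⟩ | h | h
    · exact .inr (.inl hx)
    · exact .inr (.inl (ihc h hx))
    · exact .inr (.inr (ihf h hx))

/-- In a forest with distinct labels the children of a vertex are determined by the vertex. -/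
theorem HasChildren.unique {f c d : Forest I} {v : I} (hn : f.labels.Nodup)
    (hc : f.HasChildren v c) (hd : f.HasChildren v d) : c = d := by
  induction f with
  | nil => exact hc.elim
  | cons w c' f ihc ihf =>
    simp only [labels, List.nodup_cons, List.mem_append, not_or, List.nodup_append] at hn
    obtain ⟨⟨hvc, hvf⟩, hnc, hnf, hdis⟩ := hn
    rcases hc with ⟨rfl, rfl⟩ | hc | hc <;> rcases hd with ⟨h, h'⟩ | hd | hd
    · exact h'
    · exact absurd hd.mem_labels hvc
    · exact absurd hd.mem_labels hvf
    · subst h; exact absurd hc.mem_labels hvc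
    · exact ihc hnc hc hd
    · exact (hdis _ hc.mem_labels _ hd.mem_labels rfl).elim
    · subst h; exact absurd hc.mem_labels hvf
    · exact (hdis _ hd.mem_labels _ hc.mem_labels rfl).elim
    · exact ihf hnf hc hd

/-- This guarantees that the units of the second contraction relation, being children of a vertex,
are not roots. -/
theorem HasChildren.notMem_roots {f c : Forest I} {v u : I} (hn : f.labels.Nodup)
    (hc : f.HasChildren v c) (hu : u ∈ c.labels) : u ∉ f.roots := by
  induction f with
  | nil => exact hc.elim
  | cons w c' f ihc ihf =>
    simp only [labels, List.nodup_cons, List.mem_append, not_or, List.nodup_append] at hn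
    obtain ⟨⟨hvc, hvf⟩, hnc, hnf, hdis⟩ := hn
    simp only [roots, List.mem_cons, not_or]
    rcases hc with ⟨rfl, rfl⟩ | hc | hc
    · exact ⟨fun h => hvc (h ▸ hu), fun h => hdis _ hu _ (mem_labels_of_mem_roots h) rfl⟩
    · exact ⟨fun h => hvc (h ▸ hc.labels_subset hu),
        fun h => hdis _ (hc.labels_subset hu) _ (mem_labels_of_mem_roots h) rfl⟩
    · exact ⟨fun h => hvf (h ▸ hc.labels_subset hu), ihf hnf hc⟩

/-- In a forest with distinct labels the parent of a vertex is determined by the vertex. -/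
theorem HasChildren.parent_unique {f c d : Forest I} {v w u : I} (hn : f.labels.Nodup)
    (hc : f.HasChildren v c) (hd : f.HasChildren w d) (hu : u ∈ c.roots) (hu' : u ∈ d.roots) :
    v = w := by
  induction f with
  | nil => exact hc.elim
  | cons x c' f ihc ihf =>
    have hlc := hc.labels_subset (mem_labels_of_mem_roots hu)
    simp only [labels, List.nodup_cons, List.mem_append, not_or, List.nodup_append] at hn
    obtain ⟨⟨hvc, hvf⟩, hnc, hnf, hdis⟩ := hn
    have hu1 := mem_labels_of_mem_roots hu
    have hu1' := mem_labels_of_mem_roots hu'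
    rcases hc with ⟨rfl, rfl⟩ | hc | hc <;> rcases hd with ⟨rfl, rfl⟩ | hd | hd
    · rfl
    · exact absurd hu (hd.notMem_roots hnc hu1')
    · exact (hdis _ hu1 _ (hd.labels_subset hu1') rfl).elim
    · exact absurd hu' (hc.notMem_roots hnc hu1)
    · exact ihc hnc hc hd
    · exact (hdis _ (hc.labels_subset hu1) _ (hd.labels_subset hu1') rfl).elim
    · exact (hdis _ hu1' _ (hc.labels_subset hu1) rfl).elim
    · exact (hdis _ (hd.labels_subset hu1') _ (hc.labels_subset hu1) rfl).elim
    · exact ihf hnf hc hd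

theorem length_roots (f : Forest I) : f.roots.length = f.length := by
  induction f with
  | nil => rfl
  | cons v c f _ ih => simp [roots, length, ih]

theorem length_contract {f : Forest (K ⊕ E)} (h : ∀ v ∈ f.roots, ∃ k, v = .inl k) :
    f.contract.length = f.length := by
  induction f with
  | nil => rfl
  | cons v c f _ ih =>
    obtain ⟨k, rfl⟩ := h v (by simp [roots])
    simp only [contract, length]
    rw [ih fun w hw => h w (by simp [roots, hw])]

end Forest

namespace BoxAlgebra

variable {A : BoxAlgebra.{w}} {K E : Type} {env : K ⊕ E → A.B}

theorem box_eta_eval {c : Forest (K ⊕ E)} (hl : c.length = 1) (hc : c.Full (A.q env)) {x y : ℕ}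
    (hs : A.Spans env c x y) :
    [A.box A.eta x (A.eval env c x)] = A.eval env c x := by
  have h := (eval_spec hc hs).2.1
  rw [eval_eq_val hl] at h ⊢
  rw [A.box_eta h.1]

/-- Insertion of `η` in vertices with one child amounts to contraction. -/
theorem eval_contract_of_one_child (henv : ∀ e, env (.inr e) = A.eta) {f : Forest (K ⊕ E)}
    (h : ∀ e c, f.HasChildren (.inr e) c → c.length = 1) (hf : f.Full (A.q env)) {x y : ℕ}
    (hs : A.Spans env f x y) :
    A.eval (fun k => env (.inl k)) f.contract x = A.eval env f x := by
  induction f generalizing x y with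
  | nil => rfl
  | cons v c f ihc ihf =>
    obtain ⟨s, t, h1, h2, rfl, h3⟩ := spans_cons.mp hs
    have ihc := ihc (fun e d hd => h e d (.inr (.inl hd))) hf.2.1 h1
    have ihf := ihf (fun e d hd => h e d (.inr (.inr hd))) hf.2.2 h3
    have hcol := col_box_eval hf.1 hf.2.1 h2 h1
    rw [eval_cons, hcol]
    rcases v with k | e
    · rw [Forest.contract]
      refine (eval_cons (env := fun k => env (.inl k)) _ _ _ _).trans ?_
      rw [ihc, hcol, ihf]
    · have hl := h e c (.inl ⟨rfl, rfl⟩)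
      -- Both side labels of `η` vanish, so removing this vertex changes no depth.
      have he : A.col (env (.inr e)) = (0, 1, 0) := by rw [henv, A.col_eta]
      rw [he] at h3 ihf ⊢
      simp only [Nat.add_zero] at ihf ⊢
      rw [Forest.contract, eval_append, ihc, (eval_spec hf.2.1 h1).2.2.1, ihf, henv,
        ← List.singleton_append (l := A.eval env f t), box_eta_eval hl hf.2.1 h1]

/-- Insertion of `η` in all children of a vertex amounts to contraction. -/
theorem eval_contract_of_children (henv : ∀ e, env (.inr e) = A.eta) {f : Forest (K ⊕ E)}
    (h : ∀ v c, f.HasChildren v c → (∀ u ∈ c.roots, ∃ k, u = .inl k) ∨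
      ((∃ k, v = .inl k) ∧ c ≠ .nil ∧ ∀ u ∈ c.roots, ∃ e, u = .inr e))
    (hf : f.Full (A.q env)) (hf' : f.contract.Full (A.q fun k => env (.inl k)))
    {x y : ℕ} (hs : A.Spans env f x y) :
    ((∀ u ∈ f.roots, ∃ k, u = .inl k) →
      A.eval (fun k => env (.inl k)) f.contract x = A.eval env f x) ∧
    ((∀ u ∈ f.roots, ∃ e, u = .inr e) →
      (f.contract = .nil → (f ≠ .nil → x = 0) ∧
        A.eval env f 0 = List.replicate f.length A.eta) ∧
      f.contract.length ≤ f.length ∧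
      (f.contract.length = f.length →
        A.eval (fun k => env (.inl k)) f.contract x = A.eval env f x)) := by
  -- Two kinds of forests must be treated together: those all of whose roots are kept, and rows of
  -- units, which occur above the vertex absorbing its children. Each unit has at most one child, so
  -- contraction cannot lengthen a row of units. The two extremes are recorded: all units are
  -- leaves, or each has exactly one child.
  induction f generalizing x y with
  | nil => exact ⟨fun _ => rfl, fun _ => ⟨fun _ => ⟨fun h => absurd rfl h, rfl⟩, le_rfl,
      fun _ => rfl⟩⟩
  | cons v c f ihc ihf =>
    obtain ⟨s, t, h1, h2, rfl, h3⟩ := spans_cons.mp hs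
    have hcol := col_box_eval hf.1 hf.2.1 h2 h1
    have ihc := fun hh => ihc (fun v d hd => h v d (.inr (.inl hd))) hf.2.1 hh h1
    have ihf := fun hh => ihf (fun v d hd => h v d (.inr (.inr hd))) hf.2.2 hh h3
    have hv := h v c (.inl ⟨rfl, rfl⟩)
    rw [eval_cons, hcol]
    rcases v with k | e
    · refine ⟨fun hr => ?_, fun hr => ?_⟩
      · have ihc := ihc hf'.2.1
        have ihf := (ihf hf'.2.2).1 (fun u hu => hr u (by simp [Forest.roots, hu]))
        rw [Forest.contract]
        refine (eval_cons (env := fun k => env (.inl k)) _ _ _ _).trans ?_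
        have hb : A.box (env (.inl k)) s (A.eval (fun k => env (.inl k)) c.contract s)
            = A.box (env (.inl k)) s (A.eval env c s) := by
          rcases hv with hv | ⟨-, hne, hv⟩
          · rw [ihc.1 hv]
          · have hlc := hf.1.resolve_left hne
            obtain ⟨i1, -, i3⟩ := ihc.2 hv
            -- Fullness of the contracted forest excludes mixed rows. Either every unit is a leaf,
            -- and `box_top` removes the row, or every unit has one child, and the row is replaced
            -- by the row of the children.
            rcases hf'.1 with hnil | hl
            · obtain ⟨j1, j2⟩ := i1 hnil
              obtain rfl := j1 hne
              rw [hnil, j2, hlc, eval, A.box_top, box_leaf]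
              change 0 < A.q env _
              rw [← hlc]
              exact Nat.pos_of_ne_zero fun h0 => hne (Forest.length_eq_zero h0)
            · rw [i3 (hl.trans hlc.symm)]
        rw [hb, hcol, ihf]
      · obtain ⟨e, he⟩ := hr (.inl k) (by simp [Forest.roots])
        exact absurd he (by simp)
    · refine ⟨fun hr => ?_, fun hr => ?_⟩
      · obtain ⟨e, he⟩ := hr (.inr e) (by simp [Forest.roots])
        exact absurd he (by simp)
      · have he : A.col (env (.inr e)) = (0, 1, 0) := by rw [henv, A.col_eta]
        have hq : A.q env (.inr e) = 1 := by rw [q, he]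
        replace hv := hv.resolve_right (fun h' => by simp at h')
        obtain ⟨hfc, hff⟩ := Forest.full_of_append hf'
        obtain ⟨i1, i2, i3⟩ := (ihf hff).2 (fun u hu => hr u (by simp [Forest.roots, hu]))
        have hlc := Forest.length_contract hv
        have ihc := (ihc hfc).1 hv
        rw [he] at i1 i3 ⊢
        rw [hq] at h2
        have hcl : c.length ≤ 1 := by
          rcases hf.1 with rfl | hl
          · exact Nat.zero_le _
          · rw [hl, hq]
        simp only [Nat.add_zero, Forest.contract, Forest.length_append, Forest.length]
          at i1 i3 ⊢
        refine ⟨fun hnil => ?_, by omega, fun hl => ?_⟩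
        · have hlen := congrArg Forest.length hnil
          simp only [Forest.length_append, Forest.length] at hlen
          obtain rfl : c = .nil := Forest.length_eq_zero (by omega)
          -- A unit has one input, so as a leaf it has start value `0`; this is why the row of units
          -- lies at depth `0`, as `box_top` demands.
          obtain rfl := h2 rfl one_pos
          refine ⟨fun _ => rfl, ?_⟩
          have hb : A.box (env (.inr e)) 0 (A.eval env .nil 0) = A.eta := by
            rw [eval, box_leaf (by rw [he]; exact one_pos), henv]
          have := eval_cons (A := A) (env := env) (.inr e) .nil f 0
          rw [hb, he, A.col_eta] at this
          exact this.trans (congrArg (List.cons A.eta) (i1 (Forest.length_eq_zero (by omega))).2)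
        · rw [eval_append, ihc, (eval_spec hf.2.1 h1).2.2.1, i3 (by omega), henv,
            ← List.singleton_append (l := A.eval env f t),
            box_eta_eval (by omega) hf.2.1 h1]

end BoxAlgebra

end BoxOp

/-! ### From algebras over the presented box operad to box algebras -/

namespace ColouredOperad

section

variable {C : Type v} {G : (I : Type) → (I → C) → C → Type u}
  {R : ∀ (I : Type) (a : I → C) (d : C), Term G I a d → Term G I a d → Prop}
  {A : C → Type w} (ρ : Hom (presented G R) (endo A))

theorem map_cls_act {I J : Type} [Finite I] [Finite J] {b : J → C} {d : C} (e : I ≃ J)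
    (x : Term G I (fun i => b (e i)) d) (z : ∀ j, A (b j)) :
    ρ.map (cls R (.act e x)) z = ρ.map (cls R x) (fun i => z (e i)) :=
  congrFun (ρ.map_act e (cls R x)) z

theorem map_cls_fill {K E : Type} [Finite K] [Finite E] {J : E → Type} [∀ e, Finite (J e)]
    {c : K ⊕ (Σ e, J e) → C} {b : E → C} {d : C}
    (x : Term G (K ⊕ E) (Sum.elim (fun k => c (.inl k)) b) d)
    (y : ∀ e, Term G (J e) (fun j => c (.inr ⟨e, j⟩)) (b e)) (z : ∀ s, A (c s)) :
    ρ.map (cls R (Term.fill x y)) z = ρ.map (cls R x) (fun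
      | .inl k => z (.inl k)
      | .inr e => ρ.map (cls R (y e)) (fun j => z (.inr ⟨e, j⟩))) := by
  rw [cls_fill, Hom.map_fill]
  refine congrArg (ρ.map (cls R x)) ?_
  funext s
  cases s <;> rfl

theorem map_cls_plug {K E : Type} [Finite K] [Finite E] {a : K → C} {u d : C}
    (x : Term G (K ⊕ E) (Sum.elim a (fun _ => u)) d) (h : ∀ z : Empty → C, Term G Empty z u)
    (z : ∀ k, A (a k)) :
    ρ.map (cls R (Term.plug x h)) z = ρ.map (cls R x) (fun
      | .inl k => z k
      | .inr e => ρ.map (cls R (h fun j => a (plugEquiv K E (.inr ⟨e, j⟩))))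
          (fun j => z (plugEquiv K E (.inr ⟨e, j⟩)))) := by
  refine (map_cls_act ρ _ _ z).trans ((map_cls_fill ρ _ _ _).trans ?_)
  refine congrArg (ρ.map (cls R x)) ?_
  funext s
  cases s <;> rfl

end

end ColouredOperad

namespace BoxOp

open ColouredOperad

section lists

variable {B : Type w} {col : B → Colour}

theorem chainEnd_ofFn {n : ℕ} (P : Fin (n + 1) → ℕ) (f : Fin n → B)
    (h : ∀ i, (col (f i)).2.2 = P i.succ) : chainEnd col (P 0) (List.ofFn f) = P (Fin.last n) := by
  induction n with
  | zero => rfl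
  | succ n ih =>
    rw [List.ofFn_succ, chainEnd, h 0]
    exact ih (fun i => P i.succ) (fun i => f i.succ) (fun i => h i.succ)

theorem chain_ofFn {n : ℕ} (P : Fin (n + 1) → ℕ) (f : Fin n → B)
    (h : ∀ i, (col (f i)).1 = P i.castSucc) (h' : ∀ i, (col (f i)).2.2 = P i.succ) :
    Chain col (P 0) (List.ofFn f) := by
  induction n with
  | zero => trivial
  | succ n ih =>
    rw [List.ofFn_succ, Chain, h' 0]
    exact ⟨h 0, ih (fun i => P i.succ) (fun i => f i.succ) (fun i => h i.succ)
      (fun i => h' i.succ)⟩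

theorem totalInputs_ofFn {n : ℕ} (f : Fin n → B) :
    totalInputs col (List.ofFn f) = ∑ i, (col (f i)).2.1 := by
  induction n with
  | zero => rfl
  | succ n ih => rw [List.ofFn_succ, totalInputs, ih, Fin.sum_univ_succ]

/-- It recovers the side labels `P i` of a generator from a bare list: they are the ends of its
prefixes. -/
theorem Chain.getElem {x : ℕ} {L : List B} (h : Chain col x L) (i : ℕ) (hi : i < L.length) :
    (col L[i]).1 = chainEnd col x (L.take i) ∧
      (col L[i]).2.2 = chainEnd col x (L.take (i + 1)) := by
  induction L generalizing x i with
  | nil => simp at hi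
  | cons b L ih =>
    cases i with
    | zero => exact ⟨h.1, rfl⟩
    | succ i => exact ih h.2 i (by simpa using hi)

theorem offset_succ' {n : ℕ} (m : Fin (n + 1) → ℕ) (i : Fin (n + 1)) :
    offset m i.succ = m 0 + offset (fun j => m j.succ) i := by
  exact Fin.sum_univ_succ (n := i) _

theorem offset_add_le {n : ℕ} (m : Fin n → ℕ) (i : Fin n) :
    offset m i.castSucc + m i ≤ ∑ i, m i := by
  induction n with
  | zero => exact i.elim0
  | succ n ih =>
    rw [Fin.sum_univ_succ]
    refine Fin.cases ?_ (fun i => ?_) i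
    · rw [Fin.castSucc_zero, offset_zero]; omega
    · have := ih (fun j => m j.succ) i
      rw [← Fin.succ_castSucc, offset_succ']
      omega

/-- This turns the recursive distribution of the row `M` into the indexed one of the associativity
relation, where the block of the `i`-th box starts at `offset m i.castSucc`. -/
theorem graftList_ofFn (box : B → ℕ → List B → B) {n : ℕ} (f : Fin n → B) (m : Fin n → ℕ)
    (hm : ∀ i, (col (f i)).2.1 = m i) (x : ℕ) (M : List B) :
    graftList col box (List.ofFn f) x M = List.ofFn fun i =>
      box (f i) (chainEnd col x (M.take (offset m i.castSucc)))
        ((M.drop (offset m i.castSucc)).take (m i)) := by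
  induction n generalizing x M with
  | zero => rfl
  | succ n ih =>
    rw [List.ofFn_succ, graftList, ih (fun i => f i.succ) (fun i => m i.succ) fun i => hm i.succ,
      List.ofFn_succ, hm]
    congr 2
    funext i
    rw [← Fin.succ_castSucc, offset_succ', List.take_add, chainEnd_append, List.drop_drop]

theorem take_drop_eq_ofFn {M : List B} {o m : ℕ} (h : o + m ≤ M.length) :
    (M.drop o).take m = List.ofFn fun j : Fin m => M[o + j] := by
  refine List.ext_getElem (by simp; omega) fun i _ _ => by simp

end lists

section algebra

variable {A : Colour → Type w}

/-- It takes the place of a cast along an equality of colours: a bundled element is reconstructed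
over the wanted colour, and equations remain between bundled elements. -/
theorem exists_eq_mk {c : Colour} (b : Σ c, A c) (h : b.1 = c) :
    ∃ y : A c, (⟨c, y⟩ : Σ c, A c) = b := by
  obtain ⟨c, y⟩ := b
  subst h
  exact ⟨y, rfl⟩

/-- The colours of the inputs of a generator. -/
abbrev genColour {n : ℕ} (P : Fin (n + 1) → ℕ) (p r : ℕ) (q : Fin n → ℕ) : Unit ⊕ Fin n → Colour :=
  Sum.elim (fun _ => (p, n, r)) (fun i => (P i.castSucc, q i, P i.succ))

/-- The arguments of an operation `C`. -/
structure BoxArgs (A : Colour → Type w) where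
  /-- the number of top boxes -/
  n : ℕ
  /-- the side labels of the top boxes -/
  P : Fin (n + 1) → ℕ
  /-- the left label of the bottom box -/
  p : ℕ
  /-- the right label of the bottom box -/
  r : ℕ
  /-- the numbers of inputs of the top boxes -/
  q : Fin n → ℕ
  /-- the boxes -/
  z : ∀ s, A (genColour P p r q s)

/-- The bottom box. -/
def BoxArgs.bottom (D : BoxArgs A) : Σ c, A c := ⟨_, D.z (.inl ())⟩

/-- The list of top boxes. -/
def BoxArgs.tops (D : BoxArgs A) : List (Σ c, A c) := List.ofFn fun i => ⟨_, D.z (.inr i)⟩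

/-- The bottom box determines `n`, `p`, `r`, and the top boxes determine `q` and every label except
`P 0`. That one is a separate hypothesis because the row may be empty. Uniqueness makes the choice
in `boxOf` harmless. -/
theorem BoxArgs.ext' {D D' : BoxArgs A} (hb : D.bottom = D'.bottom) (hP : D.P 0 = D'.P 0)
    (ht : D.tops = D'.tops) : D = D' := by
  obtain ⟨n, P, p, r, q, z⟩ := D
  obtain ⟨n', P', p', r', q', z'⟩ := D'
  have hb1 : (p, n, r) = (p', n', r') := congrArg Sigma.fst hb
  simp only [Prod.mk.injEq] at hb1
  obtain ⟨rfl, rfl, rfl⟩ := hb1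
  have ht' := List.ofFn_injective ht
  have hc : ∀ i : Fin n, (P i.castSucc, q i, P i.succ) = (P' i.castSucc, q' i, P' i.succ) :=
    fun i => congrArg Sigma.fst (congrFun ht' i)
  simp only [Prod.mk.injEq] at hc
  obtain rfl : P = P' := funext fun i => Fin.cases hP (fun i => (hc i).2.2) i
  obtain rfl : q = q' := funext fun i => (hc i).2.1
  obtain rfl : z = z' := by
    funext s
    rcases s with ⟨⟩ | i
    · exact eq_of_heq (Sigma.mk.inj hb).2
    · exact eq_of_heq (Sigma.mk.inj (congrFun ht' i)).2
  rfl

theorem BoxArgs.fits (D : BoxArgs A) : Fits Sigma.fst D.bottom (D.P 0) D.tops :=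
  ⟨List.length_ofFn, chain_ofFn D.P _ (fun _ => rfl) (fun _ => rfl)⟩

theorem BoxArgs.exists_of_fits {b : Σ c, A c} {x : ℕ} {L : List (Σ c, A c)}
    (h : Fits Sigma.fst b x L) : ∃ D : BoxArgs A, D.bottom = b ∧ D.P 0 = x ∧ D.tops = L := by
  obtain ⟨hl, hc⟩ := h
  obtain ⟨⟨p, n, r⟩, y⟩ := b
  dsimp only at hl
  subst hl
  choose z hz using fun i : Fin L.length => exists_eq_mk
    (c := (chainEnd Sigma.fst x (L.take i), (L[i]).1.2.1, chainEnd Sigma.fst x (L.take (i + 1))))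
    L[i] (by
      have := hc.getElem i i.2
      exact Prod.ext this.1 (Prod.ext rfl this.2))
  -- The side labels are the ends of the prefixes of `L`; the empty prefix gives `P 0 = x`.
  refine ⟨⟨L.length, fun i => chainEnd Sigma.fst x (L.take i), p, r, fun i => (L[i]).1.2.1,
    fun | .inl _ => y | .inr i => z i⟩, rfl, rfl, ?_⟩
  refine List.ext_getElem (by simp [tops]) fun i hi hi' => ?_
  simp only [tops, List.getElem_ofFn]
  exact hz ⟨i, hi'⟩

variable (ρ : Hom (presented BoxGen BoxRel) (endo A))

/-- The result of an operation `C`. -/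
def BoxArgs.result (D : BoxArgs A) : Σ c, A c :=
  ⟨(D.p + D.P 0, ∑ i, D.q i, D.r + D.P (Fin.last D.n)),
    ρ.map (cls BoxRel (.gen (.C D.P D.p D.r D.q rfl (fun _ => rfl) rfl))) D.z⟩

open Classical in
/-- The operations `C` of an algebra. -/
noncomputable def boxOf (b : Σ c, A c) (x : ℕ) (L : List (Σ c, A c)) : Σ c, A c :=
  if h : ∃ D : BoxArgs A, D.bottom = b ∧ D.P 0 = x ∧ D.tops = L then h.choose.result ρ else b

theorem boxOf_args (D : BoxArgs A) : boxOf ρ D.bottom (D.P 0) D.tops = D.result ρ := by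
  have h : ∃ D' : BoxArgs A, D'.bottom = D.bottom ∧ D'.P 0 = D.P 0 ∧ D'.tops = D.tops :=
    ⟨D, rfl, rfl, rfl⟩
  rw [boxOf, dif_pos h]
  rw [BoxArgs.ext' h.choose_spec.1 h.choose_spec.2.1 h.choose_spec.2.2]

/-- In the relations the generators occur with colour functions that have the required form only up
to a proof. Both sides of a relation are brought to the form `boxOf` by this lemma and then compared
argument by argument. -/
theorem map_gen_eq_boxOf {n : ℕ} (P : Fin (n + 1) → ℕ) (p r : ℕ) (q : Fin n → ℕ)
    {a : Unit ⊕ Fin n → Colour} {d : Colour} (hb : a (.inl ()) = (p, n, r))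
    (ht : ∀ i, a (.inr i) = (P i.castSucc, q i, P i.succ))
    (ho : d = (p + P 0, ∑ i, q i, r + P (Fin.last n))) (z : ∀ s, A (a s)) :
    (⟨d, ρ.map (cls BoxRel (.gen (.C P p r q hb ht ho))) z⟩ : Σ c, A c)
      = boxOf ρ ⟨_, z (.inl ())⟩ (P 0) (List.ofFn fun i => ⟨_, z (.inr i)⟩) := by
  subst ho
  obtain rfl : a = genColour P p r q := by
    funext s
    rcases s with ⟨⟩ | i
    · exact hb
    · exact ht i
  exact (boxOf_args ρ ⟨n, P, p, r, q, z⟩).symm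

/-- The unit of an algebra. -/
def etaOf : Σ c, A c := ⟨(0, 1, 0), ρ.map (cls BoxRel (.gen (.eta Empty.elim))) (fun z => z.elim)⟩

theorem map_eta_eq_etaOf (c : Empty → Colour) (z : ∀ s, A (c s)) :
    (⟨_, ρ.map (cls BoxRel (.gen (.eta c))) z⟩ : Σ c, A c) = etaOf ρ := by
  obtain rfl : c = Empty.elim := funext fun z => z.elim
  obtain rfl : z = fun z => z.elim := funext fun z => z.elim
  rfl

theorem col_boxOf {b : Σ c, A c} {x : ℕ} {L : List (Σ c, A c)} (h : Fits Sigma.fst b x L) :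
    (boxOf ρ b x L).1
      = (b.1.1 + x, totalInputs Sigma.fst L, b.1.2.2 + chainEnd Sigma.fst x L) := by
  obtain ⟨D, rfl, rfl, rfl⟩ := BoxArgs.exists_of_fits h
  rw [boxOf_args, BoxArgs.tops, totalInputs_ofFn, chainEnd_ofFn D.P _ (fun _ => rfl)]
  rfl

theorem boxOf_congr {b b' : Σ c, A c} {x x' : ℕ} {L L' : List (Σ c, A c)} (hb : b = b')
    (hx : x = x') (hL : L = L') : boxOf ρ b x L = boxOf ρ b' x' L' := by
  rw [hb, hx, hL]

/-- The associativity relation is evaluated at the elements supplied by the bottom box and the two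
rows. -/
theorem boxOf_boxOf {b : Σ c, A c} {x x' : ℕ} {L M : List (Σ c, A c)} (h : Fits Sigma.fst b x L)
    (h' : Fits Sigma.fst (boxOf ρ b x L) x' M) :
    boxOf ρ (boxOf ρ b x L) x' M = boxOf ρ b (x + x') (graftList Sigma.fst (boxOf ρ) L x' M) := by
  obtain ⟨⟨n, P, p, r, m, z⟩, rfl, rfl, rfl⟩ := BoxArgs.exists_of_fits h
  have hM : M.length = ∑ i, m i := by
    rw [h'.1, col_boxOf ρ h, BoxArgs.tops, totalInputs_ofFn]
    rfl
  have hle : ∀ (i : Fin n) (j : Fin (m i)), offset m i.castSucc + j < M.length := by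
    intro i j
    have := offset_add_le m i
    omega
  -- The parameters of the relation are read off from the upper row: its side labels as ends of
  -- prefixes, and its numbers of inputs, indexed by block and position in the block.
  let P' : ℕ → ℕ := fun j => chainEnd Sigma.fst x' (M.take j)
  let q : ∀ i, Fin (m i) → ℕ := fun i j => (M[offset m i.castSucc + j]'(hle i j)).1.2.1
  choose y hy using fun (i : Fin n) (j : Fin (m i)) => exists_eq_mk
    (c := assocColour P p r m P' q (.inr ⟨i, .inr j⟩)) (M[offset m i.castSucc + j]'(hle i j)) (by
      have := h'.2.getElem _ (hle i j)
      exact Prod.ext this.1 (Prod.ext rfl this.2))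
  let z' : ∀ s, A (assocColour P p r m P' q s) := fun
    | .inl _ => z (.inl ())
    | .inr ⟨i, .inl _⟩ => z (.inr i)
    | .inr ⟨i, .inr j⟩ => y i j
  have hz' : ∀ i j, (⟨_, z' (.inr ⟨i, .inr j⟩)⟩ : Σ c, A c)
      = M[offset m i.castSucc + j]'(hle i j) := hy
  have key := congrArg (fun x => (⟨_, ρ.map x z'⟩ : Σ c, A c))
    (cls_sound (BoxRel.assoc P p r m P' q))
  simp only [map_cls_act, map_cls_fill] at key
  have key' := (map_gen_eq_boxOf ρ _ _ _ _ _ _ _ _).symm.trans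
    (key.trans (map_gen_eq_boxOf ρ _ _ _ _ _ _ _ _))
  refine Eq.trans ?_ (key'.trans ?_)
  · refine boxOf_congr ρ ?_ rfl ?_
    · exact (map_gen_eq_boxOf ρ P p r m
        (a := fun j => assocColour P p r m P' q (shuffle m (.inr ⟨(), j⟩))) rfl (fun _ => rfl) rfl
        (fun j => z' (shuffle m (.inr ⟨(), j⟩)))).symm
    -- The lexicographic numbering of pairs (block, position) is the position in `M`, by
    -- `offset_add_snd`.
    · refine List.ext_getElem (by simp [hM]) fun x hx hx' => ?_
      rw [List.getElem_ofFn]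
      have hx'' : x < ∑ i, m i := hM ▸ hx
      refine Eq.trans ?_ (hz' (finSigmaFinEquiv.symm ⟨x, hx''⟩).1
        (finSigmaFinEquiv.symm ⟨x, hx''⟩).2).symm
      congr 1
      exact (offset_add_snd m ⟨x, hx''⟩).symm
  · refine boxOf_congr ρ rfl rfl ?_
    rw [BoxArgs.tops, graftList_ofFn (boxOf ρ) _ m (fun _ => rfl)]
    refine congrArg List.ofFn ?_
    funext i
    refine (map_gen_eq_boxOf ρ _ _ _ _ _ _ _ _).trans ?_
    refine boxOf_congr ρ rfl rfl ?_
    rw [take_drop_eq_ofFn (by have := offset_add_le m i; omega)]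
    exact congrArg List.ofFn (funext fun j => hz' i j)

theorem boxOf_eta {x : ℕ} {t : Σ c, A c} (h : t.1.1 = x) : boxOf ρ (etaOf ρ) x [t] = t := by
  subst h
  obtain ⟨⟨p, q, r⟩, y⟩ := t
  have key := congrArg (fun x => (⟨_, ρ.map x fun _ => y⟩ : Σ c, A c))
    (cls_sound (BoxRel.eta_bottom p q r))
  simp only [map_cls_act, map_cls_plug, cls_one, Hom.map_one] at key
  refine Eq.trans ?_ key
  refine Eq.trans ?_ (map_gen_eq_boxOf ρ _ _ _ _ _ _ _ _).symm
  exact boxOf_congr ρ (map_eta_eq_etaOf ρ _ _).symm rfl rfl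

theorem boxOf_replicate_eta (b : Σ c, A c) :
    boxOf ρ b 0 (List.replicate b.1.2.1 (etaOf ρ)) = b := by
  obtain ⟨⟨p, n, r⟩, y⟩ := b
  have key := congrArg (fun x => (⟨_, ρ.map x fun _ => y⟩ : Σ c, A c))
    (cls_sound (BoxRel.eta_top p n r))
  simp only [map_cls_plug, cls_one, Hom.map_one] at key
  refine Eq.trans ?_ key
  refine Eq.trans ?_ (map_gen_eq_boxOf ρ _ _ _ _ _ _ _ _).symm
  refine boxOf_congr ρ rfl rfl ?_
  rw [← List.ofFn_const]
  exact congrArg List.ofFn (funext fun i => (map_eta_eq_etaOf ρ _ _).symm)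

/-- The box algebra given by an algebra over the box operad. -/
noncomputable def boxAlgebra : BoxAlgebra.{w} where
  B := Σ c, A c
  col := Sigma.fst
  box := boxOf ρ
  eta := etaOf ρ
  col_box h := col_boxOf ρ h
  box_of_not_fits h := by
    refine dif_neg ?_
    rintro ⟨D, rfl, rfl, rfl⟩
    exact h D.fits
  assoc h h' := boxOf_boxOf ρ h h'
  col_eta := rfl
  box_eta h := boxOf_eta ρ h
  box_top b := boxOf_replicate_eta ρ b

end algebra

end BoxOp

/-! ### The action of `Stack[η]` on an algebra over the box operad -/

namespace BoxOp

open ColouredOperad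

/-- For a box without inputs this is the top unit relation with no units at all; for a box with
inputs it is the default value. -/
theorem BoxAlgebra.box_zero_nil {A : BoxAlgebra.{w}} (b : A.B) : A.box b 0 [] = b := by
  rcases Nat.eq_zero_or_pos (A.col b).2.1 with h | h
  · have := A.box_top b
    rwa [h] at this
  · exact BoxAlgebra.box_leaf h 0

theorem BoxAlgebra.val_eq_of_eval {A : BoxAlgebra.{w}} {I J : Type} {env : I → A.B} {env' : J → A.B}
    {f : Forest I} {g : Forest J} {x : ℕ} (h : A.eval env f x = A.eval env' g x) :
    A.val env f x = A.val env' g x := by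
  rw [BoxAlgebra.val, h]; rfl

section algebra

variable {A : Colour → Type w} (ρ : Hom (presented BoxGen BoxRel) (endo A))

/-- Elements of an algebra, as elements of the collected algebra. -/
abbrev bundle {I : Type} {a : I → Colour} (z : ∀ i, A (a i)) (i : I) : (boxAlgebra ρ).B :=
  ⟨a i, z i⟩

theorem col_val_stacking {I : Type} {a : I → Colour} {d : Colour} (S : Stacking I a d)
    (z : ∀ i, A (a i)) : ((boxAlgebra ρ).val (bundle ρ z) S.tree d.1).1 = d :=
  (BoxAlgebra.col_val (A := boxAlgebra ρ) (env := bundle ρ z) S.length_eq S.full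
    (spans_of_admissible S.admissible)).trans (Prod.ext rfl (Prod.ext S.inputs_eq rfl))

/-- The action of a stacking on an algebra over the box operad. -/
noncomputable def stackAct {I : Type} {a : I → Colour} {d : Colour} (S : Stacking I a d)
    (z : ∀ i, A (a i)) : A d :=
  (exists_eq_mk _ (col_val_stacking ρ S z)).choose

theorem stackAct_eq {I : Type} {a : I → Colour} {d : Colour} (S : Stacking I a d)
    (z : ∀ i, A (a i)) :
    (⟨d, stackAct ρ S z⟩ : Σ c, A c) = (boxAlgebra ρ).val (bundle ρ z) S.tree d.1 :=
  (exists_eq_mk _ (col_val_stacking ρ S z)).choose_spec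

theorem stackAct_one (c : Colour) (z : Unit → A c) :
    stackAct ρ (Stacking.one c) z = z () := by
  refine eq_of_heq (Sigma.mk.inj ((stackAct_eq ρ _ z).trans ?_)).2
  have h := BoxAlgebra.eval_cons (A := boxAlgebra ρ) (env := bundle ρ (a := fun _ => c) z) ()
    .nil .nil 0
  rw [Nat.zero_add] at h
  refine (congrArg (fun L => L.headD (boxAlgebra ρ).eta) h).trans ?_
  exact BoxAlgebra.box_zero_nil (A := boxAlgebra ρ) _

theorem stackAct_act {I J : Type} {b : J → Colour} {d : Colour} (e : I ≃ J)
    (S : Stacking I (fun i => b (e i)) d) (z : ∀ j, A (b j)) :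
    stackAct ρ (S.act e) z = stackAct ρ S (fun i => z (e i)) := by
  refine eq_of_heq (Sigma.mk.inj ((stackAct_eq ρ _ z).trans
    (Eq.trans ?_ (stackAct_eq ρ _ _).symm))).2
  exact BoxAlgebra.val_eq_of_eval (BoxAlgebra.eval_map _ _ _)

/-- Composition of stackings is substitution of trees, so this is `eval_subst`, where the value of
`T i` is the element placed in box `i`. -/
theorem stackAct_comp {I : Type} {J : I → Type} {a : I → Colour} {b : ∀ i, J i → Colour}
    {d : Colour} (S : Stacking I a d) (T : ∀ i, Stacking (J i) (b i) (a i))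
    (z : ∀ p : Σ i, J i, A (b p.1 p.2)) :
    stackAct ρ (S.comp T) z = stackAct ρ S (fun i => stackAct ρ (T i) (fun j => z ⟨i, j⟩)) := by
  refine eq_of_heq (Sigma.mk.inj ((stackAct_eq ρ _ z).trans
    (Eq.trans ?_ (stackAct_eq ρ _ _).symm))).2
  refine BoxAlgebra.val_eq_of_eval ?_
  have hS := spans_of_admissible S.admissible
  refine (BoxAlgebra.eval_subst (A := boxAlgebra ρ)
    (env := bundle ρ (a := fun p : Σ i, J i => b p.1 p.2) z) (a := a)
    (fun i => (T i).length_eq) (fun i => (T i).inputs_eq) (fun i => (T i).full)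
    (fun i => spans_of_admissible (T i).admissible) S.full hS).trans ?_
  congr 1
  funext i
  exact (stackAct_eq ρ (T i) _).symm

/-- The values of the generators of `Stack[η]` in an algebra over the box operad. -/
noncomputable def stackEtaVal : ∀ (I : Type) [Finite I] (a : I → Colour) (d : Colour),
    StackEtaGen I a d → (endo A).Op I a d
  | _, _, _, _, .stack S => stackAct ρ S
  | _, _, _, _, .eta z => ρ.map (cls BoxRel (.gen (.eta z)))

/-- Both contraction relations have the same shape. They reduce to the claim that `T` and its
contraction have the same evaluation whenever the vertices in `E` carry the unit. -/
theorem eval_plug_eta {K E : Type} [Finite K] [Finite E] {a : K → Colour} {d : Colour}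
    (T : Stacking (K ⊕ E) (Sum.elim a (fun _ => (0, 1, 0))) d) (T' : Stacking K a d)
    (h : ∀ env : K ⊕ E → (boxAlgebra ρ).B, (∀ e, env (.inr e) = (boxAlgebra ρ).eta) →
      T.tree.Full ((boxAlgebra ρ).q env) → (boxAlgebra ρ).Spans env T.tree d.1 d.2.2 →
      T'.tree.Full ((boxAlgebra ρ).q fun k => env (.inl k)) →
      (boxAlgebra ρ).eval (fun k => env (.inl k)) T'.tree d.1
        = (boxAlgebra ρ).eval env T.tree d.1) :
    (Term.plug (E := E) (u := (0, 1, 0)) (.gen (StackEtaGen.stack T))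
      (fun z => .gen (.eta z))).eval (endo A) (stackEtaVal ρ)
      = (Term.gen (StackEtaGen.stack T')).eval (endo A) (stackEtaVal ρ) := by
  funext z
  let z' : ∀ s : K ⊕ E, A (Sum.elim a (fun _ => (0, 1, 0)) s) := fun
    | .inl k => z k
    | .inr e => ρ.map (cls BoxRel (.gen (.eta fun j => a (plugEquiv K E (.inr ⟨e, j⟩)))))
        (fun j => z (plugEquiv K E (.inr ⟨e, j⟩)))
  have h1 : (Term.plug (E := E) (u := (0, 1, 0)) (.gen (StackEtaGen.stack T))
      (fun z => .gen (.eta z))).eval (endo A) (stackEtaVal ρ) z = stackAct ρ T z' := by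
    refine congrArg (stackAct ρ T) ?_
    funext s
    cases s <;> rfl
  refine h1.trans ?_
  refine eq_of_heq (Sigma.mk.inj ((stackAct_eq ρ _ z').trans
    (Eq.trans ?_ (stackAct_eq ρ T' z).symm))).2
  refine Eq.symm (BoxAlgebra.val_eq_of_eval (h (bundle ρ z') ?_ ?_ ?_ ?_))
  · intro e
    exact map_eta_eq_etaOf ρ _ _
  · exact T.full
  · exact spans_of_admissible T.admissible
  · exact T'.full

theorem stackEtaVal_rel (I : Type) [Finite I] (a : I → Colour) (d : Colour)
    (x y : Term StackEtaGen I a d) (h : StackEtaRel I a d x y) :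
    x.eval (endo A) (stackEtaVal ρ) = y.eval (endo A) (stackEtaVal ρ) := by
  cases h with
  | one => exact funext fun z => stackAct_one ρ _ z
  | act e S => exact funext fun z => stackAct_act ρ e S z
  | comp S T => exact funext fun z => stackAct_comp ρ S T z
  | eta_bottom T T' c j hc hj hT' =>
    refine eval_plug_eta ρ T T' fun env henv hF hs _ => ?_
    rw [hT']
    -- The only contracted vertex is `inr ()`, and distinctness of the labels makes `c` its forest
    -- of subtrees, which has one root.
    refine BoxAlgebra.eval_contract_of_one_child henv (fun e d hd => ?_) hF hs
    rw [← hc.unique T.nodup hd, ← Forest.length_roots, hj]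
    rfl
  | eta_top hm T T' c i hc hi hT' =>
    refine eval_plug_eta ρ T T' fun env henv hF hs hF' => ?_
    rw [hT'] at hF' ⊢
    -- All units are children of `i`. By uniqueness of parents no other vertex has a unit among its
    -- children, and no unit is a root; these are the hypotheses of `eval_contract_of_children`.
    have hroot : ∀ s, .inr s ∈ c.roots := fun s => by rw [hi]; simp
    refine (BoxAlgebra.eval_contract_of_children henv (fun v d hd => ?_) hF hF' hs).1 ?_
    · by_cases hv : v = .inl i
      · subst hv
        rw [← hc.unique T.nodup hd]
        refine .inr ⟨⟨i, rfl⟩, ?_, fun u hu => ?_⟩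
        · rintro rfl
          exact absurd (hroot ⟨0, hm⟩) (by simp [Forest.roots])
        · rw [hi] at hu
          obtain ⟨s, rfl⟩ := (List.mem_ofFn' _ _).mp hu
          exact ⟨s, rfl⟩
      · refine .inl fun u hu => ?_
        rcases u with k | s
        · exact ⟨k, rfl⟩
        · exact absurd (hd.parent_unique T.nodup hc hu (hroot s)) hv
    · intro u hu
      rcases u with k | s
      · exact ⟨k, rfl⟩
      · exact absurd hu (hc.notMem_roots T.nodup (Forest.mem_labels_of_mem_roots (hroot s)))

/-- An algebra over the box operad is an algebra over `Stack[η]`. -/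
noncomputable def stackEtaHom : Hom (presented StackEtaGen StackEtaRel) (endo A) :=
  lift (endo A) (stackEtaVal ρ) (stackEtaVal_rel ρ)

end algebra

end BoxOp

/-! ### Corollas and the comparison morphism -/

namespace BoxOp

open ColouredOperad

namespace Forest

variable {I J : Type}

/-- The forest whose vertices are all both roots and leaves. -/
def leaves : List I → Forest I
  | [] => nil
  | v :: l => cons v nil (leaves l)

/-- Juxtaposition of a family of forests. -/
def concat {n : ℕ} (t : Fin n → Forest I) : Forest I := (List.ofFn t).foldr append nil

theorem concat_succ {n : ℕ} (t : Fin (n + 1) → Forest I) :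
    concat t = append (t 0) (concat fun i => t i.succ) := by
  simp only [concat, List.ofFn_succ, List.foldr_cons]

theorem leaves_append (l l' : List I) : leaves (l ++ l') = append (leaves l) (leaves l') := by
  induction l with
  | nil => rfl
  | cons v l ih => simp [leaves, append, ih]

theorem concat_leaves {n : ℕ} (l : Fin n → List I) :
    concat (fun i => leaves (l i)) = leaves (List.ofFn l).flatten := by
  induction n with
  | zero => rfl
  | succ n ih => rw [concat_succ, ih, List.ofFn_succ, List.flatten_cons, leaves_append]

theorem leaves_ofFn {n : ℕ} (g : Fin n → I) :
    leaves (List.ofFn g) = concat (fun i => cons (g i) nil nil) := by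
  induction n with
  | zero => rfl
  | succ n ih => rw [concat_succ, List.ofFn_succ, leaves, ih]; rfl

theorem length_leaves (l : List I) : (leaves l).length = l.length := by
  induction l with
  | nil => rfl
  | cons v l ih => simp [leaves, length, ih]

theorem labels_leaves (l : List I) : (leaves l).labels = l := by
  induction l with
  | nil => rfl
  | cons v l ih => simp [leaves, labels, ih]

theorem roots_leaves (l : List I) : (leaves l).roots = l := by
  induction l with
  | nil => rfl
  | cons v l ih => simp [leaves, roots, ih]

theorem map_leaves (e : I → J) (l : List I) : (leaves l).map e = leaves (l.map e) := by
  induction l with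
  | nil => rfl
  | cons v l ih => simp [leaves, map, ih]

theorem map_concat (e : I → J) {n : ℕ} (t : Fin n → Forest I) :
    (concat t).map e = concat (fun i => (t i).map e) := by
  induction n with
  | zero => rfl
  | succ n ih => rw [concat_succ, concat_succ, map_append, ih]

theorem length_concat {n : ℕ} {t : Fin n → Forest I} (h : ∀ i, (t i).length = 1) :
    (concat t).length = n := by
  induction n with
  | zero => rfl
  | succ n ih => rw [concat_succ, length_append, h, ih fun i => h i.succ, Nat.add_comm]

theorem inputs_concat (q : I → ℕ) {n : ℕ} (t : Fin n → Forest I) :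
    (concat t).inputs q = ∑ i, (t i).inputs q := by
  induction n with
  | zero => rfl
  | succ n ih => rw [concat_succ, inputs_append, ih, Fin.sum_univ_succ]

theorem full_concat {q : I → ℕ} {n : ℕ} {t : Fin n → Forest I} (h : ∀ i, (t i).Full q) :
    (concat t).Full q := by
  induction n with
  | zero => trivial
  | succ n ih => rw [concat_succ]; exact full_append (h 0) (ih fun i => h i.succ)

theorem spans_concat {p q r : I → ℕ} {n : ℕ} {t : Fin n → Forest I} (P : Fin (n + 1) → ℕ)
    (h : ∀ i, (t i).Spans p q r (P i.castSucc) (P i.succ)) :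
    (concat t).Spans p q r (P 0) (P (Fin.last n)) := by
  induction n with
  | zero => rfl
  | succ n ih =>
    rw [concat_succ]
    exact spans_append (h 0) (ih (fun i => P i.succ) fun i => h i.succ)

theorem graft_concat {q : I → ℕ} {n : ℕ} {t L : Fin n → Forest I}
    (h : ∀ i, (L i).length = (t i).inputs q) :
    graft q (concat t) (concat L) = concat (fun i => graft q (t i) (L i)) := by
  induction n with
  | zero => rfl
  | succ n ih =>
    rw [concat_succ, concat_succ, concat_succ, graft_append (h 0), ih fun i => h i.succ]

theorem graft_single_leaf {q : I → ℕ} {v : I} {L : Forest I} (h : L.length = q v) :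
    graft q (cons v nil nil) L = cons v L nil := by
  conv_lhs => rw [← append_nil L]
  rw [graft_leaf h]
  rfl

theorem graft_single {q : I → ℕ} {v : I} {c L : Forest I} (h : L.length = c.inputs q) :
    graft q (cons v c nil) L = cons v (graft q c L) nil := by
  by_cases hc : c = nil
  · subst hc
    obtain rfl := length_eq_zero h
    rw [graft_nil, graft_nil]
  · conv_lhs => rw [← append_nil L]
    rw [graft_cons hc h]
    rfl

theorem subst_leaves {J : I → Type} (q : ∀ i, J i → ℕ) (T : ∀ i, Forest (J i)) {n : ℕ}
    (g : Fin n → I) :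
    subst q T (leaves (List.ofFn g)) = concat (fun i => (T (g i)).map (Sigma.mk (g i))) := by
  induction n with
  | zero => rfl
  | succ n ih => rw [List.ofFn_succ, leaves, subst, ih, concat_succ, subst, graft_nil]

theorem contract_leaves {K E : Type} (l : List E) :
    (leaves (l.map Sum.inr) : Forest (K ⊕ E)).contract = nil := by
  induction l with
  | nil => rfl
  | cons v l ih => rw [List.map_cons, leaves, contract, ih]; rfl

/-- The tree with root `v` whose other vertices `g i` are leaves. -/
def star {n : ℕ} (v : I) (g : Fin n → I) : Forest I := cons v (leaves (List.ofFn g)) nil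

theorem map_star (e : I → J) {n : ℕ} (v : I) (g : Fin n → I) :
    (star v g).map e = star (e v) (fun i => e (g i)) := by
  rw [star, map, map_leaves, List.map_ofFn]
  rfl

theorem subst_star {J : I → Type} (q : ∀ i, J i → ℕ) (T : ∀ i, Forest (J i)) {n : ℕ} (v : I)
    (g : Fin n → I) : subst q T (star v g) = graft (fun x => q x.1 x.2) ((T v).map (Sigma.mk v))
      (concat fun i => (T (g i)).map (Sigma.mk (g i))) := by
  rw [star, subst, subst_leaves, subst, append_nil]

/-- The leaves of a star are its `n` outer vertices, also for `n = 0`: then the root is a leaf, the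
row is empty, and grafting changes nothing. -/
theorem graft_star {q : I → ℕ} {n : ℕ} {v : I} {g : Fin n → I} {L : Fin n → Forest I}
    (h : ∀ i, (L i).length = q (g i)) :
    graft q (star v g) (concat L) = cons v (concat fun i => cons (g i) (L i) nil) nil := by
  have hi : ∀ i, (L i).length = (cons (g i) nil nil).inputs q := fun i => by
    rw [h]; rfl
  rw [star, graft_single, leaves_ofFn, graft_concat hi]
  · congr 2
    funext i
    exact graft_single_leaf (h i)
  · rw [leaves_ofFn, inputs_concat]
    clear hi
    induction n with
    | zero => rfl
    | succ n ih =>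
      rw [concat_succ, length_append, h, ih (g := fun i => g i.succ) fun i => h i.succ,
        Fin.sum_univ_succ]
      rfl

/-- The tree with root `inl ()` whose other vertices `inr i` are leaves. -/
abbrev corolla (n : ℕ) : Forest (Unit ⊕ Fin n) := star (.inl ()) .inr

end Forest

/-- The start `s` is free because splitting off the first block shifts all later offsets by `m 0`.
-/
theorem flatten_ofFn_offset {n : ℕ} (m : Fin n → ℕ) (s : ℕ) :
    (List.ofFn fun i => List.ofFn fun j : Fin (m i) => s + (offset m i.castSucc + j)).flatten
      = List.range' s (∑ i, m i) := by
  induction n generalizing s with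
  | zero => rfl
  | succ n ih =>
    rw [List.ofFn_succ, List.flatten_cons, Fin.sum_univ_succ, ← List.range'_append_1,
      ← ih (fun i => m i.succ)]
    congr 1
    · refine List.ext_getElem (by simp) fun i _ _ => ?_
      simp [offset_zero]
    · congr 2
      funext i
      congr 1
      funext j
      rw [← Fin.succ_castSucc, offset_succ', Nat.add_assoc, Nat.add_assoc]

theorem flatten_ofFn_finSigma {n : ℕ} (m : Fin n → ℕ) :
    (List.ofFn fun i => List.ofFn fun j : Fin (m i) => finSigmaFinEquiv ⟨i, j⟩).flatten
      = List.ofFn (fun x : Fin (∑ i, m i) => x) := by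
  refine List.map_injective_iff.mpr Fin.val_injective ?_
  have h := flatten_ofFn_offset m 0
  simp only [Nat.zero_add] at h
  rw [List.map_flatten, List.map_ofFn, List.map_ofFn]
  refine Eq.trans ?_ (h.trans ?_)
  · congr 2
    funext i
    rw [Function.comp_apply, List.map_ofFn]
    congr 1
    funext j
    exact finSigmaFinEquiv_apply _
  · refine List.ext_getElem (by simp) fun i _ _ => ?_
    simp

/-- The stacking consisting of a bottom box and boxes on top of it. -/
def corollaStacking {n : ℕ} (P : Fin (n + 1) → ℕ) (p r : ℕ) (q : Fin n → ℕ)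
    {a : Unit ⊕ Fin n → Colour} {d : Colour} (hb : a (.inl ()) = (p, n, r))
    (ht : ∀ i, a (.inr i) = (P i.castSucc, q i, P i.succ))
    (ho : d = (p + P 0, ∑ i, q i, r + P (Fin.last n))) : Stacking (Unit ⊕ Fin n) a d :=
  have hl : (Forest.corolla n).length = 1 := rfl
  have hn : (Forest.corolla n).labels.Nodup := by
    simp only [Forest.star, Forest.labels, Forest.labels_leaves, List.append_nil,
      List.nodup_cons, List.mem_ofFn, reduceCtorEq, exists_false,
      not_false_eq_true, true_and]
    exact List.nodup_ofFn.mpr Sum.inr_injective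
  { tree := Forest.corolla n
    length_eq := hl
    nodup := hn
    mem_labels := by
      rintro (⟨⟩ | i) <;> simp [Forest.star, Forest.labels, Forest.labels_leaves]
    full := by
      refine ⟨.inr ?_, ?_, trivial⟩
      · simp [Forest.length_leaves, hb]
      · rw [Forest.leaves_ofFn]
        exact Forest.full_concat fun i => ⟨.inl rfl, trivial, trivial⟩
    inputs_eq := by
      rw [ho]
      -- Without top boxes the root is itself the leaf; it contributes its own number of inputs,
      -- which is `0`, the empty sum.
      rcases n with _ | n
      · simp [Forest.star, Forest.leaves, Forest.inputs, hb]
      · rw [Forest.corolla, Forest.star, Forest.inputs_cons _ (by simp [Forest.leaves]),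
          Forest.leaves_ofFn, Forest.inputs_concat]
        simp [Forest.inputs, ht]
    admissible := by
      -- The top boxes have start value `0`, so their row spans from `P 0` to `P (Fin.last n)`. For
      -- `n = 0` the root is a leaf with start value `P 0`, allowed because it has no inputs.
      refine admissible_of_spans hl hn ⟨P 0, P (Fin.last n), ?_, ?_, ?_, ?_⟩
      · rw [Forest.leaves_ofFn]
        exact Forest.spans_concat P fun i =>
          ⟨0, 0, rfl, fun _ _ => rfl, by simp [ht], by simp [ht, Forest.Spans]⟩
      · rcases n with _ | n
        · intro _ h
          simp [hb] at h
        · intro h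
          simp [Forest.leaves] at h
      · simp [ho, hb, Nat.add_comm]
      · simp [ho, hb, Nat.add_comm, Forest.Spans] }

/-- The morphism from the operad of stackings to `Stack[η]`. -/
noncomputable def stackHom : Hom stack (presented StackEtaGen StackEtaRel) where
  map S := cls StackEtaRel (.gen (.stack S))
  map_one c := cls_sound (.one c)
  map_act e S := cls_sound (.act e S)
  map_comp S T := (cls_sound (.comp S T)).trans (cls_comp _ _)

/-- The values in `Stack[η]` of the generators of the box operad. -/
noncomputable def boxVal : ∀ (I : Type) [Finite I] (a : I → Colour) (d : Colour),
    BoxGen I a d → (presented StackEtaGen StackEtaRel).Op I a d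
  | _, _, _, _, .C P p r q hb ht ho => stackHom.map (corollaStacking P p r q hb ht ho)
  | _, _, _, _, .eta z => cls StackEtaRel (.gen (.eta z))

/-- Both sides are the tree with a bottom box, `n` middle boxes and `m i` leaves on the `i`-th
middle box. On the left the row of all top boxes is cut into blocks by grafting; on the right the
blocks are present from the start. The families `T`, `T'` and the functions `Q`, `Q'` are
constrained only by the values needed, so that the composites of the relation fit without rewriting.
-/
theorem assoc_trees {n : ℕ} (m : Fin n → ℕ) {Q : (Σ s : Fin (∑ i, m i) ⊕ Unit,
      Sum.elim (fun _ => Unit) (fun _ => Unit ⊕ Fin n) s) → ℕ}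
    {Q' : (Σ s : Unit ⊕ Fin n, Sum.elim (fun _ => Unit) (fun i => Unit ⊕ Fin (m i)) s) → ℕ}
    (hQ : ∀ i, Q ⟨.inr (), .inr i⟩ = m i) (hQ' : Q' ⟨.inl (), ()⟩ = n)
    (T : ∀ s : Fin (∑ i, m i) ⊕ Unit,
      Forest (Sum.elim (fun _ => Unit) (fun _ => Unit ⊕ Fin n) s))
    (hT : ∀ x, T (.inl x) = .cons () .nil .nil) (hT' : T (.inr ()) = Forest.corolla n)
    (T' : ∀ s : Unit ⊕ Fin n, Forest (Sum.elim (fun _ => Unit) (fun i => Unit ⊕ Fin (m i)) s))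
    (hT1 : T' (.inl ()) = .cons () .nil .nil) (hT1' : ∀ i, T' (.inr i) = Forest.corolla (m i)) :
    (((((Forest.corolla (∑ i, m i)).map (Equiv.sumComm _ _)).subst (fun s j => Q ⟨s, j⟩) T).map
        (fillEquiv _ _)).map (shuffle m))
      = ((Forest.corolla n).subst (fun s j => Q' ⟨s, j⟩) T').map (fillEquiv _ _) := by
  have hm : ∀ e : (Unit ⊕ Fin n) → (Σ s : Fin (∑ i, m i) ⊕ Unit,
      Sum.elim (fun _ => Unit) (fun _ => Unit ⊕ Fin n) s),
      (T (.inr ())).map e = Forest.star (e (.inl ())) (fun i => e (.inr i)) := fun e => by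
    rw [hT']
    exact Forest.map_star e _ _
  -- The row of top boxes is regrouped into the blocks that the middle boxes receive.
  have hx : (Forest.concat fun x => (T (Sum.inl x)).map (Sigma.mk (Sum.inl x)))
      = Forest.concat fun i : Fin n => Forest.leaves (List.ofFn fun j : Fin (m i) =>
        (⟨.inl (finSigmaFinEquiv ⟨i, j⟩), ()⟩ : Σ s : Fin (∑ i, m i) ⊕ Unit,
          Sum.elim (fun _ => Unit) (fun _ => Unit ⊕ Fin n) s)) := by
    rw [Forest.concat_leaves]
    have := congrArg (List.map fun x => (⟨.inl x, ()⟩ : Σ s : Fin (∑ i, m i) ⊕ Unit,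
      Sum.elim (fun _ => Unit) (fun _ => Unit ⊕ Fin n) s)) (flatten_ofFn_finSigma m)
    rw [List.map_flatten, List.map_ofFn, List.map_ofFn] at this
    simp only [Function.comp_def, List.map_ofFn] at this
    rw [this, Forest.leaves_ofFn]
    refine congrArg Forest.concat (funext fun x => ?_)
    rw [hT]
    rfl
  have hm' : ∀ i (e : (Unit ⊕ Fin (m i)) → (Σ s : Unit ⊕ Fin n,
      Sum.elim (fun _ => Unit) (fun i => Unit ⊕ Fin (m i)) s)),
      (T' (.inr i)).map e = Forest.star (e (.inl ())) (fun j => e (.inr j)) := fun i e => by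
    rw [hT1']
    exact Forest.map_star e _ _
  have hr : (T' (Sum.inl ())).map (Sigma.mk (Sum.inl ()))
      = .cons ⟨Sum.inl (), ()⟩ .nil .nil := by
    rw [hT1]
    rfl
  rw [Forest.map_star]
  change Forest.map _ (Forest.map _ (Forest.subst _ T (Forest.star (.inr ()) Sum.inl))) = _
  rw [Forest.subst_star, Forest.subst_star, hr, Forest.graft_single_leaf]
  · refine (congrArg (fun f => Forest.map _ (Forest.map _ f))
      ((congrArg₂ (Forest.graft Q) (hm _) hx).trans (Forest.graft_star fun i => ?_))).trans ?_
    · rw [Forest.length_leaves, List.length_ofFn]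
      exact (hQ i).symm
    · rw [Forest.map_map]
      simp only [Forest.map, Forest.map_concat, Forest.map_leaves, List.map_ofFn]
      refine congrArg (fun f => Forest.cons
        (Sum.inl () : Unit ⊕ Σ i : Fin n, Unit ⊕ Fin (m i)) f Forest.nil) ?_
      refine congrArg Forest.concat (funext fun i => ?_)
      refine Eq.trans ?_ (congrArg (Forest.map (fillEquiv Unit fun i : Fin n => Unit ⊕ Fin (m i)))
        (hm' i fun s => ⟨Sum.inr i, s⟩)).symm
      rw [Forest.map_star]
      refine congrArg (fun l => Forest.cons _ (Forest.leaves l) .nil) ?_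
      refine congrArg List.ofFn (funext fun j => ?_)
      exact (shuffle m).apply_symm_apply (.inr ⟨i, .inr j⟩)
  · rw [Forest.length_concat, hQ']
    exact fun i => congrArg Forest.length (hm' i _)

theorem fill_tree {K E : Type} [Finite K] [Finite E] {J : E → Type} [∀ e, Finite (J e)]
    {c : K ⊕ (Σ e, J e) → Colour} {b : E → Colour} {d : Colour}
    (x : stack.Op (K ⊕ E) (Sum.elim (fun k => c (.inl k)) b) d)
    (y : ∀ e, stack.Op (J e) (fun j => c (.inr ⟨e, j⟩)) (b e)) :
    (stack.fill x y).tree = ((x.tree.subst (fun s j => (c (fillEquiv K J ⟨s, j⟩)).2.1) fun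
      | .inl _ => .cons () .nil .nil
      | .inr e => (y e).tree).map (fillEquiv K J)) := by
  refine congrArg (fun T => Forest.map (fillEquiv K J)
    (x.tree.subst (fun s j => (c (fillEquiv K J ⟨s, j⟩)).2.1) T)) ?_
  funext s
  cases s <;> rfl

theorem boxVal_rel (I : Type) [Finite I] (a : I → Colour) (d : Colour)
    (x y : Term BoxGen I a d) (h : BoxRel I a d x y) :
    x.eval (presented StackEtaGen StackEtaRel) boxVal
      = y.eval (presented StackEtaGen StackEtaRel) boxVal := by
  cases h with
  | @assoc n P p r m P' q =>
    -- No unit occurs in this relation, so both sides are written as images under `stackHom` and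
    -- compared in `stack`, where equality of trees suffices.
    let c₁ : stack.Op (Fin (∑ i, m i) ⊕ Unit)
        (Sum.elim (fun k => assocColour P p r m P' q (shuffle m (.inl k)))
          (fun _ => (p + P 0, ∑ i, m i, r + P (Fin.last n))))
        (p + P 0 + P' 0, ∑ i, ∑ j, q i j, r + P (Fin.last n) + P' (∑ i, m i)) :=
      stack.act (Equiv.sumComm Unit (Fin (∑ i, m i)))
        (corollaStacking (fun j => P' j) (p + P 0) (r + P (Fin.last n))
          (fun x => q (finSigmaFinEquiv.symm x).1 (finSigmaFinEquiv.symm x).2) rfl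
          (fun x => assocColour_shuffle P p r m P' q x) (by rw [sum_flatten]; rfl))
    have hc₁ : stackHom.map c₁ = _ := stackHom.map_act _ _
    have hleft := stackHom.map_fill (K := Fin (∑ i, m i)) (E := Unit)
      (J := fun _ => Unit ⊕ Fin n) (c := fun s => assocColour P p r m P' q (shuffle m s))
      c₁ (fun _ => corollaStacking P p r m rfl (fun _ => rfl) rfl)
    rw [hc₁] at hleft
    have hright := stackHom.map_fill (K := Unit) (E := Fin n) (J := fun i => Unit ⊕ Fin (m i))
      (c := assocColour P p r m P' q)
      (b := fun i => (P i.castSucc + P' (offset m i.castSucc), ∑ j, q i j,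
        P i.succ + P' (offset m i.succ)))
      (d := (p + P 0 + P' 0, ∑ i, ∑ j, q i j, r + P (Fin.last n) + P' (∑ i, m i)))
      (corollaStacking (fun i => P i + P' (offset m i)) p r (fun i => ∑ j, q i j) rfl
        (fun _ => rfl) (by simp only [offset_zero, offset_last, Nat.add_assoc]))
      (fun i => corollaStacking (fun j => P' (offset m i.castSucc + j)) (P i.castSucc) (P i.succ)
        (q i) rfl (fun _ => rfl) (by simp [offset_succ]))
    refine Eq.trans (congrArg ((presented StackEtaGen StackEtaRel).act (shuffle m))
      ((Term.eval_fill _ _ _ _).trans hleft.symm))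
      (Eq.trans ?_ (Term.eval_fill _ _ _ _).symm)
    refine (stackHom.map_act _ _).symm.trans
      (Eq.trans (congrArg stackHom.map (Stacking.ext ?_)) hright)
    refine (congrArg (Forest.map (shuffle m)) (fill_tree _ _)).trans
      (Eq.trans ?_ (fill_tree _ _).symm)
    exact assoc_trees m
      (Q := fun x => (assocColour P p r m P' q (shuffle m (fillEquiv _ _ x))).2.1)
      (Q' := fun x => (assocColour P p r m P' q (fillEquiv _ _ x)).2.1)
      (fun _ => rfl) rfl _ (fun _ => rfl) rfl _ rfl (fun _ => rfl)
  | eta_bottom p q r =>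
    let T : stack.Op (Unit ⊕ Unit) (Sum.elim (fun _ => (p, q, r)) (fun _ => (0, 1, 0))) (p, q, r) :=
      stack.act ((Equiv.sumComm Unit (Fin 1)).trans
        (Equiv.sumCongr (Equiv.ofUnique (Fin 1) Unit) (Equiv.refl Unit)))
        (corollaStacking ![p, r] 0 0 ![q] rfl (fun i => by fin_cases i; rfl) (by simp))
    have hT : stackHom.map T = _ := stackHom.map_act _ _
    refine (Term.eval_plug _ _ _ _).trans ?_
    -- After relabelling, the corolla has the unit vertex `inr ()` as root and `inl ()` as its only
    -- child; contraction leaves the single box.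
    have h := cls_sound (StackEtaRel.eta_bottom T (Stacking.one (p, q, r)) _ ()
      (.inl ⟨rfl, rfl⟩) rfl rfl)
    rw [cls_plug] at h
    refine Eq.trans (congrArg (fun x => (presented StackEtaGen StackEtaRel).plug x _) hT.symm)
      (h.trans ?_)
    exact stackHom.map_one _
  | eta_top p n r =>
    let T : stack.Op (Unit ⊕ Fin n) (Sum.elim (fun _ => (p, n, r)) (fun _ => (0, 1, 0)))
        (p, n, r) :=
      corollaStacking (fun _ => 0) p r (fun _ => 1) rfl (fun _ => rfl) (by simp)
    refine (Term.eval_plug _ _ _ _).trans ?_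
    -- The contraction relation requires at least one child. For `n = 0` no unit is inserted, and
    -- the corolla is already the unit stacking.
    rcases n with _ | n
    · let y : ∀ e : Fin 0, stack.Op Empty
          (fun j => (fun _ => (p, 0, r)) (plugEquiv Unit (Fin 0) (.inr ⟨e, j⟩))) (0, 1, 0) :=
        fun e => e.elim0
      have h := stackHom.map_fill (c := fun s => (fun _ => (p, 0, r)) (plugEquiv Unit (Fin 0) s))
        T y
      refine Eq.trans (congrArg ((presented StackEtaGen StackEtaRel).act (plugEquiv Unit (Fin 0)))
        (Eq.trans (congrArg _ (funext fun e => e.elim0)) h.symm)) ?_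
      refine (stackHom.map_act _ _).symm.trans (Eq.trans (congrArg stackHom.map
        (Stacking.ext ?_)) (stackHom.map_one _))
      exact congrArg (Forest.map (plugEquiv Unit (Fin 0))) (fill_tree _ _)
    · have h := cls_sound (StackEtaRel.eta_top n.succ_pos T (Stacking.one (p, n + 1, r)) _ ()
        (.inl ⟨rfl, rfl⟩) (Forest.roots_leaves _) (by
          change Forest.cons () .nil .nil
            = Forest.cons () (Forest.leaves (List.ofFn Sum.inr)).contract .nil
          have hl : List.ofFn (Sum.inr : Fin (n + 1) → Unit ⊕ Fin (n + 1))
              = (List.ofFn id).map Sum.inr := by rw [List.map_ofFn]; rfl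
          rw [hl, Forest.contract_leaves]))
      rw [cls_plug] at h
      exact h.trans (stackHom.map_one _)

/-- The comparison morphism from the box operad to `Stack[η]`. -/
noncomputable def boxToStackEta :
    Hom (presented BoxGen BoxRel) (presented StackEtaGen StackEtaRel) :=
  lift _ boxVal boxVal_rel

end BoxOp

/-! ### Injectivity of the comparison morphism -/

namespace BoxOp

open ColouredOperad

theorem BoxAlgebra.eval_leaves {A : BoxAlgebra.{w}} {I : Type} {env : I → A.B} {n : ℕ}
    (P : Fin (n + 1) → ℕ) (g : Fin n → I) (hl : ∀ i, (A.col (env (g i))).1 = P i.castSucc)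
    (hr : ∀ i, (A.col (env (g i))).2.2 = P i.succ) :
    A.eval env (Forest.leaves (List.ofFn g)) (P 0) = List.ofFn fun i => env (g i) := by
  induction n with
  | zero => rfl
  | succ n ih =>
    -- Writing the left depth as `0` plus the label exhibits the start value `0` of the leaf, which
    -- makes `box` act trivially on it.
    have h0 : P 0 = 0 + (A.col (env (g 0))).1 := by rw [hl, Nat.zero_add]; rfl
    rw [List.ofFn_succ, List.ofFn_succ, Forest.leaves, h0, eval_cons]
    refine congrArg₂ List.cons (box_zero_nil _) ?_
    refine Eq.trans ?_ (ih (fun i => P i.succ) (fun i => g i.succ) (fun i => hl i.succ)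
      fun i => hr i.succ)
    congr 1
    refine (congrArg (fun b => (A.col b).2.2) (box_zero_nil _)).trans (hr 0)

/-- The top boxes are leaves with start value `0`, hence evaluate to themselves, and the root
applies one `C` to them. The action of stackings thus restricts to the given one on generators. -/
theorem stackAct_corollaStacking {A : Colour → Type w}
    (ρ : Hom (presented BoxGen BoxRel) (endo A)) {n : ℕ} (P : Fin (n + 1) → ℕ) (p r : ℕ)
    (q : Fin n → ℕ) {a : Unit ⊕ Fin n → Colour} {d : Colour} (hb : a (.inl ()) = (p, n, r))
    (ht : ∀ i, a (.inr i) = (P i.castSucc, q i, P i.succ))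
    (ho : d = (p + P 0, ∑ i, q i, r + P (Fin.last n))) (z : ∀ s, A (a s)) :
    stackAct ρ (corollaStacking P p r q hb ht ho) z
      = ρ.map (cls BoxRel (.gen (.C P p r q hb ht ho))) z := by
  refine eq_of_heq (Sigma.mk.inj ((stackAct_eq ρ _ z).trans
    (Eq.trans ?_ (map_gen_eq_boxOf ρ P p r q hb ht ho z).symm))).2
  have hd : d.1 = P 0 + ((boxAlgebra ρ).col (bundle ρ z (.inl ()))).1 := by
    rw [ho, Nat.add_comm]
    exact congrArg (P 0 + ·.1) hb.symm
  rw [hd, BoxAlgebra.val]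
  refine (congrArg (fun L => L.headD (boxAlgebra ρ).eta)
    (BoxAlgebra.eval_cons (A := boxAlgebra ρ) _ _ _ _)).trans ?_
  refine congrArg (boxOf ρ _ (P 0)) ?_
  exact BoxAlgebra.eval_leaves (A := boxAlgebra ρ) (env := bundle ρ z) P .inr
    (fun i => congrArg (·.1) (ht i)) (fun i => congrArg (·.2.2) (ht i))

theorem stackEtaHom_boxToStackEta {A : Colour → Type w}
    (ρ : Hom (presented BoxGen BoxRel) (endo A)) {I : Type} [Finite I] {a : I → Colour}
    {d : Colour} (x : (presented BoxGen BoxRel).Op I a d) :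
    (stackEtaHom ρ).map (boxToStackEta.map x) = ρ.map x := by
  refine hom_ext (f := boxToStackEta.trans (stackEtaHom ρ)) (g := ρ) (fun g => ?_) x
  cases g with
  | C P p r q hb ht ho => exact funext fun z => stackAct_corollaStacking ρ P p r q hb ht ho z
  | eta z => rfl

/-- The action on the free algebra over the box operad factors through the comparison morphism and
is faithful. -/
theorem boxToStackEta_injective {I : Type} [Finite I] {a : I → Colour} {d : Colour} :
    Function.Injective (boxToStackEta.map : (presented BoxGen BoxRel).Op I a d → _) := by
  intro x y h
  refine freeHom_injective ?_
  rw [← stackEtaHom_boxToStackEta, h, stackEtaHom_boxToStackEta]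

/-! ### Surjectivity: cutting a stacking into corollas -/

namespace Forest

variable {I J : Type}

theorem exists_map_val_eq {s : I → Prop} (f : Forest I) (h : ∀ v ∈ f.labels, s v) :
    ∃ g : Forest {v // s v}, g.map Subtype.val = f := by
  induction f with
  | nil => exact ⟨nil, rfl⟩
  | cons v c f ihc ihf =>
    simp only [labels, List.mem_cons, List.mem_append, forall_eq_or_imp] at h
    obtain ⟨c', rfl⟩ := ihc fun u hu => h.2 u (.inl hu)
    obtain ⟨f', rfl⟩ := ihf fun u hu => h.2 u (.inr hu)
    exact ⟨cons ⟨v, h.1⟩ c' f', rfl⟩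

theorem map_eq_nil {e : I → J} {f : Forest I} : f.map e = nil ↔ f = nil :=
  ⟨fun h => by_contra fun hne => map_ne_nil hne h, fun h => by rw [h]; rfl⟩

theorem full_of_map {q : J → ℕ} {e : I → J} {f : Forest I} (h : (f.map e).Full q) :
    f.Full (fun i => q (e i)) := by
  induction f with
  | nil => trivial
  | cons v c f ihc ihf =>
    obtain ⟨h1, h2, h3⟩ := h
    rw [map_eq_nil, length_map] at h1
    exact ⟨h1, ihc h2, ihf h3⟩

theorem spans_of_map {p q r : J → ℕ} {e : I → J} {f : Forest I} {x y : ℕ}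
    (h : Spans p q r (f.map e) x y) :
    Spans (fun i => p (e i)) (fun i => q (e i)) (fun i => r (e i)) f x y := by
  induction f generalizing x y with
  | nil => exact h
  | cons v c f ihc ihf =>
    obtain ⟨x', y', h1, h2, h3, h4⟩ := h
    exact ⟨x', y', ihc h1, fun hc => h2 (map_eq_nil.mpr hc), h3, ihf h4⟩

/-- The labels `P` are the depths at the gaps between adjacent trees; since adjacent depths agree,
each gap has a single label. -/
theorem exists_concat {p q r : I → ℕ} {n : ℕ} {c : Forest I} {x y : ℕ} (hn : c.length = n)
    (hf : c.Full q) (hs : c.Spans p q r x y) :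
    ∃ (P : Fin (n + 1) → ℕ) (t : Fin n → Forest I), c = concat t ∧ P 0 = x ∧
      P (Fin.last n) = y ∧ ∀ i, (t i).length = 1 ∧ (t i).Full q ∧
        (t i).Spans p q r (P i.castSucc) (P i.succ) ∧ (t i).labels.Sublist c.labels := by
  induction n generalizing c x with
  | zero =>
    obtain rfl := length_eq_zero hn
    exact ⟨fun _ => x, fun i => i.elim0, rfl, rfl, hs, fun i => i.elim0⟩
  | succ n ih =>
    cases c with
    | nil => simp [length] at hn
    | cons v c f =>
      obtain ⟨h1, h2, h3⟩ := hf
      obtain ⟨x', y', h4, h5, h6, h7⟩ := hs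
      obtain ⟨P, t, rfl, h8, h9, h10⟩ := ih (by simpa [length] using hn) h3 h7
      refine ⟨Fin.cons x P, Fin.cons (cons v c nil) t, ?_, rfl, ?_, Fin.cases ?_ fun i => ?_⟩
      · rw [concat_succ]
        rfl
      · rw [← Fin.succ_last, Fin.cons_succ, h9]
      · refine ⟨rfl, ⟨h1, h2, trivial⟩, ⟨x', y', h4, h5, h6, ?_⟩, ?_⟩
        · exact h8.symm
        · simp [labels]
      · obtain ⟨h11, h12, h13, h14⟩ := h10 i
        refine ⟨h11, h12, h13, ?_⟩
        simp only [Fin.cons_succ, labels]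
        exact (h14.trans (List.sublist_append_right _ _)).cons _

end Forest

/-- A subtree becomes a stacking of its own only after restriction to its set of vertices. Its
output colour is given by its two depths and its open inputs. -/
theorem exists_restrict {I : Type} (a : I → Colour) {t : Forest I} (hl : t.length = 1)
    (hn : t.labels.Nodup) (hf : t.Full fun i => (a i).2.1) {x y : ℕ}
    (hs : t.Spans (fun i => (a i).1) (fun i => (a i).2.1) (fun i => (a i).2.2) x y) :
    ∃ S : Stacking {v // v ∈ t.labels} (fun v => a v) (x, t.inputs fun i => (a i).2.1, y),
      S.tree.map Subtype.val = t := by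
  obtain ⟨g, hg⟩ := Forest.exists_map_val_eq (s := (· ∈ t.labels)) t fun _ h => h
  have hlab := congrArg Forest.labels hg
  rw [Forest.labels_map] at hlab
  have hl' : g.length = 1 := by rw [← Forest.length_map Subtype.val, hg, hl]
  have hn' : g.labels.Nodup := by rw [← hlab] at hn; exact hn.of_map
  refine ⟨⟨g, hl', hn', fun v => ?_, ?_, ?_, admissible_of_spans hl' hn' ?_⟩, hg⟩
  · obtain ⟨w, hw, hwv⟩ := List.mem_map.mp (hlab.symm ▸ v.2 : v.1 ∈ g.labels.map Subtype.val)
    exact Subtype.ext hwv ▸ hw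
  · rw [← hg] at hf
    exact Forest.full_of_map (q := fun i => (a i).2.1) hf
  · exact (Forest.inputs_map (fun i => (a i).2.1) Subtype.val g).symm.trans
      (congrArg (Forest.inputs fun i => (a i).2.1) hg)
  · rw [← hg] at hs
    exact Forest.spans_of_map (p := fun i => (a i).1) (q := fun i => (a i).2.1)
      (r := fun i => (a i).2.2) hs

theorem exists_map_eq_of_leaf {I : Type} [Finite I] {a : I → Colour} {d : Colour}
    (S : Stacking I a d) {v : I} (hS : S.tree = .cons v .nil .nil) (hd : d = a v) :
    ∃ x, boxToStackEta.map x = stackHom.map S := by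
  subst hd
  have hv : ∀ i, v = i := fun i => by
    have := S.mem_labels i
    rw [hS] at this
    simpa [Forest.labels, eq_comm] using this
  let e : Unit ≃ I := Equiv.ofBijective (fun _ => v) ⟨fun _ _ _ => rfl, fun i => ⟨(), hv i⟩⟩
  refine ⟨(presented BoxGen BoxRel).act e ((presented BoxGen BoxRel).one (a v)), ?_⟩
  refine (boxToStackEta.map_act (b := a) e _).trans ?_
  refine (congrArg ((presented StackEtaGen StackEtaRel).act (b := a) e)
    ((boxToStackEta.map_one (a v)).trans (stackHom.map_one (a v)).symm)).trans ?_
  refine (stackHom.map_act (b := a) e (Stacking.one (a v))).symm.trans (congrArg stackHom.map ?_)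
  exact Stacking.ext hS.symm

/-- The image of the comparison is closed under composition and relabelling. That `f` is a bijection
onto `I` follows from the labels of `S`: they are distinct and exhaust `I`. -/
theorem exists_map_eq_of_comp {I : Type} [Finite I] {a : I → Colour} {d : Colour}
    (S : Stacking I a d) {n : ℕ} {J : Unit ⊕ Fin n → Type} [∀ s, Finite (J s)]
    {f : ∀ s, J s → I} {b : Unit ⊕ Fin n → Colour} (U : Stacking (Unit ⊕ Fin n) b d)
    (R : ∀ s, Stacking (J s) (fun j => a (f s j)) (b s))
    (h : S.tree = (U.comp R).tree.map fun x => f x.1 x.2)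
    (hU : ∃ x, boxToStackEta.map x = stackHom.map U)
    (hR : ∀ s, ∃ x, boxToStackEta.map x = stackHom.map (R s)) :
    ∃ x, boxToStackEta.map x = stackHom.map S := by
  have hlab := congrArg Forest.labels h
  rw [Forest.labels_map] at hlab
  let e : (Σ s, J s) ≃ I := Equiv.ofBijective (fun x => f x.1 x.2) ⟨fun x y hxy => by
    have hn := S.nodup
    rw [hlab] at hn
    exact List.inj_on_of_nodup_map hn ((U.comp R).mem_labels x) ((U.comp R).mem_labels y) hxy,
    fun i => by
      have hi := S.mem_labels i
      rw [hlab] at hi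
      obtain ⟨x, -, hx⟩ := List.mem_map.mp hi
      exact ⟨x, hx⟩⟩
  obtain ⟨u, hu⟩ := hU
  choose ρ hρ using hR
  refine ⟨(presented BoxGen BoxRel).act e ((presented BoxGen BoxRel).comp u ρ), ?_⟩
  refine (boxToStackEta.map_act (b := a) e _).trans ?_
  refine (congrArg ((presented StackEtaGen StackEtaRel).act (b := a) e)
    ((boxToStackEta.map_comp u ρ).trans (Eq.trans ?_ (stackHom.map_comp U R).symm))).trans ?_
  · rw [hu, funext hρ]
  refine (stackHom.map_act (b := a) e _).symm.trans (congrArg stackHom.map ?_)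
  exact Stacking.ext h.symm

/-- Strong induction on the number of vertices, since the subtrees at the children of the root are
smaller stackings. -/
theorem exists_map_eq_stackHom {I : Type} [Finite I] {a : I → Colour} {d : Colour}
    (S : Stacking I a d) : ∃ x, boxToStackEta.map x = stackHom.map S := by
  induction hk : S.tree.labels.length using Nat.strong_induction_on generalizing I a d with
  | _ k ih =>
  obtain ⟨v, c, hS⟩ : ∃ v c, S.tree = .cons v c .nil := by
    have := S.length_eq
    rcases hT : S.tree with _ | ⟨v, c, f⟩
    · simp [hT, Forest.length] at this
    · simp only [hT, Forest.length, Nat.add_eq_right] at this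
      exact ⟨v, c, by rw [Forest.length_eq_zero this]⟩
  have hn := S.nodup
  have hf := S.full
  have hi := S.inputs_eq
  have hs := spans_of_admissible S.admissible
  rw [hS] at hn hf hi hs hk
  obtain ⟨x, y, hs, h0, hx, hy⟩ := hs
  -- The first case includes a lone leaf without inputs: with a positive start value it is not a
  -- unit, and it comes from `C` with an empty row. In the second case the leaf has inputs, so its
  -- start value is `0` and it is a unit.
  by_cases hc : c.length = (a v).2.1
  · obtain ⟨P, t, rfl, rfl, rfl, ht⟩ := Forest.exists_concat hc hf.2.1 hs
    have hsub : ∀ i, (t i).labels.length < k := fun i => by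
      have := (ht i).2.2.2.length_le
      simp only [Forest.labels, List.append_nil, List.length_cons] at hk
      omega
    have hnc := (List.nodup_cons.mp hn).2
    simp only [Forest.labels, List.append_nil] at hnc
    -- The root alone goes into the bottom input of the corolla, and the subtrees go into the top
    -- inputs.
    let T : Unit ⊕ Fin (a v).2.1 → Forest I := Sum.elim (fun _ => .cons v .nil .nil) t
    let b : Unit ⊕ Fin (a v).2.1 → Colour := Sum.elim (fun _ => a v) fun i =>
      (P i.castSucc, (t i).inputs fun i => (a i).2.1, P i.succ)
    have hT : ∀ s, ∃ R : Stacking {w // w ∈ (T s).labels} (fun w => a w) (b s),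
        R.tree.map Subtype.val = T s := by
      rintro (⟨⟩ | i)
      · exact exists_restrict a (t := .cons v .nil .nil) rfl
          (by simp [Forest.labels]) ⟨.inl rfl, trivial, trivial⟩ (x := (a v).1) (y := (a v).2.2)
          ⟨0, 0, rfl, fun _ _ => rfl, (Nat.zero_add _).symm, Nat.zero_add _⟩
      · exact exists_restrict a (ht i).1 (hnc.sublist (ht i).2.2.2) (ht i).2.1 (ht i).2.2.1
    choose R hR using hT
    have ho : d = ((a v).1 + P 0, ∑ i, (t i).inputs fun i => (a i).2.1,
        (a v).2.2 + P (Fin.last _)) := by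
      refine Prod.ext (hx.trans (Nat.add_comm _ _)) (Prod.ext ?_ (hy.symm.trans (Nat.add_comm _ _)))
      rw [← hi]
      by_cases h : Forest.concat t = .nil
      · have hz : (a v).2.1 = 0 := by rw [← hc, h]; rfl
        have := Forest.inputs_concat (fun i => (a i).2.1) t
        rw [h] at this ⊢
        exact (Nat.add_zero _).trans (hz.trans this)
      · rw [Forest.inputs_cons v h, Forest.inputs_concat]
        rfl
    refine exists_map_eq_of_comp S (J := fun s => {w // w ∈ (T s).labels}) (b := b)
      (f := fun _ w => w.1)
      (corollaStacking P (a v).1 (a v).2.2 (fun i => (t i).inputs fun i => (a i).2.1) rfl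
        (fun _ => rfl) ho) R ?_
      ⟨cls BoxRel (.gen (.C (a := b) P (a v).1 (a v).2.2 _ rfl (fun _ => rfl) ho)), rfl⟩ ?_
    · rw [hS]
      refine Eq.symm ((congrArg (Forest.map fun x : Σ s, {w // w ∈ (T s).labels} => x.2.1)
        (Forest.subst_star (fun s (w : {w // w ∈ (T s).labels}) => (a w).2.1)
          (fun s => (R s).tree) _ _)).trans ?_)
      refine (Forest.map_graft (fun i => (a i).2.1) (fun x : Σ s, {w // w ∈ (T s).labels} => x.2.1)
        _ _).trans ?_
      rw [Forest.map_map, Forest.map_concat]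
      simp only [Forest.map_map]
      refine (congrArg₂ (Forest.graft fun i => (a i).2.1) (hR (.inl ()))
        (congrArg Forest.concat (funext fun i => hR (.inr i)))).trans ?_
      exact Forest.graft_single_leaf hc
    · rintro (⟨⟩ | i)
      -- The bottom factor is a single box of its own colour, hence a unit. The induction hypothesis
      -- could not be used here, because the factor is not smaller than `S` when `S` has only one
      -- vertex.
      · have h := hR (.inl ())
        rcases hT : (R (.inl ())).tree with _ | ⟨w, c', f⟩
        · simp [hT, T, Forest.map] at h
        · rw [hT] at h
          obtain ⟨hw, hc', hf'⟩ := Forest.cons.inj h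
          rw [Forest.map_eq_nil] at hc' hf'
          subst hc' hf'
          exact exists_map_eq_of_leaf _ hT (congrArg a hw).symm
      · refine ih _ (hsub i) _ ?_
        refine Eq.trans ?_ (congrArg (fun f => f.labels.length) (hR (.inr i)))
        rw [Forest.labels_map, List.length_map]
  · obtain rfl : c = .nil := hf.1.resolve_right hc
    have hq : 0 < (a v).2.1 := Nat.pos_of_ne_zero fun h => hc h.symm
    obtain rfl := h0 rfl hq
    obtain rfl := hs
    refine exists_map_eq_of_leaf S hS (Prod.ext ?_ (Prod.ext hi.symm ?_))
    · rw [hx, Nat.zero_add]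
    · exact hy.symm.trans (Nat.zero_add _)

theorem boxToStackEta_surjective {I : Type} [Finite I] {a : I → Colour} {d : Colour} :
    Function.Surjective (boxToStackEta.map : (presented BoxGen BoxRel).Op I a d → _) := by
  intro y
  refine presented_induction (M := fun y => ∃ x, boxToStackEta.map x = y) ?_ ?_ ?_ ?_ y
  · intro I _ a d g
    cases g with
    | stack S => exact exists_map_eq_stackHom S
    | eta z => exact ⟨cls BoxRel (.gen (.eta z)), rfl⟩
  · exact fun c => ⟨_, boxToStackEta.map_one c⟩
  · rintro I J _ _ b d e _ ⟨x, rfl⟩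
    exact ⟨_, boxToStackEta.map_act e x⟩
  · rintro I J _ _ a b d _ y ⟨x, rfl⟩ hy
    choose z hz using hy
    obtain rfl := funext hz
    exact ⟨_, boxToStackEta.map_comp x z⟩

end BoxOp

theorem mainTheorem2 : Nonempty (ColouredOperad.Iso BoxOp.boxOperad BoxOp.stackEta) :=
  ⟨BoxOp.boxToStackEta.toIso fun _ _ _ _ =>
    ⟨BoxOp.boxToStackEta_injective, BoxOp.boxToStackEta_surjective⟩⟩
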